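/- Let $M$ be a connected smooth 4-manifold with a smooth Lorentz metric $g$ of signature $(-,+,+,+)$, and suppose that $(M,g)$ is a perfect-fluid space-time: there are a smooth vector field $u$ with $g(u,u)=-1$ and smooth functions $\mu, p : M\to\mathbb{R}$ such that Einstein's equation $$R_{ab}-\tfrac12 R\,g_{ab}=8\pi T_{ab},\qquad T_{ab}=(\mu+p)u_au_b+p\,g_{ab},$$ holds on $M$, where $R_{ab}$ is the Ricci tensor and $R$ the scalar curvature of $g$. Suppose that $\mu+p\neq 0$ at every point of $M$. Then $(M,g)$ is a Yang Pure Space, i.e. $\nabla_aR_{bc}-\nabla_bR_{ac}=0$ on $M$ (with $\nabla$ the Levi-Civita connection of $g$), if and only if $(M,g)$ is a Robertson-Walker space-time and there is a constant $c\in\mathbb{R}$ with $p=\tfrac13\mu+c$ on $M$. Here $(M,g)$ is called a Robertson-Walker space-time if, for some $k\in\{-1,0,1\}$, every point of $M$ has a coordinate neighbourhood with coordinates $(t,x,y,z)$ in which $1+\tfrac{k}{4}(x^2+y^2+z^2)>0$ and $$g=-dt^2+\frac{A(t)^2}{\bigl(1+\frac{k}{4}(x^2+y^2+z^2)\bigr)^2}\,(dx^2+dy^2+dz^2)$$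 for some smooth positive function $A$ of $t$ (which may depend on the neighbourhood). -/

import Mathlib

open scoped Manifold ContDiff

noncomputable section

namespace YangPure

/-! ### Tensor calculus in coordinates on `ℝ⁴`

Coordinates are numbered `0, 1, 2, 3`; the metric is given by the matrix `G y` of its
components at the point `y` of the coordinate domain. -/

/-- The coordinate space `ℝ⁴`. -/
abbrev E4 : Type := EuclideanSpace ℝ (Fin 4)

/-- The partial derivative `∂ᵢ f`. -/
def pd (i : Fin 4) (f : E4 → ℝ) (y : E4) : ℝ :=
  fderiv ℝ f y (EuclideanSpace.single i 1)

/-- The Christoffel symbols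
`Γᵏᵢⱼ = ½ gᵏˡ (∂ᵢ gₗⱼ + ∂ⱼ gₗᵢ - ∂ₗ gᵢⱼ)` of the Levi-Civita connection. -/
def christoffel (G : E4 → Matrix (Fin 4) (Fin 4) ℝ) (k i j : Fin 4) (y : E4) : ℝ :=
  (1 / 2 : ℝ) * ∑ l, (G y)⁻¹ k l *
    (pd i (fun z => G z l j) y + pd j (fun z => G z l i) y - pd l (fun z => G z i j) y)

/-- The components `Rᵃ_bcd = ∂_c Γᵃ_db - ∂_d Γᵃ_cb + Γᵃ_ce Γᵉ_db - Γᵃ_de Γᵉ_cb` of the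
Riemann tensor. -/
def riemann (G : E4 → Matrix (Fin 4) (Fin 4) ℝ) (a b c d : Fin 4) (y : E4) : ℝ :=
  pd c (christoffel G a d b) y - pd d (christoffel G a c b) y
    + ∑ e, (christoffel G a c e y * christoffel G e d b y
      - christoffel G a d e y * christoffel G e c b y)

/-- The components `R_bd = Rᵃ_bad` of the Ricci tensor. -/
def ricci (G : E4 → Matrix (Fin 4) (Fin 4) ℝ) (b d : Fin 4) (y : E4) : ℝ :=
  ∑ a, riemann G a b a d y

/-- The scalar curvature `R = gᵃᵇ R_ab`. -/
def scalarCurv (G : E4 → Matrix (Fin 4) (Fin 4) ℝ) (y : E4) : ℝ :=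
  ∑ a, ∑ b, (G y)⁻¹ a b * ricci G a b y

/-- The components `∇ₐ R_bc = ∂ₐ R_bc - Γᵈ_ab R_dc - Γᵈ_ac R_bd` of the covariant derivative
of the Ricci tensor. -/
def covRicci (G : E4 → Matrix (Fin 4) (Fin 4) ℝ) (a b c : Fin 4) (y : E4) : ℝ :=
  pd a (ricci G b c) y
    - ∑ d, (christoffel G d a b y * ricci G d c y + christoffel G d a c y * ricci G b d y)

/-! ### Lorentz 4-manifolds -/

section Manifold

variable {M : Type*} [TopologicalSpace M] [ChartedSpace E4 M] [IsManifold (𝓡 4) ∞ M]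

variable (M) in
/-- A smooth Lorentz metric, of signature `(-,+,+,+)`, on the smooth 4-manifold `M`. -/
structure LorentzMetric where
  /-- The bilinear form on each tangent space. -/
  val (x : M) : TangentSpace (𝓡 4) x →L[ℝ] TangentSpace (𝓡 4) x →L[ℝ] ℝ
  symm (x : M) (v w : TangentSpace (𝓡 4) x) : val x v w = val x w v
  lorentzian (x : M) : ∃ b : Module.Basis (Fin 4) ℝ (TangentSpace (𝓡 4) x), ∀ i j,
    val x (b i) (b j) = if i = j then (if i = 0 then -1 else 1) else 0
  contMDiff : ContMDiff (𝓡 4) ((𝓡 4).prod 𝓘(ℝ, E4 →L[ℝ] E4 →L[ℝ] ℝ)) ∞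
    (fun x => Bundle.TotalSpace.mk' (E4 →L[ℝ] E4 →L[ℝ] ℝ)
      (E := fun x : M => TangentSpace (𝓡 4) x →L[ℝ] TangentSpace (𝓡 4) x →L[ℝ] ℝ) x (val x))

/-- The coordinate vector `∂ᵢ` of the chart `e`, at the point with coordinates `y`. -/
def coordVec (e : OpenPartialHomeomorph M E4) (i : Fin 4) (y : E4) :
    TangentSpace (𝓡 4) (e.symm y) :=
  mfderiv (𝓡 4) (𝓡 4) e.symm y (EuclideanSpace.single i (1 : ℝ) : E4)

/-- The components `gᵢⱼ = g(∂ᵢ, ∂ⱼ)` of a metric in the chart `e`. -/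
def LorentzMetric.comp (g : LorentzMetric M) (e : OpenPartialHomeomorph M E4) (y : E4) :
    Matrix (Fin 4) (Fin 4) ℝ :=
  Matrix.of fun i j => g.val (e.symm y) (coordVec e i y) (coordVec e j y)

/-- The covariant components `uᵢ = g(u, ∂ᵢ)` of a vector field `u` in the chart `e`. -/
def LorentzMetric.lowerComp (g : LorentzMetric M) (u : (x : M) → TangentSpace (𝓡 4) x)
    (e : OpenPartialHomeomorph M E4) (i : Fin 4) (y : E4) : ℝ :=
  g.val (e.symm y) (u (e.symm y)) (coordVec e i y)

/-- `(M, g)` is a Yang Pure Space: `∇ₐ R_bc - ∇_b R_ac = 0`, in all coordinates of the smooth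
structure. -/
def LorentzMetric.IsYangPureSpace (g : LorentzMetric M) : Prop :=
  ∀ e ∈ IsManifold.maximalAtlas (𝓡 4) ∞ M, ∀ y ∈ e.target, ∀ a b c : Fin 4,
    covRicci (g.comp e) a b c y - covRicci (g.comp e) b a c y = 0

/-- `(M, g)` is a perfect-fluid space-time with four-velocity `u`, energy density `μ` and
pressure `p`: Einstein's equation `R_ab - ½ R g_ab = 8π T_ab` holds with
`T_ab = (μ + p) u_a u_b + p g_ab`, where `g(u, u) = -1`. -/
structure LorentzMetric.IsPerfectFluid (g : LorentzMetric M)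
    (u : (x : M) → TangentSpace (𝓡 4) x) (μ p : M → ℝ) : Prop where
  contMDiff_velocity : ContMDiff (𝓡 4) (𝓡 4).tangent ∞
    (fun x => (⟨x, u x⟩ : TangentBundle (𝓡 4) M))
  contMDiff_density : ContMDiff (𝓡 4) 𝓘(ℝ, ℝ) ∞ μ
  contMDiff_pressure : ContMDiff (𝓡 4) 𝓘(ℝ, ℝ) ∞ p
  unit (x : M) : g.val x (u x) (u x) = -1
  einstein : ∀ e ∈ IsManifold.maximalAtlas (𝓡 4) ∞ M, ∀ y ∈ e.target, ∀ a b : Fin 4,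
    ricci (g.comp e) a b y - (1 / 2 : ℝ) * scalarCurv (g.comp e) y * g.comp e y a b
      = 8 * Real.pi *
        ((μ (e.symm y) + p (e.symm y)) * g.lowerComp u e a y * g.lowerComp u e b y
          + p (e.symm y) * g.comp e y a b)

/-- The matrix of the Robertson-Walker line element
`-dt² + A(t)² (1 + (k/4)(x² + y² + z²))⁻² (dx² + dy² + dz²)` at the point
`y = (t, x, y, z)`. -/
def rwMatrix (k : ℝ) (A : ℝ → ℝ) (y : E4) : Matrix (Fin 4) (Fin 4) ℝ :=
  Matrix.diagonal fun i => if i = 0 then -1 else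
    (A (y 0)) ^ 2 / (1 + k / 4 * ((y 1) ^ 2 + (y 2) ^ 2 + (y 3) ^ 2)) ^ 2

/-- `(M, g)` is a Robertson-Walker space-time: for one curvature index `k ∈ {-1, 0, 1}`, every
point has a coordinate neighbourhood in which `g` is the Robertson-Walker line element with
curvature index `k` and some smooth positive scale factor. -/
def LorentzMetric.IsRobertsonWalker (g : LorentzMetric M) : Prop :=
  ∃ k : ℝ, (k = -1 ∨ k = 0 ∨ k = 1) ∧
    ∀ x : M, ∃ e ∈ IsManifold.maximalAtlas (𝓡 4) ∞ M, x ∈ e.source ∧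
      ∃ A : ℝ → ℝ, ∀ y ∈ e.target,
        0 < A (y 0) ∧ ContDiffAt ℝ ∞ A (y 0) ∧
        0 < 1 + k / 4 * ((y 1) ^ 2 + (y 2) ^ 2 + (y 3) ^ 2) ∧
        g.comp e y = rwMatrix k A y

end Manifold

end YangPure

end

set_option maxSynthPendingDepth 3

/-! Einstein's equation gives Ric = F u⊗u + h g with F = 8π(μ + p), nowhere zero, and h = 4π(μ - p),
and both directions work with this form in a chart.

From Yang to Robertson-Walker. The Codazzi equation turns the contracted Bianchi identity into 2 dR
= dR, so R = -F + 4h has no gradient: this is the equation of state, since F - 4h = 24π(p - μ/3).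
Given dF = 4 dh, the Codazzi equation read in a frame adapted to u forces ∇u = H (g + u⊗u) and dh =
F H u (`pd_h_and_covVec_velocity`). The Ricci identity then gives every curvature component with a
slot in the direction u, and the remaining part is three-dimensional, hence determined by Ric. So
the whole curvature is algebraic in u, g, F, h (`pd_expansion_and_riemannLow`). In particular u =
-dt locally, and there is A > 0 with dA = A H dt and E A² = k ∈ {-1, 0, 1}, where E = (F + 2h)/6 -
H² is the curvature of the slices.

It remains to find the spatial coordinates. On the unit sphere, on flat space and on hyperbolic
space the affine functions of the ambient space are characterised by a Hessian equation. Its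
space-time version is integrable because the curvature is known, and it is solved by a Frobenius
theorem for linear systems (`exists_flat_solution`, `exists_solution_of_integrable`,
`exists_hessianSolution`). The first integral A²⟨dq, dr⟩ + k q r supplies all inner products, and
stereographic projection yields coordinates in which g has the required form (`exists_rwFunctions`,
`IsRWFunctions.exists_chart`). Finally k is the sign of E, a function on M, so connectedness gives
the same k everywhere.

From Robertson-Walker to Yang. The covector τ = dt is unit timelike with ∇τ = H (g + τ⊗τ), hence an
eigenvector of Ric. As F ≠ 0, this forces u⊗u = τ⊗τ (`velocity_mul_eq`). The equation of state gives
dF = 4 dh, the contracted Bianchi identity gives dh = F H τ, and then ∇Ric is visibly totally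
symmetric (`fluidChart_of_covVec_eq`). The Robertson-Walker coordinates are used as functions in an
arbitrary chart, so no transformation law for ∇Ric is needed. -/

namespace YangPure

/-! ### Frobenius theorem for flat linear systems -/

section FlatSystem

open Set Metric

variable {E W : Type*} [NormedAddCommGroup E] [NormedSpace ℝ E]
  [NormedAddCommGroup W] [NormedSpace ℝ W]

/-- A time-dependent linear differential equation with small coefficients has a solution on
`[0, 1]`. -/
theorem exists_linear_ode_solution [CompleteSpace W] (B : ℝ → W →L[ℝ] W)
    (hB : ContinuousOn B (Icc 0 1)) (hB' : ∀ r ∈ Icc (0 : ℝ) 1, ‖B r‖ ≤ 1 / 4) (V₀ : W) :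
    ∃ Y : ℝ → W, Y 0 = V₀ ∧ ContinuousOn Y (Icc 0 1) ∧
      (∀ r ∈ Ico (0 : ℝ) 1, HasDerivWithinAt Y (B r (Y r)) (Ici r) r) ∧
      ∀ r ∈ Icc (0 : ℝ) 1, ‖Y r‖ ≤ ‖V₀‖ * Real.exp 1 := by
  -- On the ball of radius `‖V₀‖ + 1` about `V₀` the field has norm at most (2‖V₀‖ + 1)/4 ≤ ‖V₀‖ +
  -- 1, so a solution cannot leave the ball within unit time. This is what the bound 1/4 is for.
  have hPL : IsPicardLindelof (fun r V => B r V) (tmin := 0) (tmax := 1)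
      (⟨0, by simp⟩ : Icc (0 : ℝ) 1) V₀ (‖V₀‖₊ + 1) 0 (‖V₀‖₊ + 1) 1 := by
    refine ⟨fun t ht => ?_, fun x _ => ?_, fun t ht x hx => ?_, ?_⟩
    · refine LipschitzOnWith.of_dist_le_mul fun x _ y _ => ?_
      rw [dist_eq_norm, dist_eq_norm, ← map_sub]
      refine ((B t).le_opNorm _).trans ?_
      have := hB' t ht
      gcongr
      simpa using this.trans (by norm_num)
    · exact hB.clm_apply continuousOn_const
    · have h1 : ‖x‖ ≤ 2 * ‖V₀‖ + 1 := by
        have := norm_sub_norm_le x V₀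
        rw [mem_closedBall, dist_eq_norm] at hx
        simp only [NNReal.coe_add, coe_nnnorm, NNReal.coe_one] at hx
        linarith
      have h2 : ‖B t x‖ ≤ 1 / 4 * ‖x‖ :=
        ((B t).le_opNorm _).trans (by gcongr; exact hB' t ht)
      simp only [NNReal.coe_add, coe_nnnorm, NNReal.coe_one]
      linarith [norm_nonneg V₀]
    · simp
  obtain ⟨Y, hY0, hY⟩ := hPL.exists_eq_forall_mem_Icc_hasDerivWithinAt₀
  have hc : ContinuousOn Y (Icc 0 1) := fun r hr => (hY r hr).continuousWithinAt
  have hd : ∀ r ∈ Ico (0 : ℝ) 1, HasDerivWithinAt Y (B r (Y r)) (Ici r) r := fun r hr =>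
    (hY r (Ico_subset_Icc_self hr)).mono_of_mem_nhdsWithin (Icc_mem_nhdsGE_of_mem hr)
  refine ⟨Y, hY0, hc, hd, fun r hr => ?_⟩
  have := norm_le_gronwallBound_of_norm_deriv_right_le (δ := ‖V₀‖) (K := 1) (ε := 0) hc hd
    (by simp only at hY0; rw [hY0]) (fun x hx => by
      have := (B x).le_opNorm (Y x)
      have h2 := hB' x (Ico_subset_Icc_self hx)
      nlinarith [norm_nonneg (Y x)]) r hr
  rw [gronwallBound_ε0] at this
  refine this.trans ?_
  gcongr
  linarith [hr.2]

/-- The pointwise estimate behind `exists_flat_solution`: the first-order variation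
`Y + r A(z) v Y` of a solution along a ray solves the equation of the neighbouring ray up to an
error of second order. -/
theorem flat_variation_error_le {C M r : ℝ} (hC : 0 ≤ C) (hr : 0 ≤ r) (hr1 : r ≤ 1)
    {x v : E} (hx : ‖x‖ ≤ 1) (hv : ‖v‖ ≤ 1) (a a' : E →L[ℝ] W →L[ℝ] W)
    (D : E →L[ℝ] E →L[ℝ] W →L[ℝ] W) (ha : ‖a‖ ≤ C) (hD : ‖D‖ ≤ C)
    (ha' : ‖a' - a - r • D v‖ ≤ C * ‖v‖ ^ 2) (Y : W) (hY : ‖Y‖ ≤ M)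
    (hflat : D x v Y + a v (a x Y) = D v x Y + a x (a v Y)) :
    ‖(a x Y + (a v Y + r • (D x v Y + a v (a x Y)))) - a' (x + v) (Y + r • a v Y)‖
      ≤ (C * M + 3 * C ^ 2 * M + 2 * C * (M + C * M)) * ‖v‖ ^ 2 := by
  have hM : 0 ≤ M := (norm_nonneg _).trans hY
  have hav : ‖a v Y‖ ≤ C * ‖v‖ * M := by
    refine ((a v).le_opNorm _).trans ?_
    gcongr
    exact (a.le_opNorm _).trans (by gcongr)
  -- With a' = a + r D v + remainder, the terms of order zero and one in `v` cancel once flatness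
  -- has exchanged the roles of `x` and `v`. What is left is quadratic in `v`.
  have key : (a x Y + (a v Y + r • (D x v Y + a v (a x Y)))) - a' (x + v) (Y + r • a v Y)
      = -(r • D v v Y + r • a v (a v Y) + (r * r) • D v x (a v Y) + (r * r) • D v v (a v Y)
          + (a' - a - r • D v) (x + v) (Y + r • a v Y)) := by
    rw [hflat]
    simp only [map_add, map_smul, sub_apply, add_apply, smul_apply]
    module
  have hDv : ∀ w : E, ‖w‖ ≤ 1 → ∀ X : W, ‖D v w X‖ ≤ C * ‖v‖ * ‖w‖ * ‖X‖ := fun w _ X => by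
    refine ((D v w).le_opNorm _).trans ?_
    gcongr
    refine ((D v).le_opNorm _).trans ?_
    gcongr
    exact (D.le_opNorm _).trans (by gcongr)
  have e1 : ‖r • D v v Y‖ ≤ C * M * ‖v‖ ^ 2 := by
    rw [norm_smul, Real.norm_of_nonneg hr]
    calc r * ‖D v v Y‖ ≤ 1 * (C * ‖v‖ * ‖v‖ * M) := by
          gcongr
          exact (hDv v hv Y).trans (by gcongr)
      _ = _ := by ring
  have e2 : ‖r • a v (a v Y)‖ ≤ C ^ 2 * M * ‖v‖ ^ 2 := by
    rw [norm_smul, Real.norm_of_nonneg hr]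
    calc r * ‖a v (a v Y)‖ ≤ 1 * (C * ‖v‖ * (C * ‖v‖ * M)) := by
          gcongr
          refine ((a v).le_opNorm _).trans ?_
          gcongr
          exact (a.le_opNorm _).trans (by gcongr)
      _ = _ := by ring
  have e3 : ‖(r * r) • D v x (a v Y)‖ ≤ C ^ 2 * M * ‖v‖ ^ 2 := by
    rw [norm_smul, Real.norm_of_nonneg (by positivity)]
    calc r * r * ‖D v x (a v Y)‖ ≤ 1 * 1 * (C * ‖v‖ * 1 * (C * ‖v‖ * M)) := by
          gcongr
          exact (hDv x hx _).trans (by gcongr)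
      _ = _ := by ring
  have e4 : ‖(r * r) • D v v (a v Y)‖ ≤ C ^ 2 * M * ‖v‖ ^ 2 := by
    rw [norm_smul, Real.norm_of_nonneg (by positivity)]
    calc r * r * ‖D v v (a v Y)‖ ≤ 1 * 1 * (C * ‖v‖ * 1 * (C * ‖v‖ * M)) := by
          gcongr
          exact (hDv v hv _).trans (by gcongr)
      _ = _ := by ring
  have e5 : ‖(a' - a - r • D v) (x + v) (Y + r • a v Y)‖
      ≤ 2 * C * (M + C * M) * ‖v‖ ^ 2 := by
    have h1 : ‖x + v‖ ≤ 2 := (norm_add_le _ _).trans (by linarith)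
    have h2 : ‖Y + r • a v Y‖ ≤ M + C * M := by
      refine (norm_add_le _ _).trans ?_
      gcongr
      rw [norm_smul, Real.norm_of_nonneg hr]
      calc r * ‖a v Y‖ ≤ 1 * (C * 1 * M) := by
            gcongr
            exact hav.trans (by gcongr)
        _ = _ := by ring
    calc _ ≤ ‖a' - a - r • D v‖ * ‖x + v‖ * ‖Y + r • a v Y‖ :=
          (ContinuousLinearMap.le_opNorm _ _).trans
            (by gcongr; exact ContinuousLinearMap.le_opNorm _ _)
      _ ≤ C * ‖v‖ ^ 2 * 2 * (M + C * M) := by gcongr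
      _ = _ := by ring
  rw [key, norm_neg]
  have n1 := norm_add_le (r • D v v Y + r • a v (a v Y) + (r * r) • D v x (a v Y)
    + (r * r) • D v v (a v Y)) ((a' - a - r • D v) (x + v) (Y + r • a v Y))
  have n2 := norm_add_le (r • D v v Y + r • a v (a v Y) + (r * r) • D v x (a v Y))
    ((r * r) • D v v (a v Y))
  have n3 := norm_add_le (r • D v v Y + r • a v (a v Y)) ((r * r) • D v x (a v Y))
  have n4 := norm_add_le (r • D v v Y) (r • a v (a v Y))
  linarith

/-- A flat linear system of total differential equations `dV = A V` with `C^∞` coefficients has a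
local solution with prescribed value at a point. -/
theorem exists_flat_solution [CompleteSpace W] {A : E → E →L[ℝ] W →L[ℝ] W} {U : Set E}
    (hU : IsOpen U) (hA : ContDiffOn ℝ ∞ A U) {y₀ : E} (hy₀ : y₀ ∈ U)
    (hflat : ∀ y ∈ U, ∀ v w : E, ∀ X : W,
      fderiv ℝ A y v w X + A y w (A y v X) = fderiv ℝ A y w v X + A y v (A y w X)) (V₀ : W) :
    ∃ ρ > 0, ball y₀ ρ ⊆ U ∧ ∃ V : E → W, V y₀ = V₀ ∧ ContDiffOn ℝ ∞ V (ball y₀ ρ) ∧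
      ∀ y ∈ ball y₀ ρ, HasFDerivAt V ((A y).flip (V y)) y := by
  have hA0 : ContDiffAt ℝ ∞ A y₀ := hA.contDiffAt (hU.mem_nhds hy₀)
  have hA1 : ContDiffAt ℝ 1 (fderiv ℝ A) y₀ := hA0.fderiv_right (by norm_cast)
  obtain ⟨K, s, hs, hK⟩ := hA1.exists_lipschitzOnWith
  obtain ⟨C, hC0, hAC, hDC, hKC⟩ : ∃ C : ℝ, 0 < C ∧ ‖A y₀‖ < C ∧ ‖fderiv ℝ A y₀‖ < C ∧ K ≤ C :=
    ⟨‖A y₀‖ + ‖fderiv ℝ A y₀‖ + K + 1, by positivity,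
      by linarith [norm_nonneg (fderiv ℝ A y₀), K.2], by linarith [norm_nonneg (A y₀), K.2],
      by linarith [norm_nonneg (A y₀), norm_nonneg (fderiv ℝ A y₀)]⟩
  have hev : ∀ᶠ y in nhds y₀, y ∈ U ∧ y ∈ s ∧ ‖A y‖ < C ∧ ‖fderiv ℝ A y‖ < C :=
    (hU.eventually_mem hy₀).and (Filter.Eventually.and hs ((hA0.continuousAt.norm.eventually_lt_const hAC).and
      (hA1.continuousAt.norm.eventually_lt_const hDC)))
  obtain ⟨ρ₀, hρ₀, hball⟩ := Metric.eventually_nhds_iff_ball.1 hev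
  -- The bound `C * ρ ≤ 1 / 4` is the smallness needed by `exists_linear_ode_solution` along a ray,
  -- and `ρ ≤ 1` the one needed by `flat_variation_error_le`.
  obtain ⟨ρ, hρ, hρρ₀, hρ1, hρC⟩ : ∃ ρ > 0, ρ ≤ ρ₀ ∧ ρ ≤ 1 ∧ C * ρ ≤ 1 / 4 := by
    refine ⟨min ρ₀ (min 1 (1 / (4 * C))), by positivity, min_le_left _ _,
      (min_le_right _ _).trans (min_le_left _ _), ?_⟩
    calc _ ≤ C * (1 / (4 * C)) := by
          gcongr
          exact (min_le_right _ _).trans (min_le_right _ _)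
      _ = 1 / 4 := by field_simp
  have hray : ∀ x : E, ‖x‖ < ρ → ∀ r ∈ Icc (0 : ℝ) 1, y₀ + r • x ∈ ball y₀ ρ₀ := by
    intro x hx r hr
    rw [mem_ball, dist_eq_norm, add_sub_cancel_left, norm_smul, Real.norm_of_nonneg hr.1]
    nlinarith [hr.1, hr.2, norm_nonneg x]
  have hAd : ∀ y ∈ ball y₀ ρ₀, HasFDerivAt A (fderiv ℝ A y) y := fun y hy =>
    ((hA.contDiffAt (hU.mem_nhds (hball y hy).1)).differentiableAt (by simp)).hasFDerivAt
  have hBn : ∀ x : E, ‖x‖ < ρ → ∀ r ∈ Icc (0 : ℝ) 1, ‖A (y₀ + r • x) x‖ ≤ 1 / 4 := by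
    intro x hx r hr
    refine ((A (y₀ + r • x)).le_opNorm x).trans (le_trans ?_ hρC)
    gcongr
    exact (hball _ (hray x hx r hr)).2.2.1.le
  have hBc : ∀ x : E, ‖x‖ < ρ → ContinuousOn (fun r : ℝ => A (y₀ + r • x) x) (Icc 0 1) := by
    intro x hx r hr
    have h1 : ContinuousAt (fun r : ℝ => A (y₀ + r • x)) r :=
      ContinuousAt.comp (g := A) (hAd _ (hray x hx r hr)).continuousAt (by fun_prop)
    exact (h1.clm_apply continuousAt_const).continuousWithinAt
  have hex : ∀ x : E, ∃ Y : ℝ → W, ‖x‖ < ρ → Y 0 = V₀ ∧ ContinuousOn Y (Icc 0 1) ∧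
      (∀ r ∈ Ico (0 : ℝ) 1, HasDerivWithinAt Y (A (y₀ + r • x) x (Y r)) (Ici r) r) ∧
      ∀ r ∈ Icc (0 : ℝ) 1, ‖Y r‖ ≤ ‖V₀‖ * Real.exp 1 := by
    intro x
    by_cases hx : ‖x‖ < ρ
    · obtain ⟨Y, h⟩ := exists_linear_ode_solution (fun r => A (y₀ + r • x) x) (hBc x hx)
        (hBn x hx) V₀
      exact ⟨Y, fun _ => h⟩
    · exact ⟨0, fun h => absurd h hx⟩
  choose Y hY using hex
  set M : ℝ := ‖V₀‖ * Real.exp 1 with hM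
  have hM0 : 0 ≤ M := by positivity
  set C' : ℝ := C * M + 3 * C ^ 2 * M + 2 * C * (M + C * M) with hC'
  have hC'0 : 0 ≤ C' := by positivity
  -- Second-order Taylor bound, from the Lipschitz bound on the derivative of `A`.
  have htaylor : ∀ z ∈ ball y₀ ρ₀, ∀ w : E, z + w ∈ ball y₀ ρ₀ →
      ‖A (z + w) - A z - fderiv ℝ A z w‖ ≤ C * ‖w‖ * ‖w‖ := by
    intro z hz w hw
    have hseg : segment ℝ z (z + w) ⊆ ball y₀ ρ₀ := (convex_ball y₀ ρ₀).segment_subset hz hw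
    have := (convex_segment (𝕜 := ℝ) z (z + w)).norm_image_sub_le_of_norm_hasFDerivWithin_le'
      (f := A) (f' := fderiv ℝ A) (φ := fderiv ℝ A z) (C := C * ‖w‖) (x := z) (y := z + w)
      (fun x hx => (hAd x (hseg hx)).hasFDerivWithinAt) (fun x hx => ?_)
      (left_mem_segment ℝ z (z + w)) (right_mem_segment ℝ z (z + w))
    · simpa using this
    · have h1 := hK.norm_sub_le (hball x (hseg hx)).2.1 (hball z hz).2.1
      have h2 : ‖x - z‖ ≤ ‖w‖ := by
        have := norm_sub_le_of_mem_segment hx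
        simpa using this
      exact h1.trans (by gcongr)
  -- comparison of neighbouring rays
  have hcmp : ∀ x v : E, ‖x‖ < ρ → ‖x + v‖ < ρ → ‖v‖ ≤ 1 →
      ‖Y (x + v) 1 - Y x 1 - A (y₀ + x) v (Y x 1)‖ ≤ C' * Real.exp 1 * ‖v‖ ^ 2 := by
    intro x v hx hxv hv
    obtain ⟨hY0, hYc, hYd, hYb⟩ := hY x hx
    obtain ⟨hZ0, hZc, hZd, hZb⟩ := hY (x + v) hxv
    have hzd : ∀ r ∈ Ico (0 : ℝ) 1, HasDerivWithinAt (fun r : ℝ => A (y₀ + r • x) v)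
        (fderiv ℝ A (y₀ + r • x) x v) (Ici r) r := by
      intro r hr
      have h1 : HasDerivAt (fun r : ℝ => y₀ + r • x) x r := by
        simpa using ((hasDerivAt_id r).smul_const x).const_add y₀
      have h2 := (hAd _ (hray x hx r (Ico_subset_Icc_self hr))).comp_hasDerivAt r h1
      exact (h2.clm_apply (hasDerivAt_const r v)).hasDerivWithinAt.congr_deriv (by simp)
    have hzc : ContinuousOn (fun r : ℝ => A (y₀ + r • x) v) (Icc 0 1) := by
      intro r hr
      have h1 : ContinuousAt (fun r : ℝ => A (y₀ + r • x)) r :=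
        ContinuousAt.comp (g := A) (hAd _ (hray x hx r hr)).continuousAt (by fun_prop)
      exact (h1.clm_apply continuousAt_const).continuousWithinAt
    -- Along the ray in direction `x + v`, the variation Y_x + r A(y₀ + r x) v Y_x has the same
    -- initial value as the true solution and satisfies its equation up to `C' * ‖v‖ ^ 2`.
    -- Grönwall's inequality transfers this error to r = 1.
    have hG := dist_le_of_approx_trajectories_ODE_of_mem (a := 0) (b := 1)
      (v := fun r X => A (y₀ + r • (x + v)) (x + v) X) (s := fun _ => univ) (K := 1)
      (f := fun r => Y x r + r • A (y₀ + r • x) v (Y x r))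
      (f' := fun r => A (y₀ + r • x) x (Y x r) + (A (y₀ + r • x) v (Y x r) +
        r • (fderiv ℝ A (y₀ + r • x) x v (Y x r) + A (y₀ + r • x) v (A (y₀ + r • x) x (Y x r)))))
      (g := Y (x + v)) (g' := fun r => A (y₀ + r • (x + v)) (x + v) (Y (x + v) r))
      (εf := C' * ‖v‖ ^ 2) (εg := 0) (δ := 0) ?_ ?_ ?_ ?_ (fun _ _ => mem_univ _) hZc hZd
      (fun _ _ => by simp) (fun _ _ => mem_univ _) (by simp [hY0, hZ0]) 1 (by simp)
    · rw [dist_comm, dist_eq_norm] at hG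
      simp only [one_smul, NNReal.coe_one, add_zero, sub_zero] at hG
      rw [gronwallBound_of_K_ne_0 one_ne_zero] at hG
      rw [sub_sub]
      refine hG.trans ?_
      simp only [zero_mul, zero_add, div_one, mul_one]
      nlinarith [Real.exp_pos 1, mul_nonneg hC'0 (sq_nonneg ‖v‖)]
    · intro r hr
      refine LipschitzOnWith.of_dist_le_mul fun X _ X' _ => ?_
      rw [dist_eq_norm, dist_eq_norm, ← map_sub]
      refine (ContinuousLinearMap.le_opNorm _ _).trans ?_
      have := hBn _ hxv r (Ico_subset_Icc_self hr)
      gcongr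
      simpa using this.trans (by norm_num)
    · exact hYc.add (continuousOn_id.smul (hzc.clm_apply hYc))
    · intro r hr
      have h1 := (hzd r hr).clm_apply (hYd r hr)
      have h2 := (hYd r hr).add ((hasDerivWithinAt_id r _).smul h1)
      refine h2.congr_deriv ?_
      simp only [id_eq, one_smul]
      abel
    · intro r hr
      have hr' := Ico_subset_Icc_self hr
      rw [dist_eq_norm]
      have hz := hray x hx r hr'
      refine flat_variation_error_le hC0.le hr.1 hr.2.le (hx.le.trans hρ1) hv _ _ _
        (hball _ hz).2.2.1.le (hball _ hz).2.2.2.le ?_ _ (hYb r hr')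
        (hflat _ (hball _ hz).1 _ _ _)
      have h1 : y₀ + r • (x + v) = y₀ + r • x + r • v := by module
      have h2 := htaylor _ hz (r • v) (h1 ▸ hray _ hxv r hr')
      rw [h1, ← map_smul]
      refine h2.trans ?_
      rw [norm_smul, Real.norm_of_nonneg hr.1]
      have : r * ‖v‖ ≤ ‖v‖ := mul_le_of_le_one_left (norm_nonneg _) hr.2.le
      have h0 : 0 ≤ r * ‖v‖ := mul_nonneg hr.1 (norm_nonneg _)
      calc C * (r * ‖v‖) * (r * ‖v‖) ≤ C * ‖v‖ * ‖v‖ := by gcongr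
        _ = _ := by ring
  have hVd : ∀ y ∈ ball y₀ ρ, HasFDerivAt (fun y => Y (y - y₀) 1)
      ((A y).flip (Y (y - y₀) 1)) y := by
    intro y hy
    rw [hasFDerivAt_iff_isLittleO_nhds_zero]
    have hy' : ‖y - y₀‖ < ρ := by rwa [mem_ball, dist_eq_norm] at hy
    have hO : (fun h : E => Y (y + h - y₀) 1 - Y (y - y₀) 1 - (A y).flip (Y (y - y₀) 1) h)
        =O[nhds 0] fun h => ‖h‖ ^ 2 := by
      refine Asymptotics.IsBigO.of_bound (C' * Real.exp 1) ?_
      have e1 : ∀ᶠ h : E in nhds 0, ‖(y - y₀) + h‖ < ρ := by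
        have : ContinuousAt (fun h : E => ‖(y - y₀) + h‖) 0 := by fun_prop
        exact this.eventually_lt_const (by simpa using hy')
      have e2 : ∀ᶠ h : E in nhds 0, ‖h‖ < 1 :=
        continuous_norm.continuousAt.eventually_lt_const (by simp)
      filter_upwards [e1, e2] with h h1 h2
      have := hcmp (y - y₀) h hy' h1 h2.le
      rw [add_sub_cancel] at this
      rw [add_sub_right_comm, Real.norm_of_nonneg (by positivity)]
      exact this
    refine hO.trans_isLittleO ?_
    have := Asymptotics.isLittleO_norm_pow_id (E' := E) one_lt_two
    simpa using this
  have hsub : ball y₀ ρ ⊆ U := fun y hy => (hball y (ball_subset_ball hρρ₀ hy)).1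
  refine ⟨ρ, hρ, hsub, fun y => Y (y - y₀) 1, ?_, ?_, hVd⟩
  · have h0 : ‖(0 : E)‖ < ρ := by simpa using hρ
    obtain ⟨hY0, hYc, hYd, -⟩ := hY 0 h0
    have := constant_of_has_deriv_right_zero hYc (fun r hr => by simpa using hYd r hr) 1
      (by simp)
    simp [this, hY0]
  · rw [contDiffOn_infty]
    intro n
    -- Bootstrap: the derivative of `V` is `(A y).flip (V y)`, so regularity `C^n` of `V` gives
    -- `C^(n+1)`.
    induction n with
    | zero =>
      exact contDiffOn_zero.2 fun y hy => (hVd y hy).continuousAt.continuousWithinAt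
    | succ n ih =>
      push_cast
      rw [contDiffOn_succ_iff_fderiv_of_isOpen isOpen_ball]
      refine ⟨fun y hy => (hVd y hy).differentiableAt.differentiableWithinAt, by simp, ?_⟩
      have hflip : ContDiffOn ℝ n (fun y => (A y).flip) (ball y₀ ρ) :=
        (ContinuousLinearMap.flipₗᵢ ℝ E W W).toContinuousLinearEquiv.contDiff.comp_contDiffOn
          ((hA.mono hsub).of_le (by exact_mod_cast le_top))
      exact (hflip.clm_apply ih).congr fun y hy => (hVd y hy).fderiv

end FlatSystem

open Set Matrix

/-! ### Partial derivatives of functions and matrices -/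

section PartialDerivatives

variable {U : Set E4} {f g : E4 → ℝ} {y : E4} {i j c : Fin 4}

theorem differentiableAt_of_contDiffOn (hU : IsOpen U) (hf : ContDiffOn ℝ ∞ f U) (hy : y ∈ U) :
    DifferentiableAt ℝ f y :=
  (hf.contDiffAt (hU.mem_nhds hy)).differentiableAt (by simp)

theorem contDiffOn_pd (hU : IsOpen U) (hf : ContDiffOn ℝ ∞ f U) : ContDiffOn ℝ ∞ (pd i f) U :=
  (hf.fderiv_of_isOpen hU (by simp)).clm_apply contDiffOn_const

theorem pd_congr_of_eqOn (hU : IsOpen U) (h : EqOn f g U) (hy : y ∈ U) : pd i f y = pd i g y := by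
  unfold pd
  rw [(h.eventuallyEq_of_mem (hU.mem_nhds hy)).fderiv_eq]

theorem pd_const (r : ℝ) : pd i (fun _ => r) y = 0 := by simp [pd]

theorem pd_add (hf : DifferentiableAt ℝ f y) (hg : DifferentiableAt ℝ g y) :
    pd i (fun z => f z + g z) y = pd i f y + pd i g y := by
  simp only [pd]
  rw [fderiv_fun_add hf hg]
  rfl

theorem pd_sub (hf : DifferentiableAt ℝ f y) (hg : DifferentiableAt ℝ g y) :
    pd i (fun z => f z - g z) y = pd i f y - pd i g y := by
  simp only [pd]
  rw [fderiv_fun_sub hf hg]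
  rfl

theorem pd_neg : pd i (fun z => -f z) y = -pd i f y := by
  simp only [pd]
  rw [fderiv_fun_neg]
  rfl

theorem pd_mul (hf : DifferentiableAt ℝ f y) (hg : DifferentiableAt ℝ g y) :
    pd i (fun z => f z * g z) y = pd i f y * g y + f y * pd i g y := by
  simp only [pd]
  rw [fderiv_fun_mul hf hg]
  simp
  ring

theorem pd_const_mul (r : ℝ) (hf : DifferentiableAt ℝ f y) :
    pd i (fun z => r * f z) y = r * pd i f y := by
  rw [pd_mul (by fun_prop) hf, pd_const]
  ring

theorem pd_sum {ι : Type*} (s : Finset ι) {f : ι → E4 → ℝ}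
    (hf : ∀ k ∈ s, DifferentiableAt ℝ (f k) y) :
    pd i (fun z => ∑ k ∈ s, f k z) y = ∑ k ∈ s, pd i (f k) y := by
  simp only [pd]
  rw [fderiv_fun_sum hf]
  simp

theorem pd_comm (hU : IsOpen U) (hf : ContDiffOn ℝ ∞ f U) (hy : y ∈ U) :
    pd i (pd j f) y = pd j (pd i f) y := by
  have h1 : DifferentiableAt ℝ (fderiv ℝ f) y :=
    ((hf.fderiv_of_isOpen (m := ∞) hU (by simp)).contDiffAt (hU.mem_nhds hy)).differentiableAt
      (by simp)
  have h2 : IsSymmSndFDerivAt ℝ f y :=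
    (hf.contDiffAt (hU.mem_nhds hy)).isSymmSndFDerivAt (by
      simpa using WithTop.coe_le_coe.2 (le_top : (2 : ℕ∞) ≤ ⊤))
  have h3 : ∀ k l : Fin 4, pd k (pd l f) y
      = fderiv ℝ (fderiv ℝ f) y (EuclideanSpace.single k 1) (EuclideanSpace.single l 1) := by
    intro k l
    change fderiv ℝ (fun z => fderiv ℝ f z (EuclideanSpace.single l 1)) y _ = _
    rw [fderiv_clm_apply h1 (by fun_prop)]
    simp
  rw [h3, h3]
  exact h2.eq _ _

/-- A matrix-valued function with `C^∞` entries. -/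
def SmoothMatrixOn (M : E4 → Matrix (Fin 4) (Fin 4) ℝ) (U : Set E4) : Prop :=
  ∀ i j, ContDiffOn ℝ ∞ (fun y => M y i j) U

/-- The entrywise partial derivative of a matrix-valued function. -/
noncomputable def pdMatrix (c : Fin 4) (M : E4 → Matrix (Fin 4) (Fin 4) ℝ) (y : E4) :
    Matrix (Fin 4) (Fin 4) ℝ :=
  Matrix.of fun i j => pd c (fun z => M z i j) y

variable {M N : E4 → Matrix (Fin 4) (Fin 4) ℝ}

theorem SmoothMatrixOn.differentiableAt (hU : IsOpen U) (hM : SmoothMatrixOn M U) (hy : y ∈ U)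
    (i j : Fin 4) : DifferentiableAt ℝ (fun y => M y i j) y :=
  differentiableAt_of_contDiffOn hU (hM i j) hy

theorem SmoothMatrixOn.add (hM : SmoothMatrixOn M U) (hN : SmoothMatrixOn N U) :
    SmoothMatrixOn (fun y => M y + N y) U := fun i j => (hM i j).add (hN i j)

theorem SmoothMatrixOn.sub (hM : SmoothMatrixOn M U) (hN : SmoothMatrixOn N U) :
    SmoothMatrixOn (fun y => M y - N y) U := fun i j => (hM i j).sub (hN i j)

theorem SmoothMatrixOn.transpose (hM : SmoothMatrixOn M U) :
    SmoothMatrixOn (fun y => (M y)ᵀ) U := fun i j => hM j i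

theorem SmoothMatrixOn.mul (hM : SmoothMatrixOn M U) (hN : SmoothMatrixOn N U) :
    SmoothMatrixOn (fun y => M y * N y) U := fun i j => by
  simp only [Matrix.mul_apply]
  exact ContDiffOn.sum fun k _ => (hM i k).mul (hN k j)

theorem SmoothMatrixOn.pdMatrix (hU : IsOpen U) (hM : SmoothMatrixOn M U) :
    SmoothMatrixOn (pdMatrix c M) U := fun i j => contDiffOn_pd hU (hM i j)

theorem SmoothMatrixOn.det (hM : SmoothMatrixOn M U) : ContDiffOn ℝ ∞ (fun y => (M y).det) U := by
  simp only [Matrix.det_apply]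
  exact ContDiffOn.sum fun σ _ => ContDiffOn.const_smul _ (contDiffOn_prod fun k _ => hM _ _)

/-- Cramer's rule: the entries of the inverse are polynomials in the entries divided by the
determinant. -/
theorem SmoothMatrixOn.inv (hM : SmoothMatrixOn M U) (hdet : ∀ y ∈ U, (M y).det ≠ 0) :
    SmoothMatrixOn (fun y => (M y)⁻¹) U := fun i j => by
  simp only [Matrix.inv_def, Ring.inverse_eq_inv', Matrix.smul_apply, smul_eq_mul,
    Matrix.adjugate_apply]
  refine (hM.det.inv hdet).mul (SmoothMatrixOn.det (M := fun y => (M y).updateRow j _) fun k l => ?_)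
  simp only [Matrix.updateRow_apply]
  split_ifs
  · exact contDiffOn_const
  · exact hM k l

theorem pdMatrix_congr (hU : IsOpen U) (h : ∀ y ∈ U, M y = N y) (hy : y ∈ U) :
    pdMatrix c M y = pdMatrix c N y := by
  ext i j
  exact pd_congr_of_eqOn hU (fun z hz => by simp only [h z hz]) hy

theorem pdMatrix_add (hU : IsOpen U) (hM : SmoothMatrixOn M U) (hN : SmoothMatrixOn N U)
    (hy : y ∈ U) : pdMatrix c (fun z => M z + N z) y = pdMatrix c M y + pdMatrix c N y := by
  ext i j
  exact pd_add (hM.differentiableAt hU hy i j) (hN.differentiableAt hU hy i j)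

theorem pdMatrix_sub (hU : IsOpen U) (hM : SmoothMatrixOn M U) (hN : SmoothMatrixOn N U)
    (hy : y ∈ U) : pdMatrix c (fun z => M z - N z) y = pdMatrix c M y - pdMatrix c N y := by
  ext i j
  exact pd_sub (hM.differentiableAt hU hy i j) (hN.differentiableAt hU hy i j)

theorem pdMatrix_mul (hU : IsOpen U) (hM : SmoothMatrixOn M U) (hN : SmoothMatrixOn N U)
    (hy : y ∈ U) :
    pdMatrix c (fun z => M z * N z) y = pdMatrix c M y * N y + M y * pdMatrix c N y := by
  ext i j
  have hM' := hM.differentiableAt hU hy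
  have hN' := hN.differentiableAt hU hy
  simp only [pdMatrix, Matrix.of_apply, Matrix.mul_apply, Matrix.add_apply]
  rw [pd_sum _ fun k _ => (hM' i k).fun_mul (hN' k j), ← Finset.sum_add_distrib]
  exact Finset.sum_congr rfl fun k _ => pd_mul (hM' i k) (hN' k j)

theorem pdMatrix_transpose : pdMatrix c (fun z => (M z)ᵀ) y = (pdMatrix c M y)ᵀ := rfl

theorem pdMatrix_const (A : Matrix (Fin 4) (Fin 4) ℝ) : pdMatrix c (fun _ => A) y = 0 := by
  ext i j
  exact pd_const _

theorem pdMatrix_comm (hU : IsOpen U) (hM : SmoothMatrixOn M U) (hy : y ∈ U) :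
    pdMatrix i (pdMatrix j M) y = pdMatrix j (pdMatrix i M) y := by
  ext k l
  exact pd_comm hU (hM k l) hy

end PartialDerivatives

/-! ### Christoffel symbols and curvature of a metric on a coordinate domain -/

/-- `G` is the matrix of components of a pseudo-Riemannian metric on the open set `U`. -/
structure IsMetricOn (G : E4 → Matrix (Fin 4) (Fin 4) ℝ) (U : Set E4) : Prop where
  isOpen : IsOpen U
  smooth : SmoothMatrixOn G U
  symm : ∀ y ∈ U, (G y)ᵀ = G y
  det_ne_zero : ∀ y ∈ U, (G y).det ≠ 0

/-- The matrix `(Γᵃ_cb)_ab`. -/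
noncomputable def christoffelMatrix (G : E4 → Matrix (Fin 4) (Fin 4) ℝ) (c : Fin 4) (y : E4) :
    Matrix (Fin 4) (Fin 4) ℝ :=
  Matrix.of fun a b => christoffel G a c b y

/-- The matrix `(Rᵃ_bcd)_ab`. -/
noncomputable def riemannMatrix (G : E4 → Matrix (Fin 4) (Fin 4) ℝ) (c d : Fin 4) (y : E4) :
    Matrix (Fin 4) (Fin 4) ℝ :=
  Matrix.of fun a b => riemann G a b c d y

/-- The matrix `(R_bd)_bd`. -/
noncomputable def ricciMatrix (G : E4 → Matrix (Fin 4) (Fin 4) ℝ) (y : E4) : Matrix (Fin 4) (Fin 4) ℝ :=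
  Matrix.of fun b d => ricci G b d y

/-- The matrix `(∇ₐ R_bc)_bc`. -/
noncomputable def covRicciMatrix (G : E4 → Matrix (Fin 4) (Fin 4) ℝ) (a : Fin 4) (y : E4) :
    Matrix (Fin 4) (Fin 4) ℝ :=
  Matrix.of fun b c => covRicci G a b c y

/-- The matrix `(Rᵃᵇ_cd)_ab`. -/
noncomputable def riemannUp (G : E4 → Matrix (Fin 4) (Fin 4) ℝ) (c d : Fin 4) (y : E4) :
    Matrix (Fin 4) (Fin 4) ℝ :=
  riemannMatrix G c d y * (G y)⁻¹

namespace IsMetricOn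

variable {G : E4 → Matrix (Fin 4) (Fin 4) ℝ} {U : Set E4} {y : E4}

theorem mono {U' : Set E4} (h : IsMetricOn G U) (hU' : IsOpen U') (hs : U' ⊆ U) :
    IsMetricOn G U' :=
  ⟨hU', fun i j => (h.smooth i j).mono hs, fun y hy => h.symm y (hs hy),
    fun y hy => h.det_ne_zero y (hs hy)⟩

theorem isUnit_det (h : IsMetricOn G U) (hy : y ∈ U) : IsUnit (G y).det :=
  isUnit_iff_ne_zero.2 (h.det_ne_zero y hy)

theorem mul_inv (h : IsMetricOn G U) (hy : y ∈ U) : G y * (G y)⁻¹ = 1 :=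
  Matrix.mul_nonsing_inv _ (h.isUnit_det hy)

theorem inv_mul (h : IsMetricOn G U) (hy : y ∈ U) : (G y)⁻¹ * G y = 1 :=
  Matrix.nonsing_inv_mul _ (h.isUnit_det hy)

theorem symm_apply (h : IsMetricOn G U) (hy : y ∈ U) (i j : Fin 4) : G y i j = G y j i :=
  congrFun (congrFun (h.symm y hy) j) i

theorem inv_symm (h : IsMetricOn G U) (hy : y ∈ U) : ((G y)⁻¹)ᵀ = (G y)⁻¹ := by
  rw [Matrix.transpose_nonsing_inv, h.symm y hy]

theorem inv_symm_apply (h : IsMetricOn G U) (hy : y ∈ U) (i j : Fin 4) :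
    (G y)⁻¹ i j = (G y)⁻¹ j i :=
  congrFun (congrFun (h.inv_symm hy) j) i

theorem smooth_inv (h : IsMetricOn G U) : SmoothMatrixOn (fun y => (G y)⁻¹) U :=
  h.smooth.inv h.det_ne_zero

theorem pd_symm (h : IsMetricOn G U) (hy : y ∈ U) (c i j : Fin 4) :
    pd c (fun z => G z i j) y = pd c (fun z => G z j i) y :=
  pd_congr_of_eqOn h.isOpen (fun _ hz => h.symm_apply hz i j) hy

theorem smooth_christoffel (h : IsMetricOn G U) (k i j : Fin 4) :
    ContDiffOn ℝ ∞ (christoffel G k i j) U := by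
  unfold christoffel
  refine contDiffOn_const.mul (ContDiffOn.sum fun l _ => (h.smooth_inv k l).mul ?_)
  exact ((contDiffOn_pd h.isOpen (h.smooth l j)).add
    (contDiffOn_pd h.isOpen (h.smooth l i))).sub (contDiffOn_pd h.isOpen (h.smooth i j))

theorem smooth_christoffelMatrix (h : IsMetricOn G U) (c : Fin 4) :
    SmoothMatrixOn (christoffelMatrix G c) U := fun a b => h.smooth_christoffel a c b

theorem christoffel_symm (h : IsMetricOn G U) (hy : y ∈ U) (k i j : Fin 4) :
    christoffel G k i j y = christoffel G k j i y := by
  unfold christoffel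
  congr 1
  refine Finset.sum_congr rfl fun l _ => ?_
  rw [h.pd_symm hy l i j]
  ring

theorem lower_christoffel (h : IsMetricOn G U) (hy : y ∈ U) (l i j : Fin 4) :
    ∑ k, G y l k * christoffel G k i j y =
      1 / 2 * (pd i (fun z => G z l j) y + pd j (fun z => G z l i) y
        - pd l (fun z => G z i j) y) := by
  set X : Fin 4 → ℝ := fun l => 1 / 2 * (pd i (fun z => G z l j) y + pd j (fun z => G z l i) y
        - pd l (fun z => G z i j) y) with hX
  have h1 : ∀ k, christoffel G k i j y = ((G y)⁻¹ *ᵥ X) k := by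
    intro k
    simp only [christoffel, Matrix.mulVec, dotProduct, hX, Finset.mul_sum]
    exact Finset.sum_congr rfl fun l _ => by ring
  have h2 : G y *ᵥ ((G y)⁻¹ *ᵥ X) = X := by
    rw [Matrix.mulVec_mulVec, h.mul_inv hy, Matrix.one_mulVec]
  simp only [h1]
  exact congrFun h2 l

/-- The Levi-Civita connection is metric. -/
theorem pdMatrix_metric (h : IsMetricOn G U) (hy : y ∈ U) (c : Fin 4) :
    pdMatrix c G y = (christoffelMatrix G c y)ᵀ * G y + G y * christoffelMatrix G c y := by
  ext i j
  have h1 := h.lower_christoffel hy i c j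
  have h2 := h.lower_christoffel hy j c i
  have h3 : ((christoffelMatrix G c y)ᵀ * G y) i j = ∑ k, G y j k * christoffel G k c i y := by
    simp only [Matrix.mul_apply, Matrix.transpose_apply, christoffelMatrix, Matrix.of_apply]
    exact Finset.sum_congr rfl fun k _ => by rw [h.symm_apply hy k j, mul_comm]
  rw [Matrix.add_apply, h3, h2]
  simp only [Matrix.mul_apply, christoffelMatrix, Matrix.of_apply, pdMatrix]
  rw [h1, h.pd_symm hy c j i, h.pd_symm hy i c j, h.pd_symm hy j c i]
  ring

/-- Differentiating G G⁻¹ = 1 and inserting metric compatibility shows that the inverse metric is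
parallel too. -/
theorem pdMatrix_inv (h : IsMetricOn G U) (hy : y ∈ U) (c : Fin 4) :
    pdMatrix c (fun z => (G z)⁻¹) y =
      -(christoffelMatrix G c y * (G y)⁻¹) - (G y)⁻¹ * (christoffelMatrix G c y)ᵀ := by
  have h1 : pdMatrix c G y * (G y)⁻¹ + G y * pdMatrix c (fun z => (G z)⁻¹) y = 0 := by
    rw [← pdMatrix_mul h.isOpen h.smooth h.smooth_inv hy,
      pdMatrix_congr h.isOpen (fun z hz => h.mul_inv hz) hy, pdMatrix_const]
  have h2 : pdMatrix c (fun z => (G z)⁻¹) y = -((G y)⁻¹ * pdMatrix c G y * (G y)⁻¹) := by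
    calc _ = (G y)⁻¹ * (G y * pdMatrix c (fun z => (G z)⁻¹) y) := by
          rw [← Matrix.mul_assoc, h.inv_mul hy, Matrix.one_mul]
      _ = (G y)⁻¹ * (-(pdMatrix c G y * (G y)⁻¹)) := by
          rw [eq_neg_of_add_eq_zero_right h1]
      _ = _ := by rw [Matrix.mul_neg, Matrix.mul_assoc]
  rw [h2, h.pdMatrix_metric hy, Matrix.mul_add, Matrix.add_mul, ← Matrix.mul_assoc,
    Matrix.mul_assoc _ (G y), h.mul_inv hy, ← Matrix.mul_assoc, h.inv_mul hy]
  simp only [Matrix.mul_one, Matrix.one_mul]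
  abel

/-- This is the curvature of the connection form, dΓ + Γ∧Γ. In this form the second Bianchi identity
and the skewness of the curvature become identities in a noncommutative ring. -/
theorem riemannMatrix_eq (G : E4 → Matrix (Fin 4) (Fin 4) ℝ) (c d : Fin 4) (y : E4) :
    riemannMatrix G c d y = pdMatrix c (christoffelMatrix G d) y
      - pdMatrix d (christoffelMatrix G c) y
      + (christoffelMatrix G c y * christoffelMatrix G d y
        - christoffelMatrix G d y * christoffelMatrix G c y) := by
  ext a b
  simp only [riemannMatrix, riemann, Matrix.of_apply, Matrix.add_apply, Matrix.sub_apply,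
    Matrix.mul_apply, Finset.sum_sub_distrib]
  rfl

theorem smooth_riemannMatrix (h : IsMetricOn G U) (c d : Fin 4) :
    SmoothMatrixOn (riemannMatrix G c d) U := by
  have := h.smooth_christoffelMatrix
  rw [funext (riemannMatrix_eq G c d)]
  exact (((this d).pdMatrix h.isOpen).sub ((this c).pdMatrix h.isOpen)).add
    (((this c).mul (this d)).sub ((this d).mul (this c)))

theorem smooth_ricciMatrix (h : IsMetricOn G U) : SmoothMatrixOn (ricciMatrix G) U := fun b d => by
  change ContDiffOn ℝ ∞ (fun y => ∑ a, riemannMatrix G a d y a b) U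
  exact ContDiffOn.sum fun a _ => h.smooth_riemannMatrix a d a b

theorem riemannMatrix_antisymm (G : E4 → Matrix (Fin 4) (Fin 4) ℝ) (c d : Fin 4) (y : E4) :
    riemannMatrix G d c y = -riemannMatrix G c d y := by
  rw [riemannMatrix_eq, riemannMatrix_eq]
  abel

/-- The second Bianchi identity. -/
theorem bianchi (h : IsMetricOn G U) (hy : y ∈ U) (e c d : Fin 4) :
    (pdMatrix e (riemannMatrix G c d) y + (christoffelMatrix G e y * riemannMatrix G c d y
      - riemannMatrix G c d y * christoffelMatrix G e y))
    + (pdMatrix c (riemannMatrix G d e) y + (christoffelMatrix G c y * riemannMatrix G d e y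
      - riemannMatrix G d e y * christoffelMatrix G c y))
    + (pdMatrix d (riemannMatrix G e c) y + (christoffelMatrix G d y * riemannMatrix G e c y
      - riemannMatrix G e c y * christoffelMatrix G d y)) = 0 := by
  have hΓ := h.smooth_christoffelMatrix
  have key : ∀ e c d : Fin 4, pdMatrix e (riemannMatrix G c d) y =
      pdMatrix e (pdMatrix c (christoffelMatrix G d)) y
        - pdMatrix e (pdMatrix d (christoffelMatrix G c)) y
        + ((pdMatrix e (christoffelMatrix G c) y * christoffelMatrix G d y
            + christoffelMatrix G c y * pdMatrix e (christoffelMatrix G d) y)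
          - (pdMatrix e (christoffelMatrix G d) y * christoffelMatrix G c y
            + christoffelMatrix G d y * pdMatrix e (christoffelMatrix G c) y)) := by
    intro e c d
    rw [funext (riemannMatrix_eq G c d),
      pdMatrix_add h.isOpen (((hΓ d).pdMatrix h.isOpen).sub ((hΓ c).pdMatrix h.isOpen))
        (((hΓ c).mul (hΓ d)).sub ((hΓ d).mul (hΓ c))) hy,
      pdMatrix_sub h.isOpen ((hΓ d).pdMatrix h.isOpen) ((hΓ c).pdMatrix h.isOpen) hy,
      pdMatrix_sub h.isOpen ((hΓ c).mul (hΓ d)) ((hΓ d).mul (hΓ c)) hy,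
      pdMatrix_mul h.isOpen (hΓ c) (hΓ d) hy, pdMatrix_mul h.isOpen (hΓ d) (hΓ c) hy]
  -- Once mixed second derivatives of Γ are identified they cancel cyclically, and the rest is
  -- algebra in the matrices Γ and ∂Γ.
  rw [key, key, key, pdMatrix_comm h.isOpen (hΓ d) hy (i := c) (j := e),
    pdMatrix_comm h.isOpen (hΓ c) hy (i := e) (j := d),
    pdMatrix_comm h.isOpen (hΓ e) hy (i := d) (j := c),
    riemannMatrix_eq, riemannMatrix_eq, riemannMatrix_eq]
  noncomm_ring

/-- `R_abcd = -R_bacd`. -/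
theorem riemannMatrix_skew (h : IsMetricOn G U) (hy : y ∈ U) (c d : Fin 4) :
    (riemannMatrix G c d y)ᵀ * G y = -(G y * riemannMatrix G c d y) := by
  have hΓ := h.smooth_christoffelMatrix
  have key : ∀ c d : Fin 4, pdMatrix c (pdMatrix d G) y =
      ((pdMatrix c (christoffelMatrix G d) y)ᵀ * G y
        + (christoffelMatrix G d y)ᵀ
          * ((christoffelMatrix G c y)ᵀ * G y + G y * christoffelMatrix G c y))
      + (((christoffelMatrix G c y)ᵀ * G y + G y * christoffelMatrix G c y)
          * christoffelMatrix G d y + G y * pdMatrix c (christoffelMatrix G d) y) := by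
    intro c d
    rw [pdMatrix_congr h.isOpen (fun z hz => h.pdMatrix_metric hz d) hy,
      pdMatrix_add h.isOpen ((hΓ d).transpose.mul h.smooth) (h.smooth.mul (hΓ d)) hy,
      pdMatrix_mul h.isOpen (hΓ d).transpose h.smooth hy,
      pdMatrix_mul h.isOpen h.smooth (hΓ d) hy, h.pdMatrix_metric hy, pdMatrix_transpose]
  -- The second derivatives of `G` commute. Written out by metric compatibility, their commutator is
  -- exactly Rᵀ G + G R.
  have h1 := pdMatrix_comm h.isOpen h.smooth hy (i := c) (j := d)
  rw [key, key, ← sub_eq_zero] at h1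
  rw [← sub_eq_zero, ← h1, riemannMatrix_eq]
  simp only [Matrix.transpose_add, Matrix.transpose_sub, Matrix.transpose_mul]
  noncomm_ring

theorem riemannUp_skew (h : IsMetricOn G U) (hy : y ∈ U) (c d : Fin 4) :
    (riemannUp G c d y)ᵀ = -riemannUp G c d y := by
  have h1 := h.riemannMatrix_skew hy c d
  rw [riemannUp, Matrix.transpose_mul, h.inv_symm hy]
  calc _ = (G y)⁻¹ * ((riemannMatrix G c d y)ᵀ * G y) * (G y)⁻¹ := by
        rw [Matrix.mul_assoc, Matrix.mul_assoc, h.mul_inv hy, Matrix.mul_one]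
    _ = _ := by
        rw [h1, Matrix.mul_neg, ← Matrix.mul_assoc, h.inv_mul hy, Matrix.one_mul, Matrix.neg_mul]

theorem smooth_riemannUp (h : IsMetricOn G U) (c d : Fin 4) :
    SmoothMatrixOn (riemannUp G c d) U :=
  (h.smooth_riemannMatrix c d).mul h.smooth_inv

/-- Since the inverse metric is parallel, an index may be raised under ∇. The commutator with Γ
becomes Γ R + R Γᵀ, because both matrix indices are now upper ones. Raising makes both
antisymmetries of the curvature plain sign rules for entries, which the double contraction needs. -/
theorem bianchi_up (h : IsMetricOn G U) (hy : y ∈ U) (e c d : Fin 4) :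
    (pdMatrix e (riemannUp G c d) y + (christoffelMatrix G e y * riemannUp G c d y
      + riemannUp G c d y * (christoffelMatrix G e y)ᵀ))
    + (pdMatrix c (riemannUp G d e) y + (christoffelMatrix G c y * riemannUp G d e y
      + riemannUp G d e y * (christoffelMatrix G c y)ᵀ))
    + (pdMatrix d (riemannUp G e c) y + (christoffelMatrix G d y * riemannUp G e c y
      + riemannUp G e c y * (christoffelMatrix G d y)ᵀ)) = 0 := by
  have key : ∀ e c d : Fin 4, pdMatrix e (riemannUp G c d) y =
      pdMatrix e (riemannMatrix G c d) y * (G y)⁻¹ + riemannMatrix G c d y *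
        (-(christoffelMatrix G e y * (G y)⁻¹) - (G y)⁻¹ * (christoffelMatrix G e y)ᵀ) := by
    intro e c d
    rw [← h.pdMatrix_inv hy, ← pdMatrix_mul h.isOpen (h.smooth_riemannMatrix c d) h.smooth_inv hy]
    rfl
  have h1 := congrArg (· * (G y)⁻¹) (h.bianchi hy e c d)
  simp only [Matrix.zero_mul] at h1
  rw [key, key, key, ← h1]
  simp only [riemannUp]
  noncomm_ring

end IsMetricOn

/-! ### Contracted Bianchi identity and constancy of the scalar curvature -/

open Set Matrix

/-- The double contraction of the second Bianchi identity, as an identity between arrays. Here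
`w a b c d` stands for `Rᵃᵇ_cd`, `dw` for its partial derivatives and `γ a e m` for the
Christoffel symbols. -/
theorem contract_bianchi_array (w : Fin 4 → Fin 4 → Fin 4 → Fin 4 → ℝ)
    (dw : Fin 4 → Fin 4 → Fin 4 → Fin 4 → Fin 4 → ℝ) (γ : Fin 4 → Fin 4 → Fin 4 → ℝ)
    (hγ : ∀ a e m, γ a e m = γ a m e)
    (hw₁ : ∀ a b c d, w a b c d = -w b a c d) (hw₂ : ∀ a b c d, w a b c d = -w a b d c)
    (hdw₁ : ∀ e a b c d, dw e a b c d = -dw e b a c d)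
    (hdw₂ : ∀ e a b c d, dw e a b c d = -dw e a b d c)
    (hB : ∀ e c d a b,
      (dw e a b c d + (∑ m, γ a e m * w m b c d + ∑ m, w a m c d * γ b e m))
      + (dw c a b d e + (∑ m, γ a c m * w m b d e + ∑ m, w a m d e * γ b c m))
      + (dw d a b e c + (∑ m, γ a d m * w m b e c + ∑ m, w a m e c * γ b d m)) = 0)
    (d : Fin 4) :
    2 * ((∑ b, ∑ a, dw b a b a d) + (∑ b, ∑ m, γ b b m * ∑ a, w a m a d)
      - ∑ a, ∑ m, γ a d m * ∑ n, w n m n a) = ∑ b, ∑ a, dw d a b a b := by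
  -- The Bianchi identity is contracted by setting the derivative index `e` equal to the second
  -- upper index and `c` equal to the first.
  have hsum : ∑ a, ∑ b,
      ((dw b a b a d + (∑ m, γ a b m * w m b a d + ∑ m, w a m a d * γ b b m))
      + (dw a a b d b + (∑ m, γ a a m * w m b d b + ∑ m, w a m d b * γ b a m))
      + (dw d a b b a + (∑ m, γ a d m * w m b b a + ∑ m, w a m b a * γ b d m))) = 0 :=
    Finset.sum_eq_zero fun a _ => Finset.sum_eq_zero fun b _ => hB b a d a b
  simp only [Finset.sum_add_distrib] at hsum
  have t1 : ∑ a, ∑ b, dw b a b a d = ∑ b, ∑ a, dw b a b a d := Finset.sum_comm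
  have t2 : ∑ a, ∑ b, dw a a b d b = ∑ b, ∑ a, dw b a b a d :=
    Finset.sum_congr rfl fun a _ => Finset.sum_congr rfl fun b _ => by
      rw [hdw₁, hdw₂, neg_neg]
  have t3 : ∑ a, ∑ b, dw d a b b a = -∑ b, ∑ a, dw d a b a b := by
    rw [Finset.sum_comm]
    simp only [← Finset.sum_neg_distrib]
    exact Finset.sum_congr rfl fun b _ => Finset.sum_congr rfl fun a _ => by rw [hdw₂]
  -- Here `γ` is symmetric and `w` antisymmetric in the summed pair `b`, `m`, so the sum is its own
  -- negative; `u2'` vanishes in the same way.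
  have u1 : ∑ a, ∑ b, ∑ m, γ a b m * w m b a d = 0 := by
    refine Finset.sum_eq_zero fun a _ => ?_
    have : ∑ b, ∑ m, γ a b m * w m b a d = -∑ b, ∑ m, γ a b m * w m b a d := by
      conv_lhs => rw [Finset.sum_comm]
      simp only [← Finset.sum_neg_distrib]
      refine Finset.sum_congr rfl fun b _ => Finset.sum_congr rfl fun m _ => ?_
      rw [hw₁, hγ]
      ring
    linarith
  have u1' : ∑ a, ∑ b, ∑ m, w a m a d * γ b b m = ∑ b, ∑ m, γ b b m * ∑ a, w a m a d := by
    rw [Finset.sum_comm]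
    refine Finset.sum_congr rfl fun b _ => ?_
    rw [Finset.sum_comm]
    refine Finset.sum_congr rfl fun m _ => ?_
    rw [Finset.mul_sum]
    exact Finset.sum_congr rfl fun a _ => mul_comm _ _
  have u2 : ∑ a, ∑ b, ∑ m, γ a a m * w m b d b = ∑ b, ∑ m, γ b b m * ∑ a, w a m a d := by
    refine Finset.sum_congr rfl fun a _ => ?_
    rw [Finset.sum_comm]
    refine Finset.sum_congr rfl fun m _ => ?_
    rw [Finset.mul_sum]
    exact Finset.sum_congr rfl fun b _ => by rw [hw₁, hw₂, neg_neg]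
  have u2' : ∑ a, ∑ b, ∑ m, w a m d b * γ b a m = 0 := by
    rw [Finset.sum_comm]
    refine Finset.sum_eq_zero fun b _ => ?_
    have : ∑ a, ∑ m, w a m d b * γ b a m = -∑ a, ∑ m, w a m d b * γ b a m := by
      conv_lhs => rw [Finset.sum_comm]
      simp only [← Finset.sum_neg_distrib]
      refine Finset.sum_congr rfl fun a _ => Finset.sum_congr rfl fun m _ => ?_
      rw [hw₁, hγ]
      ring
    linarith
  have u3 : ∑ a, ∑ b, ∑ m, γ a d m * w m b b a = -∑ a, ∑ m, γ a d m * ∑ n, w n m n a := by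
    simp only [← Finset.sum_neg_distrib]
    refine Finset.sum_congr rfl fun a _ => ?_
    rw [Finset.sum_comm]
    refine Finset.sum_congr rfl fun m _ => ?_
    rw [Finset.mul_sum, ← Finset.sum_neg_distrib]
    exact Finset.sum_congr rfl fun b _ => by rw [hw₁]; ring
  have u3' : ∑ a, ∑ b, ∑ m, w a m b a * γ b d m = -∑ a, ∑ m, γ a d m * ∑ n, w n m n a := by
    rw [Finset.sum_comm]
    simp only [← Finset.sum_neg_distrib]
    refine Finset.sum_congr rfl fun b _ => ?_
    rw [Finset.sum_comm]
    refine Finset.sum_congr rfl fun m _ => ?_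
    rw [Finset.mul_sum, ← Finset.sum_neg_distrib]
    exact Finset.sum_congr rfl fun a _ => by rw [hw₂]; ring
  linarith

/-- The matrix `(Rᵇ_d)_bd`. -/
noncomputable def ricciUp (G : E4 → Matrix (Fin 4) (Fin 4) ℝ) (y : E4) :
    Matrix (Fin 4) (Fin 4) ℝ :=
  (G y)⁻¹ * ricciMatrix G y

namespace IsMetricOn

variable {G : E4 → Matrix (Fin 4) (Fin 4) ℝ} {U : Set E4} {y : E4}

theorem riemannUp_contract (h : IsMetricOn G U) (hy : y ∈ U) (m d : Fin 4) :
    ∑ a, riemannUp G a d y a m = ricciUp G y m d := by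
  simp only [riemannUp, ricciUp, Matrix.mul_apply]
  rw [Finset.sum_comm]
  refine Finset.sum_congr rfl fun b _ => ?_
  rw [← Finset.sum_mul, h.inv_symm_apply hy m b, mul_comm]
  rfl

theorem smooth_ricciUp (h : IsMetricOn G U) : SmoothMatrixOn (ricciUp G) U :=
  h.smooth_inv.mul h.smooth_ricciMatrix

/-- The contracted second Bianchi identity. -/
theorem contracted_bianchi (h : IsMetricOn G U) (hy : y ∈ U) (d : Fin 4) :
    2 * ((∑ b, pdMatrix b (ricciUp G) y b d)
      + (∑ b, (christoffelMatrix G b y * ricciUp G y) b d)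
      - ∑ a, (ricciUp G y * christoffelMatrix G a y) a d)
      = (pdMatrix d (ricciUp G) y).trace := by
  have hpd : ∀ e m d : Fin 4, pdMatrix e (ricciUp G) y m d
      = ∑ a, pdMatrix e (riemannUp G a d) y a m := by
    intro e m d
    change pd e (fun z => ricciUp G z m d) y = _
    rw [pd_congr_of_eqOn h.isOpen (fun z hz => (h.riemannUp_contract hz m d).symm) hy,
      pd_sum _ fun a _ => (h.smooth_riemannUp a d).differentiableAt h.isOpen hy a m]
    rfl
  have hsk : ∀ z ∈ U, ∀ a b c d, riemannUp G c d z a b = -riemannUp G c d z b a := by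
    intro z hz a b c d
    have := congrFun (congrFun (h.riemannUp_skew hz c d) b) a
    simpa using this
  have hanti : ∀ z, ∀ a b c d, riemannUp G c d z a b = -riemannUp G d c z a b := by
    intro z a b c d
    rw [riemannUp, riemannUp, riemannMatrix_antisymm, Matrix.neg_mul, Matrix.neg_apply]
  have key := contract_bianchi_array (fun a b c d => riemannUp G c d y a b)
    (fun e a b c d => pdMatrix e (riemannUp G c d) y a b)
    (fun a e m => christoffel G a e m y) (fun a e m => h.christoffel_symm hy a e m)
    (fun a b c d => hsk y hy a b c d) (fun a b c d => hanti y a b c d)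
    (fun e a b c d => by
      change pd e (fun z => riemannUp G c d z a b) y = -pd e (fun z => riemannUp G c d z b a) y
      rw [← pd_neg]
      exact pd_congr_of_eqOn h.isOpen (fun z hz => hsk z hz a b c d) hy)
    (fun e a b c d => by
      change pd e (fun z => riemannUp G c d z a b) y = -pd e (fun z => riemannUp G d c z a b) y
      rw [← pd_neg]
      exact pd_congr_of_eqOn h.isOpen (fun z _ => hanti z a b c d) hy)
    (fun e c d a b => by
      have := congrFun (congrFun (h.bianchi_up hy e c d) a) b
      simpa only [Matrix.add_apply, Matrix.mul_apply, Matrix.transpose_apply, christoffelMatrix,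
        Matrix.of_apply, Matrix.zero_apply] using this) d
  have e3 : ∑ a, (ricciUp G y * christoffelMatrix G a y) a d
      = ∑ a, ∑ m, christoffel G a d m y * ricciUp G y m a := by
    rw [Finset.sum_comm]
    simp only [Matrix.mul_apply, christoffelMatrix, Matrix.of_apply]
    exact Finset.sum_congr rfl fun m _ => Finset.sum_congr rfl fun a _ => by
      rw [h.christoffel_symm hy, mul_comm]
  simp only [h.riemannUp_contract hy, ← hpd] at key
  rw [e3]
  simp only [Matrix.mul_apply, christoffelMatrix, Matrix.of_apply, Matrix.trace, Matrix.diag]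
  exact key

theorem covRicciMatrix_eq (G : E4 → Matrix (Fin 4) (Fin 4) ℝ) (a : Fin 4) (y : E4) :
    covRicciMatrix G a y = pdMatrix a (ricciMatrix G) y
      - (christoffelMatrix G a y)ᵀ * ricciMatrix G y
      - ricciMatrix G y * christoffelMatrix G a y := by
  ext b c
  simp only [covRicciMatrix, covRicci, Matrix.of_apply, Matrix.sub_apply, Matrix.mul_apply,
    Matrix.transpose_apply, christoffelMatrix, ricciMatrix, pdMatrix, Finset.sum_add_distrib]
  simp only [mul_comm (ricci G b _ y)]
  ring

/-- Because the inverse metric is parallel, the derivative of the mixed Ricci tensor is the raised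
∇Ric plus a commutator with Γ. The commutator has trace zero, so it disappears from the gradient of
the scalar curvature. -/
theorem pdMatrix_ricciUp (h : IsMetricOn G U) (hy : y ∈ U) (a : Fin 4) :
    pdMatrix a (ricciUp G) y = (G y)⁻¹ * covRicciMatrix G a y
      + ricciUp G y * christoffelMatrix G a y - christoffelMatrix G a y * ricciUp G y := by
  have : pdMatrix a (ricciUp G) y = pdMatrix a (fun z => (G z)⁻¹) y * ricciMatrix G y
      + (G y)⁻¹ * pdMatrix a (ricciMatrix G) y :=
    pdMatrix_mul h.isOpen h.smooth_inv h.smooth_ricciMatrix hy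
  rw [this, h.pdMatrix_inv hy, covRicciMatrix_eq, ricciUp]
  noncomm_ring

/-- The contracted second Bianchi identity, in terms of the covariant derivative of the Ricci
tensor. -/
theorem divergence_ricci (h : IsMetricOn G U) (hy : y ∈ U) (d : Fin 4) :
    2 * ∑ a, ((G y)⁻¹ * covRicciMatrix G a y) a d = (pdMatrix d (ricciUp G) y).trace := by
  rw [← h.contracted_bianchi hy d, ← Finset.sum_add_distrib, ← Finset.sum_sub_distrib]
  congr 1
  refine Finset.sum_congr rfl fun a _ => ?_
  rw [h.pdMatrix_ricciUp hy]
  simp only [Matrix.add_apply, Matrix.sub_apply]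
  ring


/-- If the Ricci tensor is symmetric and satisfies the Codazzi equation, then the scalar curvature
has vanishing derivative. -/
theorem trace_pdMatrix_ricciUp_eq_zero (h : IsMetricOn G U) (hy : y ∈ U)
    (hsymm : ∀ z ∈ U, (ricciMatrix G z)ᵀ = ricciMatrix G z)
    (hyang : ∀ a b c, covRicci G a b c y = covRicci G b a c y) (d : Fin 4) :
    (pdMatrix d (ricciUp G) y).trace = 0 := by
  have hcs : ∀ a, (covRicciMatrix G a y)ᵀ = covRicciMatrix G a y := by
    intro a
    have h1 : (pdMatrix a (ricciMatrix G) y)ᵀ = pdMatrix a (ricciMatrix G) y := by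
      rw [← pdMatrix_transpose]
      exact pdMatrix_congr h.isOpen hsymm hy
    rw [covRicciMatrix_eq]
    simp only [Matrix.transpose_sub, Matrix.transpose_mul, h1, hsymm y hy,
      Matrix.transpose_transpose]
    abel
  have hcs' : ∀ a b c, covRicci G a b c y = covRicci G a c b y := fun a b c =>
    congrFun (congrFun (hcs a) c) b
  have h1 : (pdMatrix d (ricciUp G) y).trace = ((G y)⁻¹ * covRicciMatrix G d y).trace := by
    rw [h.pdMatrix_ricciUp hy, Matrix.trace_sub, Matrix.trace_add, Matrix.trace_mul_comm
      (ricciUp G y)]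
    ring
  -- By symmetry of Ric and the Codazzi equation, the divergence of Ric equals the gradient of its
  -- trace. The contracted Bianchi identity says that twice the divergence is that gradient, so both
  -- vanish.
  have h2 : ∑ a, ((G y)⁻¹ * covRicciMatrix G a y) a d = ((G y)⁻¹ * covRicciMatrix G d y).trace := by
    refine Finset.sum_congr rfl fun a _ => ?_
    simp only [Matrix.mul_apply, Matrix.diag]
    refine Finset.sum_congr rfl fun b _ => ?_
    congr 1
    change covRicci G a b d y = covRicci G d b a y
    rw [hcs' a b d, hyang, hcs']
  have h3 := h.divergence_ricci hy d
  rw [h2, h1] at h3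
  rw [h1]
  linarith

end IsMetricOn

open Set Matrix

/-! ### Orthonormal frames at a point -/

/-- The signs of the Minkowski metric. -/
def mink (i j : Fin 4) : ℝ := if i = j then (if i = 0 then -1 else 1) else 0

/-- The components of the covector dual to the first frame vector. -/
def timeComp (i : Fin 4) : ℝ := if i = 0 then -1 else 0

/-- Contraction of a covector with a frame. -/
def hat (f : Fin 4 → Fin 4 → ℝ) (x : Fin 4 → ℝ) (i : Fin 4) : ℝ := f i ⬝ᵥ x

/-- Contraction of a 2-tensor with a frame. -/
def hat₂ (f : Fin 4 → Fin 4 → ℝ) (x : Fin 4 → Fin 4 → ℝ) (i j : Fin 4) : ℝ :=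
  hat f (fun a => hat f (x a) j) i

/-- Contraction of a 3-tensor with a frame. -/
def hat₃ (f : Fin 4 → Fin 4 → ℝ) (x : Fin 4 → Fin 4 → Fin 4 → ℝ) (i j k : Fin 4) : ℝ :=
  hat f (fun a => hat₂ f (x a) j k) i

/-- Contraction of a 4-tensor with a frame. -/
def hat₄ (f : Fin 4 → Fin 4 → ℝ) (x : Fin 4 → Fin 4 → Fin 4 → Fin 4 → ℝ) (i j k l : Fin 4) : ℝ :=
  hat f (fun a => hat₃ f (x a) j k l) i

section Hat

variable (f : Fin 4 → Fin 4 → ℝ) (x y : Fin 4 → ℝ) (r : ℝ) (i : Fin 4)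

theorem hat_add : hat f (fun a => x a + y a) i = hat f x i + hat f y i := dotProduct_add _ _ _

theorem hat_sub : hat f (fun a => x a - y a) i = hat f x i - hat f y i := dotProduct_sub _ _ _

theorem hat_neg : hat f (fun a => -x a) i = -hat f x i := dotProduct_neg _ _

theorem hat_mul_left : hat f (fun a => r * x a) i = r * hat f x i := by
  simp only [hat, dotProduct, Finset.mul_sum, mul_left_comm]

theorem hat_mul_right : hat f (fun a => x a * r) i = hat f x i * r := by
  simp only [mul_comm _ r, hat_mul_left]

theorem hat_comm (X : Fin 4 → Fin 4 → ℝ) (i j : Fin 4) :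
    hat f (fun a => hat f (fun b => X b a) j) i = hat₂ f X j i := by
  simp only [hat₂, hat, dotProduct, Finset.mul_sum]
  rw [Finset.sum_comm]
  exact Finset.sum_congr rfl fun _ _ => Finset.sum_congr rfl fun _ _ => by ring

end Hat

/-- `f` is an orthonormal frame for the Lorentz matrix `G` whose first vector is dual to `u`. -/
structure IsFrame (f : Fin 4 → Fin 4 → ℝ) (G : Matrix (Fin 4) (Fin 4) ℝ) (u : Fin 4 → ℝ) :
    Prop where
  orth : ∀ i j, hat₂ f G i j = mink i j
  dual : ∀ b, hat f (fun a => G a b) 0 = u b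

namespace IsFrame

variable {f : Fin 4 → Fin 4 → ℝ} {G : Matrix (Fin 4) (Fin 4) ℝ} {u : Fin 4 → ℝ}

theorem hat_velocity (h : IsFrame f G u) (i : Fin 4) : hat f u i = timeComp i := by
  have h1 := hat_comm f G i 0
  rw [h.orth] at h1
  simp only [h.dual] at h1
  rw [h1, timeComp, mink]
  fin_cases i <;> simp

theorem orth_matrix (h : IsFrame f G u) :
    Matrix.of f * G * (Matrix.of f)ᵀ = Matrix.of mink := by
  ext i j
  rw [Matrix.of_apply, ← h.orth i j, Matrix.mul_assoc]
  simp only [Matrix.mul_apply, hat₂, hat, dotProduct, Matrix.of_apply, Matrix.transpose_apply]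
  exact Finset.sum_congr rfl fun _ _ => by
    congr 1
    exact Finset.sum_congr rfl fun _ _ => mul_comm _ _

theorem mink_mul_mink : Matrix.of mink * Matrix.of mink = 1 := by
  ext i j
  fin_cases i <;> fin_cases j <;> simp [Matrix.mul_apply, mink]

theorem mul_left_inv (h : IsFrame f G u) :
    (Matrix.of f)ᵀ * (Matrix.of mink * Matrix.of f * G) = 1 := by
  rw [mul_eq_one_comm, Matrix.mul_assoc, Matrix.mul_assoc, ← Matrix.mul_assoc (Matrix.of f),
    h.orth_matrix, mink_mul_mink]

theorem inv_eq (h : IsFrame f G u) :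
    G⁻¹ = (Matrix.of f)ᵀ * (Matrix.of mink * Matrix.of f) :=
  Matrix.inv_eq_left_inv (by rw [Matrix.mul_assoc]; exact h.mul_left_inv)

/-- A frame matrix is invertible because it carries `G` to the Minkowski matrix. Hence tensor
identities at a point can be checked on frame components, where `G` and `u` are constant arrays. -/
theorem ext_hat (h : IsFrame f G u) {x y : Fin 4 → ℝ} (hxy : ∀ i, hat f x i = hat f y i) (a : Fin 4) :
    x a = y a := by
  have h1 : Matrix.of f *ᵥ x = Matrix.of f *ᵥ y := funext hxy
  have h2 : ((Matrix.of mink * Matrix.of f * G))ᵀ * Matrix.of f = 1 := by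
    have := congrArg Matrix.transpose h.mul_left_inv
    simpa only [Matrix.transpose_mul, Matrix.transpose_one, Matrix.transpose_transpose] using this
  have h3 := congrArg (fun z => ((Matrix.of mink * Matrix.of f * G))ᵀ *ᵥ z) h1
  simp only [Matrix.mulVec_mulVec, h2, Matrix.one_mulVec] at h3
  exact congrFun h3 a

theorem ext_hat₂ (h : IsFrame f G u) {x y : Fin 4 → Fin 4 → ℝ}
    (hxy : ∀ i j, hat₂ f x i j = hat₂ f y i j) (a b : Fin 4) : x a b = y a b :=
  h.ext_hat (fun j => h.ext_hat (fun i => hxy i j) a) b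

theorem ext_hat₃ (h : IsFrame f G u) {x y : Fin 4 → Fin 4 → Fin 4 → ℝ}
    (hxy : ∀ i j k, hat₃ f x i j k = hat₃ f y i j k) (a b c : Fin 4) : x a b c = y a b c :=
  h.ext_hat₂ (fun j k => h.ext_hat (fun i => hxy i j k) a) b c

theorem ext_hat₄ (h : IsFrame f G u) {x y : Fin 4 → Fin 4 → Fin 4 → Fin 4 → ℝ}
    (hxy : ∀ i j k l, hat₄ f x i j k l = hat₄ f y i j k l) (a b c d : Fin 4) :
    x a b c d = y a b c d :=
  h.ext_hat₃ (fun j k l => h.ext_hat (fun i => hxy i j k l) a) b c d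

theorem dotProduct_inv (h : IsFrame f G u) (v w : Fin 4 → ℝ) :
    v ⬝ᵥ (G⁻¹ *ᵥ w) = ∑ i, mink i i * hat f v i * hat f w i := by
  have h1 : v ⬝ᵥ (G⁻¹ *ᵥ w) = (Matrix.of f *ᵥ v) ⬝ᵥ (Matrix.of mink *ᵥ (Matrix.of f *ᵥ w)) := by
    rw [h.inv_eq, ← Matrix.mulVec_mulVec, Matrix.dotProduct_mulVec, Matrix.vecMul_transpose,
      Matrix.mulVec_mulVec]
  rw [h1]
  change ∑ i, hat f v i * ∑ j, mink i j * hat f w j = _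
  refine Finset.sum_congr rfl fun i _ => ?_
  rw [Finset.sum_eq_single i (fun j _ hj => by simp [mink, hj.symm]) (by simp)]
  ring

/-- The metric trace of a 2-tensor, computed in a frame. -/
theorem trace_inv (h : IsFrame f G u) (X : Fin 4 → Fin 4 → ℝ) :
    ∑ a, ∑ b, G⁻¹ a b * X a b = ∑ i, mink i i * hat₂ f X i i := by
  have h1 : ∀ a b, G⁻¹ a b = ∑ i, mink i i * f i a * f i b := by
    intro a b
    have := h.dotProduct_inv (Pi.single a 1) (Pi.single b 1)
    simpa [hat] using this
  simp only [h1, hat₂, hat, dotProduct, Finset.sum_mul, Finset.mul_sum]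
  simp only [Fin.sum_univ_four]
  ring

end IsFrame

/-! ### Covariant derivatives of covector fields and 2-tensors -/

/-- The components `∇_c v_b` of the covariant derivative of a covector field. -/
noncomputable def covVec (G : E4 → Matrix (Fin 4) (Fin 4) ℝ) (v : Fin 4 → E4 → ℝ) (c b : Fin 4)
    (y : E4) : ℝ :=
  pd c (v b) y - ∑ e, christoffel G e c b y * v e y

/-- The components `∇_c X_db` of the covariant derivative of a 2-tensor. -/
noncomputable def covTensor (G : E4 → Matrix (Fin 4) (Fin 4) ℝ) (X : Fin 4 → Fin 4 → E4 → ℝ)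
    (c d b : Fin 4) (y : E4) : ℝ :=
  pd c (X d b) y - ∑ e, christoffel G e c d y * X e b y - ∑ e, christoffel G e c b y * X d e y

/-- The inner product of two covectors at a point. -/
noncomputable def ip (G : E4 → Matrix (Fin 4) (Fin 4) ℝ) (v w : Fin 4 → ℝ) (y : E4) : ℝ :=
  v ⬝ᵥ ((G y)⁻¹ *ᵥ w)

section CovariantDerivative

variable {G : E4 → Matrix (Fin 4) (Fin 4) ℝ} {U : Set E4} {y : E4}

theorem covTensor_add {X Y : Fin 4 → Fin 4 → E4 → ℝ} (hX : ∀ a b, DifferentiableAt ℝ (X a b) y)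
    (hY : ∀ a b, DifferentiableAt ℝ (Y a b) y) (c d b : Fin 4) :
    covTensor G (fun a b z => X a b z + Y a b z) c d b y
      = covTensor G X c d b y + covTensor G Y c d b y := by
  simp only [covTensor, pd_add (hX d b) (hY d b), mul_add, Finset.sum_add_distrib]
  ring

theorem covTensor_sub {X Y : Fin 4 → Fin 4 → E4 → ℝ} (hX : ∀ a b, DifferentiableAt ℝ (X a b) y)
    (hY : ∀ a b, DifferentiableAt ℝ (Y a b) y) (c d b : Fin 4) :
    covTensor G (fun a b z => X a b z - Y a b z) c d b y
      = covTensor G X c d b y - covTensor G Y c d b y := by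
  simp only [covTensor, pd_sub (hX d b) (hY d b), mul_sub, Finset.sum_sub_distrib]
  ring

theorem covTensor_smul {r : E4 → ℝ} {X : Fin 4 → Fin 4 → E4 → ℝ} (hr : DifferentiableAt ℝ r y)
    (hX : ∀ a b, DifferentiableAt ℝ (X a b) y) (c d b : Fin 4) :
    covTensor G (fun a b z => r z * X a b z) c d b y
      = pd c r y * X d b y + r y * covTensor G X c d b y := by
  simp only [covTensor, pd_mul hr (hX d b), mul_left_comm _ (r y), ← Finset.mul_sum]
  ring

theorem covTensor_tmul {v w : Fin 4 → E4 → ℝ} (hv : ∀ a, DifferentiableAt ℝ (v a) y)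
    (hw : ∀ a, DifferentiableAt ℝ (w a) y) (c d b : Fin 4) :
    covTensor G (fun a b z => v a z * w b z) c d b y
      = covVec G v c d y * w b y + v d y * covVec G w c b y := by
  have h1 : ∑ e, christoffel G e c d y * (v e y * w b y)
      = (∑ e, christoffel G e c d y * v e y) * w b y := by
    simp only [Finset.sum_mul, mul_assoc]
  have h2 : ∑ e, christoffel G e c b y * (v d y * w e y)
      = v d y * ∑ e, christoffel G e c b y * w e y := by
    simp only [Finset.mul_sum, mul_left_comm]
  rw [covTensor, covVec, covVec, pd_mul (hv d) (hw b), h1, h2]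
  ring

theorem covVec_add {v w : Fin 4 → E4 → ℝ} (hv : ∀ a, DifferentiableAt ℝ (v a) y)
    (hw : ∀ a, DifferentiableAt ℝ (w a) y) (c b : Fin 4) :
    covVec G (fun a z => v a z + w a z) c b y = covVec G v c b y + covVec G w c b y := by
  simp only [covVec, pd_add (hv b) (hw b), mul_add, Finset.sum_add_distrib]
  ring

theorem covVec_smul {r : E4 → ℝ} {v : Fin 4 → E4 → ℝ} (hr : DifferentiableAt ℝ r y)
    (hv : ∀ a, DifferentiableAt ℝ (v a) y) (c b : Fin 4) :
    covVec G (fun a z => r z * v a z) c b y = pd c r y * v b y + r y * covVec G v c b y := by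
  simp only [covVec, pd_mul hr (hv b), mul_left_comm _ (r y), ← Finset.mul_sum]
  ring

namespace IsMetricOn

theorem covTensor_metric (h : IsMetricOn G U) (hy : y ∈ U) (c d b : Fin 4) :
    covTensor G (fun a b z => G z a b) c d b y = 0 := by
  have := congrFun (congrFun (h.pdMatrix_metric hy c) d) b
  simp only [Matrix.add_apply, Matrix.mul_apply, Matrix.transpose_apply, christoffelMatrix,
    Matrix.of_apply, pdMatrix] at this
  rw [covTensor, this]
  simp only [mul_comm (G y d _)]
  ring

theorem pd_ip (h : IsMetricOn G U) (hy : y ∈ U) {v w : Fin 4 → E4 → ℝ}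
    (hv : ∀ a, DifferentiableAt ℝ (v a) y) (hw : ∀ a, DifferentiableAt ℝ (w a) y) (c : Fin 4) :
    pd c (fun z => ip G (fun a => v a z) (fun a => w a z) z) y
      = ip G (fun b => covVec G v c b y) (fun a => w a y) y
        + ip G (fun a => v a y) (fun b => covVec G w c b y) y := by
  have hGi := h.smooth_inv.differentiableAt h.isOpen hy
  have h1 : pd c (fun z => ip G (fun a => v a z) (fun a => w a z) z) y =
      (fun b => pd c (v b) y) ⬝ᵥ ((G y)⁻¹ *ᵥ fun a => w a y)
      + ((fun a => v a y) ⬝ᵥ (pdMatrix c (fun z => (G z)⁻¹) y *ᵥ fun a => w a y)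
      + (fun a => v a y) ⬝ᵥ ((G y)⁻¹ *ᵥ fun b => pd c (w b) y)) := by
    simp only [ip, dotProduct, Matrix.mulVec]
    rw [pd_sum _ fun a _ => (hv a).fun_mul (DifferentiableAt.fun_sum fun b _ =>
      (hGi a b).fun_mul (hw b)), ← Finset.sum_add_distrib, ← Finset.sum_add_distrib]
    refine Finset.sum_congr rfl fun a _ => ?_
    rw [pd_mul (hv a) (DifferentiableAt.fun_sum fun b _ => (hGi a b).fun_mul (hw b)),
      pd_sum _ fun b _ => (hGi a b).fun_mul (hw b), ← mul_add, ← Finset.sum_add_distrib]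
    congr 2
    exact Finset.sum_congr rfl fun b _ => pd_mul (hGi a b) (hw b)
  have h2 : ∀ v : Fin 4 → E4 → ℝ, (fun b => pd c (v b) y) = (fun b => covVec G v c b y)
      + (christoffelMatrix G c y)ᵀ *ᵥ fun a => v a y := by
    intro v
    funext b
    simp [covVec, Matrix.mulVec, dotProduct, christoffelMatrix]
  rw [h1, h.pdMatrix_inv hy, h2 v, h2 w]
  simp only [ip, Matrix.sub_mulVec, Matrix.neg_mulVec, Matrix.mulVec_add, dotProduct_add,
    add_dotProduct, dotProduct_sub, dotProduct_neg, ← Matrix.mulVec_mulVec]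
  have h3 : ∀ x z : Fin 4 → ℝ, ((christoffelMatrix G c y)ᵀ *ᵥ x) ⬝ᵥ z
      = x ⬝ᵥ (christoffelMatrix G c y *ᵥ z) := by
    intro x z
    rw [Matrix.mulVec_transpose, Matrix.dotProduct_mulVec]
  rw [h3]
  ring

/-- The Ricci identity, in a form which only needs the first derivatives of `v` at one point. -/
theorem ricci_identity_at (h : IsMetricOn G U) (hy : y ∈ U) {v : Fin 4 → E4 → ℝ}
    {X : Fin 4 → Fin 4 → E4 → ℝ} (hv : ∀ a, DifferentiableAt ℝ (v a) y)
    (hX : ∀ a b, DifferentiableAt ℝ (X a b) y) (hcov : ∀ c b, covVec G v c b y = X c b y)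
    (b c d : Fin 4) :
    pd c (fun z => (∑ e, christoffel G e d b z * v e z) + X d b z) y
      - pd d (fun z => (∑ e, christoffel G e c b z * v e z) + X c b z) y
      = (∑ a, v a y * riemann G a b c d y) + (covTensor G X c d b y - covTensor G X d c b y) := by
  have hΓ : ∀ k i j, DifferentiableAt ℝ (christoffel G k i j) y := fun k i j =>
    differentiableAt_of_contDiffOn h.isOpen (h.smooth_christoffel k i j) hy
  have hpv : ∀ c e, pd c (v e) y = (∑ a, christoffel G a c e y * v a y) + X c e y := by
    intro c e
    rw [← hcov, covVec]
    ring
  have key : ∀ c d, pd c (fun z => (∑ e, christoffel G e d b z * v e z) + X d b z) y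
      = (∑ a, v a y * (pd c (christoffel G a d b) y
          + ∑ e, christoffel G a c e y * christoffel G e d b y))
        + (∑ e, christoffel G e d b y * X c e y) + pd c (X d b) y := by
    intro c d
    rw [pd_add (DifferentiableAt.fun_sum fun e _ => (hΓ e d b).fun_mul (hv e)) (hX d b),
      pd_sum _ fun e _ => (hΓ e d b).fun_mul (hv e)]
    simp only [pd_mul (hΓ _ d b) (hv _), hpv, mul_add, Finset.sum_add_distrib, Finset.mul_sum]
    rw [Finset.sum_comm (f := fun x i =>
      christoffel G x d b y * (christoffel G i c x y * v i y))]
    simp only [← add_assoc]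
    congr 3
    · exact Finset.sum_congr rfl fun a _ => mul_comm _ _
    · exact Finset.sum_congr rfl fun a _ => Finset.sum_congr rfl fun e _ => by ring
  rw [key, key]
  have hs : ∑ e, christoffel G e c d y * X e b y = ∑ e, christoffel G e d c y * X e b y :=
    Finset.sum_congr rfl fun e _ => by rw [h.christoffel_symm hy]
  simp only [riemann, covTensor, hs, Finset.sum_sub_distrib, mul_add, mul_sub,
    Finset.sum_add_distrib]
  ring

theorem ricci_identity (h : IsMetricOn G U) (hy : y ∈ U) {v : Fin 4 → E4 → ℝ}
    {X : Fin 4 → Fin 4 → E4 → ℝ} (hv : ∀ a, ContDiffOn ℝ ∞ (v a) U)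
    (hX : ∀ a b, ContDiffOn ℝ ∞ (X a b) U) (hcov : ∀ z ∈ U, ∀ c b, covVec G v c b z = X c b z)
    (b c d : Fin 4) :
    (∑ a, v a y * riemann G a b c d y) = covTensor G X d c b y - covTensor G X c d b y := by
  have h1 := h.ricci_identity_at hy (fun a => differentiableAt_of_contDiffOn h.isOpen (hv a) hy)
    (fun a b => differentiableAt_of_contDiffOn h.isOpen (hX a b) hy) (hcov y hy) b c d
  have h2 : ∀ d, EqOn (fun z => (∑ e, christoffel G e d b z * v e z) + X d b z) (pd d (v b)) U := by
    intro d z hz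
    have := hcov z hz d b
    simp only [← this, covVec]
    ring
  rw [pd_congr_of_eqOn h.isOpen (h2 d) hy, pd_congr_of_eqOn h.isOpen (h2 c) hy,
    pd_comm h.isOpen (hv b) hy] at h1
  linarith

end IsMetricOn

end CovariantDerivative


open Set Matrix

/-! ### Perfect fluids satisfying the Codazzi equation, in one chart -/

/-- The Codazzi equation of a perfect fluid, in an orthonormal frame adapted to the velocity. -/
theorem codazzi_frame {F : ℝ} {dF dh : Fin 4 → ℝ} {N : Fin 4 → Fin 4 → ℝ}
    (h4 : ∀ i, dF i = 4 * dh i) (hN : ∀ i, N i 0 = 0)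
    (heq : ∀ i j k, dF i * (timeComp j * timeComp k)
        + F * (N i j * timeComp k + timeComp j * N i k) + dh i * mink j k
      = dF j * (timeComp i * timeComp k)
        + F * (N j i * timeComp k + timeComp i * N j k) + dh j * mink i k) :
    (∀ i, dh i = -dh 0 * timeComp i) ∧
      ∀ i j, F * N i j = -dh 0 * (mink i j + timeComp i * timeComp j) := by
  -- For distinct spatial `i`, `j` and `k = j`, only the term in `dh i` survives, so the spatial
  -- gradient of h vanishes.
  have e1 := heq 1 2 2
  have e2 := heq 2 1 1
  have e3 := heq 3 1 1
  simp [timeComp, mink] at e1 e2 e3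
  have hh : ∀ i, dh i = -dh 0 * timeComp i := by
    intro i
    fin_cases i <;> simp [timeComp, e1, e2, e3]
  refine ⟨hh, fun i j => ?_⟩
  -- The components `0 j 0` with `j` spatial remove the acceleration of u. The components `0 i j`
  -- with both indices spatial leave only a pure trace in ∇u, so shear and rotation vanish as well.
  have e0 := heq 0 j 0
  have ej := heq 0 i j
  have h4i := h4 j
  have hhj := hh j
  fin_cases i <;> fin_cases j <;> simp [timeComp, mink, hN, -mul_eq_zero] at e0 ej h4i hhj ⊢ <;>
    linarith

/-- A 4-tensor with the antisymmetries of a Riemann tensor, which has no time components and no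
Ricci contraction, vanishes: in dimension 3 the Ricci tensor determines the curvature. -/
theorem curvature_frame_eq_zero {T : Fin 4 → Fin 4 → Fin 4 → Fin 4 → ℝ}
    (h1 : ∀ i j k l, T i j k l = -T j i k l) (h2 : ∀ i j k l, T i j k l = -T i j l k)
    (hB : ∀ i j k l, T i j k l + T i k l j + T i l j k = 0)
    (h0 : ∀ j k l, T 0 j k l = 0) (hR : ∀ j l, ∑ i, mink i i * T i j i l = 0) (i j k l : Fin 4) :
    T i j k l = 0 := by
  have h0' : ∀ i k l, T i 0 k l = 0 := fun i k l => by rw [h1, h0, neg_zero]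
  have hd : ∀ i k l, T i i k l = 0 := fun i k l => by linarith [h1 i i k l]
  have hd' : ∀ i j k, T i j k k = 0 := fun i j k => by linarith [h2 i j k k]
  have hS : ∀ i j k, T i j k 0 = 0 := by
    -- The first Bianchi identity with one time index makes `T i j k 0` symmetric in `j`, `k`. It is
    -- antisymmetric in `i`, `j`, and an array with both properties is zero.
    have hs : ∀ i j k, T i j k 0 = T i k j 0 := fun i j k => by
      linarith [hB i 0 j k, h0' i j k, h2 i k 0 j]
    intro i j k
    linarith [hs i j k, h1 i k j 0, hs k i j, h1 k j i 0, hs j k i, h1 j i k 0]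
  simp [Fin.sum_univ_four, h0, mink] at hR
  have r11 := hR 1 1
  have r22 := hR 2 2
  have r33 := hR 3 3
  have r12 := hR 1 2
  have r13 := hR 1 3
  have r21 := hR 2 1
  have r23 := hR 2 3
  have r31 := hR 3 1
  have r32 := hR 3 2
  simp only [hd, hd', zero_add, add_zero] at r11 r22 r33 r12 r13 r21 r23 r31 r32
  have a1 := h1 2 1
  have a2 := h1 3 1
  have a3 := h1 3 2
  have b1 := fun i j => h2 i j 2 1
  have b2 := fun i j => h2 i j 3 1
  have b3 := fun i j => h2 i j 3 2
  simp only [a1, a2, a3, b1, b2, b3, neg_neg] at r11 r22 r33 r12 r13 r21 r23 r31 r32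
  have key : ∀ i j k l : Fin 4, i < j → k < l → T i j k l = 0 := by
    intro i j k l hij hkl
    rcases eq_or_ne i 0 with rfl | hi
    · exact h0 _ _ _
    rcases eq_or_ne k 0 with rfl | hk
    · rw [h2, hS, neg_zero]
    -- Nine components with spatial `i < j` and `k < l` are left, and the nine spatial Ricci
    -- contractions determine them. Pair symmetry is not needed.
    have c1 : T 1 2 1 2 = 0 := by linarith
    have c2 : T 1 3 1 3 = 0 := by linarith
    have c3 : T 2 3 2 3 = 0 := by linarith
    have c4 : T 1 2 1 3 = 0 := by linarith
    have c5 : T 1 3 1 2 = 0 := by linarith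
    have c6 : T 1 2 2 3 = 0 := by linarith
    have c7 : T 2 3 1 2 = 0 := by linarith
    have c8 : T 1 3 2 3 = 0 := by linarith
    have c9 : T 2 3 1 3 = 0 := by linarith
    fin_cases i <;> fin_cases j <;>
      first
      | exact absurd hij (by decide)
      | exact absurd rfl hi
      | (fin_cases k <;> fin_cases l <;>
          first
          | exact absurd hkl (by decide)
          | exact absurd rfl hk
          | assumption)
  rcases lt_trichotomy i j with hij | hij | hij
  · rcases lt_trichotomy k l with hkl | hkl | hkl
    · exact key _ _ _ _ hij hkl
    · rw [hkl, hd']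
    · rw [h2, key _ _ _ _ hij hkl, neg_zero]
  · rw [hij, hd]
  · rw [h1]
    rcases lt_trichotomy k l with hkl | hkl | hkl
    · rw [key _ _ _ _ hij hkl, neg_zero]
    · rw [hkl, hd', neg_zero]
    · rw [h2, key _ _ _ _ hij hkl, neg_zero, neg_zero]


/-- A perfect fluid satisfying Einstein's equation, in one chart: `u`, `F`, `h` are the covariant
components of the velocity and the coefficients of the Ricci tensor `F u_a u_b + h g_ab`. -/
structure EinsteinFluidChart (G : E4 → Matrix (Fin 4) (Fin 4) ℝ) (U : Set E4) (u : Fin 4 → E4 → ℝ)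
    (F h : E4 → ℝ) : Prop where
  metric : IsMetricOn G U
  smooth_velocity : ∀ a, ContDiffOn ℝ ∞ (u a) U
  smooth_F : ContDiffOn ℝ ∞ F U
  smooth_h : ContDiffOn ℝ ∞ h U
  ne_zero : ∀ y ∈ U, F y ≠ 0
  frame : ∀ y ∈ U, ∃ f, IsFrame f (G y) (fun a => u a y)
  ricci_eq : ∀ y ∈ U, ∀ a b, ricci G a b y = F y * (u a y * u b y) + h y * G y a b

/-- A perfect fluid satisfying Einstein's equation and the Codazzi equation, in one chart. -/
structure FluidChart (G : E4 → Matrix (Fin 4) (Fin 4) ℝ) (U : Set E4) (u : Fin 4 → E4 → ℝ)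
    (F h : E4 → ℝ) : Prop extends EinsteinFluidChart G U u F h where
  codazzi : ∀ y ∈ U, ∀ a b c, covRicci G a b c y = covRicci G b a c y

/-- The expansion rate of the fluid, `H = -u^a ∂ₐ h / F`. -/
noncomputable def expansion (G : E4 → Matrix (Fin 4) (Fin 4) ℝ) (u : Fin 4 → E4 → ℝ)
    (F h : E4 → ℝ) (y : E4) : ℝ :=
  -(ip G (fun a => u a y) (fun a => pd a h y) y) / F y

/-- The spatial projection `P_ab = g_ab + u_a u_b` of the metric. -/
def proj (G : E4 → Matrix (Fin 4) (Fin 4) ℝ) (u : Fin 4 → E4 → ℝ) (a b : Fin 4) (y : E4) : ℝ :=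
  G y a b + u a y * u b y

theorem covTensor_congr {G : E4 → Matrix (Fin 4) (Fin 4) ℝ} {U : Set E4} {y : E4}
    {X Y : Fin 4 → Fin 4 → E4 → ℝ} (hU : IsOpen U) (h : ∀ a b, EqOn (X a b) (Y a b) U)
    (hy : y ∈ U) (c d b : Fin 4) : covTensor G X c d b y = covTensor G Y c d b y := by
  simp only [covTensor, pd_congr_of_eqOn hU (h d b) hy, h _ _ hy]

theorem IsFrame.sum_velocity_ip {f : Fin 4 → Fin 4 → ℝ} {G : E4 → Matrix (Fin 4) (Fin 4) ℝ}
    {u : Fin 4 → ℝ} {y : E4} (h : IsFrame f (G y) u) (v : Fin 4 → ℝ) : ip G u v y = hat f v 0 := by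
  rw [ip, h.dotProduct_inv]
  simp [h.hat_velocity, timeComp, mink]

namespace IsMetricOn

variable {G : E4 → Matrix (Fin 4) (Fin 4) ℝ} {U : Set E4} {u : Fin 4 → E4 → ℝ} {y : E4}

theorem covRicci_of_ricci_eq (hG : IsMetricOn G U) (hy : y ∈ U) {F h : E4 → ℝ}
    (hu : ∀ a, DifferentiableAt ℝ (u a) y) (hF : DifferentiableAt ℝ F y)
    (hh : DifferentiableAt ℝ h y)
    (hric : ∀ z ∈ U, ∀ a b, ricci G a b z = F z * (u a z * u b z) + h z * G z a b)
    (a b c : Fin 4) : covRicci G a b c y =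
    pd a F y * (u b y * u c y) + F y * (covVec G u a b y * u c y + u b y * covVec G u a c y)
      + pd a h y * G y b c := by
  have h1 : covRicci G a b c y = covTensor G (ricci G) a b c y := by
    rw [covRicci, covTensor, Finset.sum_add_distrib]
    ring
  have hm := hG.smooth.differentiableAt hG.isOpen hy
  rw [h1, covTensor_congr hG.isOpen (fun a b z hz => hric z hz a b) hy,
    covTensor_add (X := fun a b z => F z * (u a z * u b z)) (Y := fun a b z => h z * G z a b)
      (fun a b => hF.fun_mul ((hu a).fun_mul (hu b)))
      (fun a b => hh.fun_mul (hm a b)),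
    covTensor_smul (X := fun a b z => u a z * u b z) hF (fun a b => (hu a).fun_mul (hu b)),
    covTensor_smul (X := fun a b z => G z a b) hh hm, covTensor_tmul hu hu,
    hG.covTensor_metric hy]
  ring

theorem covTensor_proj_of_covVec_eq (hG : IsMetricOn G U) (hy : y ∈ U) {H : ℝ}
    (hu : ∀ a, DifferentiableAt ℝ (u a) y) (hcov : ∀ c b, covVec G u c b y = H * proj G u c b y)
    (c d b : Fin 4) : covTensor G (proj G u) c d b y
      = H * (proj G u c d y * u b y + u d y * proj G u c b y) := by
  have h1 : covTensor G (proj G u) c d b y = covTensor G (fun a b z => G z a b) c d b y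
      + covTensor G (fun a b z => u a z * u b z) c d b y :=
    covTensor_add (hG.smooth.differentiableAt hG.isOpen hy)
      (fun a b => (hu a).fun_mul (hu b)) c d b
  rw [h1, hG.covTensor_metric hy, covTensor_tmul hu hu, hcov, hcov]
  ring

/-- The curvature in the direction of a covector field `u` with `∇_c u_b = H (g_cb + u_c u_b)`. -/
theorem sum_riemann_of_covVec_eq (hG : IsMetricOn G U) (hy : y ∈ U) {H : E4 → ℝ}
    (hu : ∀ a, ContDiffOn ℝ ∞ (u a) U) (hH : ContDiffOn ℝ ∞ H U)
    (hcov : ∀ z ∈ U, ∀ c b, covVec G u c b z = H z * proj G u c b z) (b c d : Fin 4) :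
    ∑ a, u a y * riemann G a b c d y =
    pd d H y * proj G u c b y - pd c H y * proj G u d b y
      + H y ^ 2 * (u c y * proj G u d b y - u d y * proj G u c b y) := by
  have hdH := differentiableAt_of_contDiffOn hG.isOpen hH hy
  have hdu := fun a => differentiableAt_of_contDiffOn hG.isOpen (hu a) hy
  have hsP : ∀ a b, ContDiffOn ℝ ∞ (proj G u a b) U := fun a b =>
    (hG.smooth a b).add ((hu a).mul (hu b))
  have hP := fun a b => differentiableAt_of_contDiffOn hG.isOpen (hsP a b) hy
  have hproj := hG.covTensor_proj_of_covVec_eq hy hdu (hcov y hy)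
  rw [hG.ricci_identity hy (X := fun a b z => H z * proj G u a b z) hu
      (fun a b => hH.mul (hsP a b)) hcov, covTensor_smul hdH hP, covTensor_smul hdH hP,
    hproj, hproj]
  have : proj G u c d y = proj G u d c y := by
    simp only [proj, hG.symm_apply hy c d]
    ring
  rw [this]
  ring

end IsMetricOn

namespace EinsteinFluidChart

variable {G : E4 → Matrix (Fin 4) (Fin 4) ℝ} {U : Set E4} {u : Fin 4 → E4 → ℝ} {F h : E4 → ℝ}
  {y : E4} (hf : EinsteinFluidChart G U u F h) (hy : y ∈ U)
include hf hy

theorem differentiableAt_velocity (a : Fin 4) : DifferentiableAt ℝ (u a) y :=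
  differentiableAt_of_contDiffOn hf.metric.isOpen (hf.smooth_velocity a) hy

theorem differentiableAt_F : DifferentiableAt ℝ F y :=
  differentiableAt_of_contDiffOn hf.metric.isOpen hf.smooth_F hy

theorem differentiableAt_h : DifferentiableAt ℝ h y :=
  differentiableAt_of_contDiffOn hf.metric.isOpen hf.smooth_h hy

theorem trace_ricciUp : (ricciUp G y).trace = -F y + 4 * h y := by
  obtain ⟨f, fr⟩ := hf.frame y hy
  have h1 : (ricciUp G y).trace
      = ∑ a, ∑ b, (G y)⁻¹ a b * (F y * (u a y * u b y) + h y * G y a b) := by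
    simp only [ricciUp, Matrix.trace, Matrix.diag, Matrix.mul_apply]
    refine Finset.sum_congr rfl fun a _ => Finset.sum_congr rfl fun b _ => ?_
    change _ * ricci G b a y = _
    rw [hf.ricci_eq y hy, hf.metric.symm_apply hy b a]
    ring
  have ho : ∀ i j, hat f (fun a => hat f (G y a) j) i = mink i j := fr.orth
  have hu : ∀ i, hat f (fun a => u a y) i = timeComp i := fr.hat_velocity
  rw [h1, fr.trace_inv]
  simp only [hat₂, hat_add, hat_mul_left, hat_mul_right, ho, hu]
  simp [Fin.sum_univ_four, mink, timeComp]
  ring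

theorem ip_velocity : ip G (fun a => u a y) (fun a => u a y) y = -1 := by
  obtain ⟨f, fr⟩ := hf.frame y hy
  rw [fr.sum_velocity_ip]
  exact fr.hat_velocity 0

end EinsteinFluidChart

namespace FluidChart

variable {G : E4 → Matrix (Fin 4) (Fin 4) ℝ} {U : Set E4} {u : Fin 4 → E4 → ℝ} {F h : E4 → ℝ}
  {y : E4}

section

variable (hf : FluidChart G U u F h) (hy : y ∈ U)
include hf hy

/-- The scalar curvature is -F + 4h, and it has zero gradient by the Codazzi equation and the
contracted Bianchi identity. -/
theorem pd_F (a : Fin 4) : pd a F y = 4 * pd a h y := by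
  have h1 := hf.metric.trace_pdMatrix_ricciUp_eq_zero hy (fun z hz => by
    ext a b
    change ricci G b a z = ricci G a b z
    rw [hf.ricci_eq z hz, hf.ricci_eq z hz, hf.metric.symm_apply hz b a]
    ring) (hf.codazzi y hy) a
  have h2 : (pdMatrix a (ricciUp G) y).trace = pd a (fun z => -F z + 4 * h z) y := by
    rw [pd_congr_of_eqOn hf.metric.isOpen (fun z hz => (hf.trace_ricciUp hz).symm) hy]
    exact (pd_sum _ fun i _ =>
      hf.metric.smooth_ricciUp.differentiableAt hf.metric.isOpen hy i i).symm
  rw [h2, pd_add (hf.differentiableAt_F hy).fun_neg ((hf.differentiableAt_h hy).const_mul 4),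
    pd_neg, pd_const_mul _ (hf.differentiableAt_h hy)] at h1
  linarith

/-- Derivative of the constant g(u, u) = -1. -/
theorem ip_covVec_velocity (c : Fin 4) :
    ip G (fun a => u a y) (fun b => covVec G u c b y) y = 0 := by
  have h1 := hf.metric.pd_ip hy (hf.differentiableAt_velocity hy) (hf.differentiableAt_velocity hy) c
  rw [pd_congr_of_eqOn hf.metric.isOpen (g := fun _ => -1) (fun z hz => hf.ip_velocity hz) hy,
    pd_const] at h1
  obtain ⟨f, fr⟩ := hf.frame y hy
  have h2 : ip G (fun b => covVec G u c b y) (fun a => u a y) y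
      = ip G (fun a => u a y) (fun b => covVec G u c b y) y := by
    rw [ip, ip, fr.dotProduct_inv, fr.dotProduct_inv]
    exact Finset.sum_congr rfl fun i _ => by ring
  linarith

theorem covRicci_eq (a b c : Fin 4) : covRicci G a b c y =
    pd a F y * (u b y * u c y) + F y * (covVec G u a b y * u c y + u b y * covVec G u a c y)
      + pd a h y * G y b c :=
  hf.metric.covRicci_of_ricci_eq hy (hf.differentiableAt_velocity hy) (hf.differentiableAt_F hy)
    (hf.differentiableAt_h hy) hf.ricci_eq a b c

/-- The Codazzi equation for F u⊗u + h g is expanded by the Leibniz rule and read in a frame whose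
first vector is dual to u, where `codazzi_frame` solves it. Dividing by F ≠ 0 shows that the flow is
geodesic, irrotational and shear-free, with h varying only along u. -/
theorem pd_h_and_covVec_velocity :
    (∀ a, pd a h y = F y * expansion G u F h y * u a y) ∧
      ∀ a b, covVec G u a b y = expansion G u F h y * proj G u a b y := by
  obtain ⟨f, fr⟩ := hf.frame y hy
  have ho : ∀ i j, hat f (fun a => hat f (G y a) j) i = mink i j := fr.orth
  have hu : ∀ i, hat f (fun a => u a y) i = timeComp i := fr.hat_velocity
  have hF := hf.ne_zero y hy
  have key := codazzi_frame (F := F y) (dF := hat f fun a => pd a F y)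
    (dh := hat f fun a => pd a h y) (N := hat₂ f fun a b => covVec G u a b y)
    (fun i => by simp only [hf.pd_F hy, hat_mul_left])
    (fun i => by
      have h1 : ∀ a, hat f (fun b => covVec G u a b y) 0 = 0 := fun a => by
        rw [← fr.sum_velocity_ip (y := y), hf.ip_covVec_velocity hy]
      simp only [hat₂, h1]
      exact dotProduct_zero _)
    (fun i j k => by
      have h1 : hat₃ f (fun a b c => covRicci G a b c y) i j k
          = hat₃ f (fun a b c => covRicci G b a c y) i j k := by
        simp only [hf.codazzi y hy]
      simp only [hf.covRicci_eq hy, hat₃, hat₂, hat_add, hat_mul_left, hat_mul_right, ho, hu] at h1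
      rw [hat_comm f (fun a b => covVec G u a b y) i j] at h1
      simp only [hat₂] at h1 ⊢
      linarith)
  have h0 : F y * expansion G u F h y = -hat f (fun a => pd a h y) 0 := by
    rw [expansion, fr.sum_velocity_ip]
    field_simp
  refine ⟨fr.ext_hat fun i => ?_, fr.ext_hat₂ fun i j => mul_left_cancel₀ hF ?_⟩
  · rw [key.1 i, ← h0, hat_mul_left, hu]
  · rw [key.2 i j, ← h0]
    simp only [proj, hat₂, hat_add, hat_mul_left, hat_mul_right, ho, hu]
    ring

theorem pd_h (a : Fin 4) : pd a h y = F y * expansion G u F h y * u a y :=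
  (hf.pd_h_and_covVec_velocity hy).1 a

theorem covVec_velocity (a b : Fin 4) :
    covVec G u a b y = expansion G u F h y * proj G u a b y :=
  (hf.pd_h_and_covVec_velocity hy).2 a b

end

theorem smooth_ip (hG : IsMetricOn G U) {v w : Fin 4 → E4 → ℝ} (hv : ∀ a, ContDiffOn ℝ ∞ (v a) U)
    (hw : ∀ a, ContDiffOn ℝ ∞ (w a) U) :
    ContDiffOn ℝ ∞ (fun y => ip G (fun a => v a y) (fun a => w a y) y) U := by
  simp only [ip, dotProduct, Matrix.mulVec]
  exact ContDiffOn.sum fun a _ => (hv a).mul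
    (ContDiffOn.sum fun b _ => (hG.smooth_inv a b).mul (hw b))

theorem smooth_expansion (hf : FluidChart G U u F h) : ContDiffOn ℝ ∞ (expansion G u F h) U :=
  (smooth_ip hf.metric hf.smooth_velocity
    (fun _ => contDiffOn_pd hf.metric.isOpen hf.smooth_h)).neg.div hf.smooth_F hf.ne_zero

theorem smooth_proj (hf : FluidChart G U u F h) (a b : Fin 4) :
    ContDiffOn ℝ ∞ (proj G u a b) U :=
  (hf.metric.smooth a b).add ((hf.smooth_velocity a).mul (hf.smooth_velocity b))

section

variable (hf : FluidChart G U u F h) (hy : y ∈ U)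
include hf hy

theorem differentiableAt_expansion : DifferentiableAt ℝ (expansion G u F h) y :=
  differentiableAt_of_contDiffOn hf.metric.isOpen hf.smooth_expansion hy

theorem differentiableAt_proj (a b : Fin 4) : DifferentiableAt ℝ (proj G u a b) y :=
  differentiableAt_of_contDiffOn hf.metric.isOpen (hf.smooth_proj a b) hy

theorem covTensor_proj (c d b : Fin 4) : covTensor G (proj G u) c d b y =
    expansion G u F h y * (proj G u c d y * u b y + u d y * proj G u c b y) :=
  hf.metric.covTensor_proj_of_covVec_eq hy (hf.differentiableAt_velocity hy)
    (hf.covVec_velocity hy) c d b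

theorem sum_velocity_riemann (b c d : Fin 4) : ∑ a, u a y * riemann G a b c d y =
    pd d (expansion G u F h) y * proj G u c b y - pd c (expansion G u F h) y * proj G u d b y
      + expansion G u F h y ^ 2 * (u c y * proj G u d b y - u d y * proj G u c b y) :=
  hf.metric.sum_riemann_of_covVec_eq hy hf.smooth_velocity hf.smooth_expansion
    (fun _ hz => hf.covVec_velocity hz) b c d

end

end FluidChart

/-! ### The curvature tensor with lowered index -/

/-- The components `R_abcd`. -/
noncomputable def riemannLow (G : E4 → Matrix (Fin 4) (Fin 4) ℝ) (y : E4) (a b c d : Fin 4) : ℝ :=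
  ∑ e, G y a e * riemann G e b c d y

theorem hat_swap (f g : Fin 4 → Fin 4 → ℝ) (X : Fin 4 → Fin 4 → ℝ) (i j : Fin 4) :
    hat f (fun a => hat g (X a) j) i = hat g (fun b => hat f (fun a => X a b) i) j := by
  simp only [hat, dotProduct, Finset.mul_sum]
  rw [Finset.sum_comm]
  exact Finset.sum_congr rfl fun _ _ => Finset.sum_congr rfl fun _ _ => by ring

theorem hat₄_cycle (f : Fin 4 → Fin 4 → ℝ) (X : Fin 4 → Fin 4 → Fin 4 → Fin 4 → ℝ)
    (i j k l : Fin 4) : hat₄ f X i k l j = hat₄ f (fun a b c d => X a c d b) i j k l := by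
  simp only [hat₄, hat₃, hat₂]
  congr 1
  funext a
  conv_rhs => rw [hat_swap]
  congr 1
  funext b
  exact hat_swap _ _ _ _ _

theorem hat_sum {ι : Type*} (s : Finset ι) (f : Fin 4 → Fin 4 → ℝ) (x : ι → Fin 4 → ℝ) (i : Fin 4) :
    hat f (fun a => ∑ k ∈ s, x k a) i = ∑ k ∈ s, hat f (x k) i := by
  simp only [hat, dotProduct, Finset.mul_sum]
  exact Finset.sum_comm

section RiemannLow

variable {G : E4 → Matrix (Fin 4) (Fin 4) ℝ} {U : Set E4} {y : E4}

theorem riemann_antisymm (G : E4 → Matrix (Fin 4) (Fin 4) ℝ) (a b c d : Fin 4) (y : E4) :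
    riemann G a b d c y = -riemann G a b c d y :=
  congrFun (congrFun (IsMetricOn.riemannMatrix_antisymm G c d y) a) b

namespace IsMetricOn

variable (hG : IsMetricOn G U) (hy : y ∈ U)
include hG hy

theorem riemannLow_antisymm_left (a b c d : Fin 4) :
    riemannLow G y a b c d = -riemannLow G y b a c d := by
  have := congrFun (congrFun (hG.riemannMatrix_skew hy c d) b) a
  simp only [Matrix.mul_apply, Matrix.neg_apply, Matrix.transpose_apply, riemannMatrix,
    Matrix.of_apply] at this
  rw [riemannLow, riemannLow, ← this]
  exact Finset.sum_congr rfl fun e _ => by rw [hG.symm_apply hy a e, mul_comm]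

omit hG hy in
theorem riemannLow_antisymm_right (a b c d : Fin 4) :
    riemannLow G y a b c d = -riemannLow G y a b d c := by
  simp only [riemannLow, riemann_antisymm G _ b d c, mul_neg, Finset.sum_neg_distrib]

/-- The first Bianchi identity. -/
theorem riemannLow_cyclic (a b c d : Fin 4) :
    riemannLow G y a b c d + riemannLow G y a c d b + riemannLow G y a d b c = 0 := by
  have h1 : ∀ k i j, EqOn (christoffel G k i j) (christoffel G k j i) U :=
    fun k i j z hz => hG.christoffel_symm hz k i j
  have h2 : ∀ e, riemann G e b c d y + riemann G e c d b y + riemann G e d b c y = 0 := by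
    intro e
    simp only [riemann, pd_congr_of_eqOn hG.isOpen (h1 e d b) hy,
      pd_congr_of_eqOn hG.isOpen (h1 e c b) hy, pd_congr_of_eqOn hG.isOpen (h1 e d c) hy,
      hG.christoffel_symm hy _ d b, hG.christoffel_symm hy _ c b, hG.christoffel_symm hy _ d c,
      Finset.sum_sub_distrib]
    ring
  simp only [riemannLow, ← Finset.sum_add_distrib, ← mul_add, h2, mul_zero, Finset.sum_const_zero]

theorem ricci_eq_trace (b d : Fin 4) :
    ricci G b d y = ∑ a, ∑ c, (G y)⁻¹ a c * riemannLow G y a b c d := by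
  have h1 : ∀ c, riemann G c b c d y = ∑ a, (G y)⁻¹ a c * riemannLow G y a b c d := by
    intro c
    have h2 : (G y)⁻¹ *ᵥ (G y *ᵥ fun e => riemann G e b c d y) = fun e => riemann G e b c d y := by
      rw [Matrix.mulVec_mulVec, hG.inv_mul hy, Matrix.one_mulVec]
    have h3 : ∑ a, (G y)⁻¹ c a * riemannLow G y a b c d = riemann G c b c d y := congrFun h2 c
    rw [← h3]
    exact Finset.sum_congr rfl fun a _ => by rw [hG.inv_symm_apply hy c a]
  rw [ricci, Finset.sum_comm]
  exact Finset.sum_congr rfl fun c _ => h1 c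

theorem hat_ricci {f : Fin 4 → Fin 4 → ℝ} {u : Fin 4 → ℝ} (fr : IsFrame f (G y) u) (j l : Fin 4) :
    hat₂ f (fun b d => ricci G b d y) j l = ∑ i, mink i i * hat₄ f (riemannLow G y) i j i l := by
  simp only [hG.ricci_eq_trace hy, fr.trace_inv, hat₂, hat_sum, hat_mul_left]
  refine Finset.sum_congr rfl fun i _ => ?_
  congr 1
  simp only [hat₄, hat₃, hat₂]
  rw [hat_swap (X := fun a b => hat f (fun c => hat f (fun d => riemannLow G y a b c d) l) i)]
  congr 1
  funext b
  rw [hat_swap]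
  congr 1
  funext a
  rw [hat_swap]

omit hG hy in
theorem hat_riemannLow_zero {f : Fin 4 → Fin 4 → ℝ} {u : Fin 4 → ℝ} (fr : IsFrame f (G y) u)
    (j k l : Fin 4) :
    hat₄ f (riemannLow G y) 0 j k l
      = hat₃ f (fun b c d => ∑ a, u a * riemann G a b c d y) j k l := by
  have h1 : ∀ b c d, ∑ a, u a * riemann G a b c d y
      = hat f (fun a => riemannLow G y a b c d) 0 := by
    intro b c d
    simp only [riemannLow, hat_sum, hat_mul_right, fr.dual]
  simp only [h1, hat₄, hat₃, hat₂]
  rw [hat_swap]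
  congr 1
  funext b
  rw [hat_swap]
  congr 1
  funext c
  rw [hat_swap]

theorem hat_riemannLow_antisymm_left (f : Fin 4 → Fin 4 → ℝ) (i j k l : Fin 4) :
    hat₄ f (riemannLow G y) i j k l = -hat₄ f (riemannLow G y) j i k l := by
  simp only [hat₄, hat₃, hat₂]
  rw [hat_swap, ← hat_neg]
  congr 1
  funext b
  rw [← hat_neg]
  congr 1
  funext a
  rw [← hat_neg]
  congr 1
  funext c
  rw [← hat_neg]
  congr 1
  funext d
  exact hG.riemannLow_antisymm_left hy a b c d

omit hG hy in
theorem hat_riemannLow_antisymm_right (f : Fin 4 → Fin 4 → ℝ) (i j k l : Fin 4) :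
    hat₄ f (riemannLow G y) i j k l = -hat₄ f (riemannLow G y) i j l k := by
  simp only [hat₄, hat₃, hat₂]
  rw [← hat_neg]
  congr 1
  funext a
  rw [← hat_neg]
  congr 1
  funext b
  rw [hat_swap, ← hat_neg]
  congr 1
  funext d
  rw [← hat_neg]
  congr 1
  funext c
  exact riemannLow_antisymm_right a b c d

theorem hat_riemannLow_cyclic (f : Fin 4 → Fin 4 → ℝ) (i j k l : Fin 4) :
    hat₄ f (riemannLow G y) i j k l + hat₄ f (riemannLow G y) i k l j
      + hat₄ f (riemannLow G y) i l j k = 0 := by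
  rw [hat₄_cycle f (riemannLow G y) i j k l, hat₄_cycle f (riemannLow G y) i k l j,
    hat₄_cycle f (fun a b c d => riemannLow G y a c d b) i j k l]
  simp only [hat₄, hat₃, hat₂, ← hat_add, hG.riemannLow_cyclic hy]
  simp [hat, dotProduct]

end IsMetricOn

end RiemannLow

/-- The curvature tensor of a Robertson-Walker metric, with energy coefficient `C` and acceleration
coefficient `κ`, in terms of the velocity `u` and the projection `P`. -/
def fluidCurvature (C κ : ℝ) (u : Fin 4 → ℝ) (P : Fin 4 → Fin 4 → ℝ) (a b c d : Fin 4) : ℝ :=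
  C * (P a c * P b d - P a d * P b c) + κ * (u b * (u c * P a d - u d * P a c)
    - u a * (u c * P b d - u d * P b c))

namespace FluidChart

variable {G : E4 → Matrix (Fin 4) (Fin 4) ℝ} {U : Set E4} {u : Fin 4 → E4 → ℝ} {F h : E4 → ℝ}
  {y : E4} (hf : FluidChart G U u F h) (hy : y ∈ U)
include hf hy

/-- The Ricci identity for ∇u = H P expresses all curvature components with a first index along u
through dH and H². Tracing them against the known Ric determines dH. The difference between the
curvature and the model `fluidCurvature` then has no time components and no Ricci contraction, so it
vanishes by the three-dimensional argument. -/
theorem pd_expansion_and_riemannLow :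
    (∀ a, pd a (expansion G u F h) y = ((F y - h y) / 3 + expansion G u F h y ^ 2) * u a y) ∧
      ∀ a b c d, riemannLow G y a b c d = fluidCurvature ((F y + 2 * h y) / 6)
        (-(F y - h y) / 3) (fun a => u a y) (fun a b => proj G u a b y) a b c d := by
  obtain ⟨f, fr⟩ := hf.frame y hy
  have ho : ∀ i j, hat f (fun a => hat f (G y a) j) i = mink i j := fr.orth
  have hu : ∀ i, hat f (fun a => u a y) i = timeComp i := fr.hat_velocity
  set H := expansion G u F h y with hH
  set dH : Fin 4 → ℝ := hat f (fun a => pd a (expansion G u F h) y) with hdH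
  set P : Fin 4 → Fin 4 → ℝ := fun i j => mink i j + timeComp i * timeComp j with hP
  have hPs : ∀ i j, P i j = P j i := by
    intro i j
    fin_cases i <;> fin_cases j <;> simp [hP, mink, timeComp]
  have hproj : ∀ i j, hat f (fun a => hat f (fun b => proj G u a b y) j) i = P i j := by
    intro i j
    simp only [proj, hat_add, hat_mul_left, hat_mul_right, ho, hu, hP]
  have hproj' : ∀ i j, hat f (fun b => hat f (fun a => proj G u a b y) j) i = P i j := by
    intro i j
    rw [hat_swap, hproj, hPs]
  have hR0 : ∀ j k l, hat₄ f (riemannLow G y) 0 j k l = dH l * P k j - dH k * P l j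
      + H ^ 2 * (timeComp k * P l j - timeComp l * P k j) := by
    intro j k l
    rw [IsMetricOn.hat_riemannLow_zero fr]
    simp only [hf.sum_velocity_riemann hy, ← hH, hat₃, hat₂, hat_add, hat_sub, hat_mul_left,
      hat_mul_right, hu, hproj', ← hdH]
    rw [hPs k j, hPs l j]
  have hric : ∀ j l, ∑ i, mink i i * hat₄ f (riemannLow G y) i j i l
      = F y * (timeComp j * timeComp l) + h y * mink j l := by
    intro j l
    rw [← hf.metric.hat_ricci hy fr]
    simp only [hf.ricci_eq y hy, hat₂, hat_add, hat_mul_left, hat_mul_right, ho, hu]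
  have hanti := hf.metric.hat_riemannLow_antisymm_left hy f
  have hanti' := IsMetricOn.hat_riemannLow_antisymm_right (G := G) (y := y) f
  -- The mixed components R_0l of the Ricci tensor vanish for spatial `l`, and their trace
  -- expression is a nonzero multiple of `dH l`. The component R_00, used in `htime`, fixes `dH 0`.
  have hspace : ∀ l, l ≠ 0 → dH l = 0 := by
    intro l hl
    have h1 := hric 0 l
    simp only [Fin.sum_univ_four, hanti 1 0, hanti 2 0, hanti 3 0, hR0, hP] at h1
    fin_cases l <;> first | exact absurd rfl hl | skip
    all_goals
      simp [mink, timeComp] at h1 ⊢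
      linarith
  have htime : dH 0 = -((F y - h y) / 3 + H ^ 2) := by
    have h1 := hric 0 0
    simp only [Fin.sum_univ_four, hanti 1 0, hanti 2 0, hanti 3 0, hR0, hP] at h1
    simp [mink, timeComp] at h1
    linarith
  have hdH' : ∀ i, dH i = ((F y - h y) / 3 + H ^ 2) * timeComp i := by
    intro i
    rcases eq_or_ne i 0 with rfl | hi
    · rw [htime]
      simp [timeComp]
    · rw [hspace i hi]
      simp [timeComp, hi]
  refine ⟨fr.ext_hat fun i => ?_, fr.ext_hat₄ fun i j k l => ?_⟩
  · rw [hat_mul_left, hu]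
    exact hdH' i
  set K := (F y + 2 * h y) / 6 with hK
  set κ := -(F y - h y) / 3 with hκ
  have hmodel : ∀ i j k l, hat₄ f (fluidCurvature K κ (fun a => u a y)
      fun a b => proj G u a b y) i j k l = fluidCurvature K κ timeComp P i j k l := by
    intro i j k l
    change hat f (fun a => hat f (fun b => hat f (fun c => hat f (fun d =>
      K * (proj G u a c y * proj G u b d y - proj G u a d y * proj G u b c y)
        + κ * (u b y * (u c y * proj G u a d y - u d y * proj G u a c y)
          - u a y * (u c y * proj G u b d y - u d y * proj G u b c y))) l) k) j) i = _
    simp only [hat_add, hat_sub, hat_mul_left, hat_mul_right, hu, hproj]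
    rfl
  rw [hmodel, ← sub_eq_zero]
  -- Symmetries, time components and Ricci contraction are checked for curvature minus model. The
  -- coefficients (F + 2h)/6 and -(F - h)/3 are the ones that make the contraction match.
  refine curvature_frame_eq_zero (T := fun i j k l => hat₄ f (riemannLow G y) i j k l
    - fluidCurvature K κ timeComp P i j k l) (fun i j k l => ?_) (fun i j k l => ?_)
    (fun i j k l => ?_) (fun j k l => ?_) (fun j l => ?_) i j k l
  · rw [hanti, fluidCurvature, fluidCurvature]
    ring
  · rw [hanti', fluidCurvature, fluidCurvature]
    ring
  · have h1 := hf.metric.hat_riemannLow_cyclic hy f i j k l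
    simp only [fluidCurvature, hPs k j, hPs l j, hPs l k]
    linarith
  · simp only [hR0, hdH', fluidCurvature]
    have e0 : ∀ j, P 0 j = 0 := by
      intro j
      fin_cases j <;> simp [hP, mink, timeComp]
    have e1 : timeComp 0 = -1 := by simp [timeComp]
    simp only [e0, e1, hPs k j, hPs l j]
    ring
  · have h1 := hric j l
    simp only [mul_sub, Finset.sum_sub_distrib, h1]
    simp only [fluidCurvature, Fin.sum_univ_four, hP, hK, hκ]
    fin_cases j <;> fin_cases l <;> simp [mink, timeComp] <;> ring

end FluidChart


open Set Matrix Metric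

/-! ### Linear systems of total differential equations in coordinates -/

theorem fderiv_eq_sum_pd {f : E4 → ℝ} {y : E4} (v : E4) :
    fderiv ℝ f y v = ∑ c, v c * pd c f y := by
  have h1 : v = ∑ c, v c • EuclideanSpace.single c (1 : ℝ) := by
    ext i
    simp [Finset.sum_apply, Pi.single_apply]
  conv_lhs => rw [h1]
  simp [pd]

theorem eq_of_pd_eq_zero {f : E4 → ℝ} {y₀ : E4} {ρ : ℝ}
    (hf : ∀ y ∈ ball y₀ ρ, DifferentiableAt ℝ f y)
    (h0 : ∀ y ∈ ball y₀ ρ, ∀ c, pd c f y = 0) {y : E4} (hy : y ∈ ball y₀ ρ) : f y = f y₀ := by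
  have hρ : 0 < ρ := dist_nonneg.trans_lt hy
  refine isOpen_ball.is_const_of_fderiv_eq_zero (𝕜 := ℝ) (convex_ball y₀ ρ).isPreconnected
    (fun z hz => (hf z hz).differentiableWithinAt) (fun z hz => ?_) hy (mem_ball_self hρ)
  ext v
  rw [fderiv_eq_sum_pd]
  simp [h0 z hz]

theorem differentiable_coord (c : Fin 4) : Differentiable ℝ (fun z : E4 => z c) :=
  (EuclideanSpace.proj (𝕜 := ℝ) c).differentiable

theorem pd_coord (c d : Fin 4) (y : E4) :
    pd c (fun z => z d) y = if d = c then 1 else 0 := by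
  have : fderiv ℝ (fun z : E4 => z d) y = EuclideanSpace.proj (𝕜 := ℝ) d :=
    (EuclideanSpace.proj (𝕜 := ℝ) d).fderiv
  rw [pd, this]
  simp

/-- A formally integrable linear system of total differential equations
`∂_d Vⁱ = L_d(y, V)ⁱ` has a local solution with prescribed value at a point. -/
theorem exists_solution_of_integrable {ι : Type*} [Fintype ι] [DecidableEq ι]
    {L : Fin 4 → E4 → (ι → ℝ) →ₗ[ℝ] (ι → ℝ)} {U : Set E4} (hU : IsOpen U)
    (hL : ∀ d X i, ContDiffOn ℝ ∞ (fun y => L d y X i) U)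
    (hint : ∀ y ∈ U, ∀ V : ι → E4 → ℝ, (∀ j, DifferentiableAt ℝ (V j) y) →
      (∀ c j, pd c (V j) y = L c y (fun k => V k y) j) → ∀ c d i,
      pd c (fun z => L d z (fun k => V k z) i) y = pd d (fun z => L c z (fun k => V k z) i) y)
    {y₀ : E4} (hy₀ : y₀ ∈ U) (V₀ : ι → ℝ) :
    ∃ ρ > 0, ball y₀ ρ ⊆ U ∧ ∃ V : ι → E4 → ℝ, (∀ i, V i y₀ = V₀ i) ∧
      (∀ i, ContDiffOn ℝ ∞ (V i) (ball y₀ ρ)) ∧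
      ∀ y ∈ ball y₀ ρ, ∀ d i, pd d (V i) y = L d y (fun k => V k y) i := by
  set A : E4 → E4 →L[ℝ] (ι → ℝ) →L[ℝ] (ι → ℝ) := fun y =>
    ∑ d, (EuclideanSpace.proj (𝕜 := ℝ) d : E4 →L[ℝ] ℝ).smulRight
      (∑ j, (ContinuousLinearMap.proj (R := ℝ) (φ := fun _ : ι => ℝ) j).smulRight
        (L d y (Pi.single j 1))) with hA
  have hsum : ∀ (f : (ι → ℝ) →ₗ[ℝ] (ι → ℝ)) (X : ι → ℝ), f X = ∑ j, X j • f (Pi.single j 1) := by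
    intro f X
    conv_lhs => rw [← Finset.univ_sum_single X]
    rw [map_sum]
    refine Finset.sum_congr rfl fun j _ => ?_
    rw [← map_smul]
    congr 1
    ext k
    simp [Pi.single_apply]
  have hAapp : ∀ y v X, A y v X = ∑ d, v d • L d y X := by
    intro y v X
    simp [hA, hsum (L _ y) X]
  have hAs : ContDiffOn ℝ ∞ A U := by
    refine ContDiffOn.sum fun d _ => ?_
    refine (ContinuousLinearMap.smulRightL ℝ E4 ((ι → ℝ) →L[ℝ] (ι → ℝ))
      (EuclideanSpace.proj (𝕜 := ℝ) d)).contDiff.comp_contDiffOn ?_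
    refine ContDiffOn.sum fun j _ => ?_
    exact (ContinuousLinearMap.smulRightL ℝ (ι → ℝ) (ι → ℝ)
      (ContinuousLinearMap.proj (R := ℝ) (φ := fun _ : ι => ℝ) j)).contDiff.comp_contDiffOn
        (contDiffOn_pi.2 fun i => hL d _ i)
  have hLd : ∀ y ∈ U, ∀ d X i, DifferentiableAt ℝ (fun y => L d y X i) y := fun y hy d X i =>
    differentiableAt_of_contDiffOn hU (hL d X i) hy
  have hfd : ∀ y ∈ U, ∀ v w X i, fderiv ℝ A y v w X i
      = ∑ d, ∑ c, w d * (v c * pd c (fun z => L d z X i) y) := by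
    intro y hy v w X i
    have hAd : DifferentiableAt ℝ A y :=
      (hAs.contDiffAt (hU.mem_nhds hy)).differentiableAt (by simp)
    set Λ : (E4 →L[ℝ] (ι → ℝ) →L[ℝ] (ι → ℝ)) →L[ℝ] ℝ :=
      (ContinuousLinearMap.proj (R := ℝ) (φ := fun _ : ι => ℝ) i).comp
        ((ContinuousLinearMap.apply ℝ (ι → ℝ) X).comp
          (ContinuousLinearMap.apply ℝ ((ι → ℝ) →L[ℝ] (ι → ℝ)) w)) with hΛ
    have h1 : HasFDerivAt (fun z => A z w X i) (Λ.comp (fderiv ℝ A y)) y :=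
      Λ.hasFDerivAt.comp y hAd.hasFDerivAt
    have h2 : fderiv ℝ A y v w X i = fderiv ℝ (fun z => A z w X i) y v := by
      rw [h1.fderiv]
      rfl
    rw [h2, fderiv_eq_sum_pd]
    have h3 : ∀ c, pd c (fun z => A z w X i) y = ∑ d, w d * pd c (fun z => L d z X i) y := by
      intro c
      simp only [hAapp, Finset.sum_apply, Pi.smul_apply, smul_eq_mul]
      rw [pd_sum _ fun d _ => (hLd y hy d X i).const_mul (w d)]
      exact Finset.sum_congr rfl fun d _ => pd_const_mul _ (hLd y hy d X i)
    simp only [h3, Finset.mul_sum]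
    rw [Finset.sum_comm]
    exact Finset.sum_congr rfl fun d _ => Finset.sum_congr rfl fun c _ => by ring
  have hsymm : ∀ y ∈ U, ∀ X i c d, pd c (fun z => L d z X i) y + L d y (L c y X) i
      = pd d (fun z => L c z X i) y + L c y (L d y X) i := by
    intro y hy X i
    -- `V` is affine, with value `X` and partial derivatives `L c y X` at the single point `y`. The
    -- integrability hypothesis tests functions that satisfy the system only at one point, so
    -- evaluating it on `V` gives the algebraic flatness condition.
    set V : ι → E4 → ℝ := fun j z => X j + ∑ c, (z c - y c) * L c y X j with hV
    have hcd : ∀ c, DifferentiableAt ℝ (fun z : E4 => z c - y c) y := fun c =>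
      (differentiable_coord c y).sub_const _
    have hpc : ∀ c d, pd c (fun z => z d - y d) y = if d = c then 1 else 0 := by
      intro c d
      rw [pd_sub (differentiable_coord d y) (by fun_prop), pd_coord, pd_const, sub_zero]
    have hVd : ∀ j, DifferentiableAt ℝ (V j) y := fun j =>
      (differentiableAt_const _).add (DifferentiableAt.fun_sum fun c _ => (hcd c).mul_const _)
    have hVy : (fun k => V k y) = X := by
      funext k
      simp [hV]
    have hVp : ∀ c j, pd c (V j) y = L c y X j := by
      intro c j
      rw [hV, pd_add (by fun_prop) (DifferentiableAt.fun_sum fun c _ => (hcd c).mul_const _),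
        pd_const, pd_sum _ fun d _ => (hcd d).mul_const _, zero_add]
      rw [Finset.sum_eq_single c]
      · rw [pd_mul (hcd c) (by fun_prop), pd_const, hpc]
        simp
      · intro d _ hd
        rw [pd_mul (hcd d) (by fun_prop), pd_const, hpc]
        simp [hd]
      · simp
    have hLV : ∀ c d, pd c (fun z => L d z (fun k => V k z) i) y
        = pd c (fun z => L d z X i) y + L d y (L c y X) i := by
      intro c d
      have h1 : ∀ z, L d z (fun k => V k z) i
          = L d z X i + ∑ e, (z e - y e) * L d z (L e y X) i := by
        intro z
        have : (fun k => V k z) = X + ∑ e, (z e - y e) • L e y X := by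
          funext k
          simp [hV]
        rw [this]
        simp
      simp only [h1]
      rw [pd_add (hLd y hy d X i) (DifferentiableAt.fun_sum fun e _ =>
        (hcd e).fun_mul (hLd y hy d _ i)), pd_sum _ fun e _ => (hcd e).fun_mul (hLd y hy d _ i)]
      congr 1
      rw [Finset.sum_eq_single c]
      · rw [pd_mul (hcd c) (hLd y hy d _ i), hpc]
        simp
      · intro e _ he
        rw [pd_mul (hcd e) (hLd y hy d _ i), hpc]
        simp [he]
      · simp
    intro c d
    rw [← hLV, ← hLV]
    exact hint y hy V hVd (fun c j => by rw [hVp, hVy]) c d i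
  obtain ⟨ρ, hρ, hsub, V, hV0, hVs, hVd⟩ := exists_flat_solution hU hAs hy₀ (fun y hy v w X => by
    funext i
    have key : ∀ v w : E4, fderiv ℝ A y v w X i + A y w (A y v X) i
        = ∑ d, ∑ c, w d * (v c * (pd c (fun z => L d z X i) y + L d y (L c y X) i)) := by
      intro v w
      rw [hfd y hy, hAapp, hAapp]
      simp only [map_sum, map_smul, Finset.sum_apply, Pi.smul_apply, smul_eq_mul, Finset.mul_sum,
        ← Finset.sum_add_distrib, ← mul_add]
    rw [Pi.add_apply, Pi.add_apply, key, key, Finset.sum_comm]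
    refine Finset.sum_congr rfl fun c _ => Finset.sum_congr rfl fun d _ => ?_
    rw [hsymm y hy X i c d]
    ring) V₀
  have hVi : ∀ y ∈ ball y₀ ρ, ∀ i, HasFDerivAt (fun z => V z i)
      ((ContinuousLinearMap.proj (R := ℝ) (φ := fun _ : ι => ℝ) i).comp
        ((A y).flip (V y))) y := fun y hy i =>
    (ContinuousLinearMap.proj (R := ℝ) (φ := fun _ : ι => ℝ) i).hasFDerivAt.comp y (hVd y hy)
  refine ⟨ρ, hρ, hsub, fun i y => V y i, fun i => congrFun hV0 i, fun i => ?_, fun y hy d i => ?_⟩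
  · exact contDiffOn_pi.1 hVs i
  · rw [pd, (hVi y hy i).fderiv]
    simp [hAapp]

/-- A closed 1-form is locally exact. -/
theorem exists_potential {w : Fin 4 → E4 → ℝ} {U : Set E4} (hU : IsOpen U)
    (hw : ∀ a, ContDiffOn ℝ ∞ (w a) U) (hcl : ∀ y ∈ U, ∀ c d, pd c (w d) y = pd d (w c) y)
    {y₀ : E4} (hy₀ : y₀ ∈ U) : ∃ ρ > 0, ball y₀ ρ ⊆ U ∧ ∃ s : E4 → ℝ, s y₀ = 0 ∧
      ContDiffOn ℝ ∞ s (ball y₀ ρ) ∧ ∀ y ∈ ball y₀ ρ, ∀ c, pd c s y = w c y := by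
  -- The solver treats linear homogeneous systems, so ds = w is homogenised with a second unknown:
  -- dV₀ = 0, dV₁ = V₀ w, and V₀ = 1 at the base point.
  have hlin : ∀ (d : Fin 4) (y : E4), IsLinearMap ℝ
      (fun X : Fin 2 → ℝ => fun i : Fin 2 => if i = 0 then 0 else X 0 * w d y) := fun d y =>
    ⟨fun X Y => by
      funext i
      simp only [Pi.add_apply]
      split_ifs <;> ring, fun r X => by
      funext i
      simp only [Pi.smul_apply, smul_eq_mul]
      split_ifs <;> ring⟩
  obtain ⟨ρ, hρ, hsub, V, hV0, hVs, hVd⟩ := exists_solution_of_integrable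
    (L := fun d y => (hlin d y).mk') hU (fun d X i => by
      simp only [IsLinearMap.mk'_apply]
      split_ifs
      · exact contDiffOn_const
      · exact contDiffOn_const.mul (hw d)) (fun y hy V hV hVp c d i => by
      simp only [IsLinearMap.mk'_apply] at hVp ⊢
      split_ifs with hi
      · rw [pd_const, pd_const]
      · have hwd := fun a => differentiableAt_of_contDiffOn hU (hw a) hy
        rw [pd_mul (hV 0) (hwd d), pd_mul (hV 0) (hwd c), hVp, hVp, hcl y hy]
        simp) hy₀ (fun i => if i = 0 then 1 else 0)
  refine ⟨ρ, hρ, hsub, V 1, by simp [hV0], hVs 1, fun y hy c => ?_⟩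
  have h1 : V 0 y = 1 := by
    rw [eq_of_pd_eq_zero (fun z hz => differentiableAt_of_contDiffOn isOpen_ball (hVs 0) hz)
      (fun z hz c => by simp [hVd z hz c 0]) hy, hV0]
    simp
  rw [hVd y hy]
  simp [h1]


/-! ### Inner products of covectors and the curvature of the slices -/

open Set Matrix Metric

section InnerProduct

variable {G : E4 → Matrix (Fin 4) (Fin 4) ℝ} {U : Set E4} {y : E4}

theorem ip_add_left (v v' w : Fin 4 → ℝ) :
    ip G (fun a => v a + v' a) w y = ip G v w y + ip G v' w y := add_dotProduct _ _ _

theorem ip_sub_left (v v' w : Fin 4 → ℝ) :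
    ip G (fun a => v a - v' a) w y = ip G v w y - ip G v' w y := sub_dotProduct _ _ _

theorem ip_mul_left (r : ℝ) (v w : Fin 4 → ℝ) :
    ip G (fun a => r * v a) w y = r * ip G v w y := smul_dotProduct r v _

theorem IsMetricOn.ip_symm (h : IsMetricOn G U) (hy : y ∈ U) (v w : Fin 4 → ℝ) :
    ip G v w y = ip G w v y := by
  rw [ip, ip, Matrix.dotProduct_mulVec, ← Matrix.mulVec_transpose, h.inv_symm hy, dotProduct_comm]

theorem IsMetricOn.ip_metric_left (h : IsMetricOn G U) (hy : y ∈ U) (c : Fin 4) (w : Fin 4 → ℝ) :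
    ip G (fun b => G y c b) w y = w c := by
  have h1 : G y *ᵥ ((G y)⁻¹ *ᵥ w) = w := by
    rw [Matrix.mulVec_mulVec, h.mul_inv hy, Matrix.one_mulVec]
  exact congrFun h1 c

theorem ip_mul_left_right (r : ℝ) (v w : Fin 4 → ℝ) :
    ip G (fun a => v a * r) w y = ip G v w y * r := by
  simp only [mul_comm _ r, ip_mul_left]

theorem ip_add_right (v w w' : Fin 4 → ℝ) :
    ip G v (fun a => w a + w' a) y = ip G v w y + ip G v w' y := by
  simp only [ip]
  rw [← dotProduct_add, ← Matrix.mulVec_add]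
  rfl

theorem ip_mul_right (r : ℝ) (v w : Fin 4 → ℝ) :
    ip G v (fun a => r * w a) y = r * ip G v w y := by
  simp only [ip]
  rw [← smul_eq_mul, ← dotProduct_smul, ← Matrix.mulVec_smul]
  rfl

theorem IsMetricOn.sum_riemann_eq_ip (h : IsMetricOn G U) (hy : y ∈ U) (v : Fin 4 → ℝ)
    (b c d : Fin 4) :
    ∑ a, v a * riemann G a b c d y = ip G v (fun e => riemannLow G y e b c d) y := by
  have h2 : (G y)⁻¹ *ᵥ (G y *ᵥ fun e => riemann G e b c d y) = fun e => riemann G e b c d y := by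
    rw [Matrix.mulVec_mulVec, h.inv_mul hy, Matrix.one_mulVec]
  have h3 : (fun e => riemannLow G y e b c d) = G y *ᵥ fun e => riemann G e b c d y := rfl
  rw [ip, h3, h2]
  rfl

end InnerProduct

/-- The curvature `E` of the spaces orthogonal to the fluid flow. -/
noncomputable def spaceCurvature (G : E4 → Matrix (Fin 4) (Fin 4) ℝ) (u : Fin 4 → E4 → ℝ)
    (F h : E4 → ℝ) (y : E4) : ℝ :=
  (F y + 2 * h y) / 6 - expansion G u F h y ^ 2

namespace FluidChart

variable {G : E4 → Matrix (Fin 4) (Fin 4) ℝ} {U : Set E4} {u : Fin 4 → E4 → ℝ} {F h : E4 → ℝ}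
  {y : E4}

theorem smooth_spaceCurvature (hf : FluidChart G U u F h) :
    ContDiffOn ℝ ∞ (spaceCurvature G u F h) U :=
  ((hf.smooth_F.add (contDiffOn_const.mul hf.smooth_h)).div_const _).sub (hf.smooth_expansion.pow 2)

section

variable (hf : FluidChart G U u F h) (hy : y ∈ U)
include hf hy

theorem pd_expansion (a : Fin 4) : pd a (expansion G u F h) y =
    ((F y - h y) / 3 + expansion G u F h y ^ 2) * u a y :=
  (hf.pd_expansion_and_riemannLow hy).1 a

theorem differentiableAt_spaceCurvature : DifferentiableAt ℝ (spaceCurvature G u F h) y :=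
  differentiableAt_of_contDiffOn hf.metric.isOpen hf.smooth_spaceCurvature hy

/-- It follows from dF = 4 dh, dh = F H u and the formula for dH. With dA = -A H u it makes E A²
constant, which produces the curvature index. -/
theorem pd_spaceCurvature (a : Fin 4) : pd a (spaceCurvature G u F h) y =
    2 * expansion G u F h y * spaceCurvature G u F h y * u a y := by
  have hF := hf.differentiableAt_F hy
  have hh := hf.differentiableAt_h hy
  have hH := hf.differentiableAt_expansion hy
  have h1 : pd a (spaceCurvature G u F h) y = pd a (fun z => (1 / 6) * (F z + 2 * h z)
      - expansion G u F h z * expansion G u F h z) y := by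
    congr 1
    funext z
    rw [spaceCurvature]
    ring
  rw [h1, pd_sub ((hF.fun_add (hh.const_mul 2)).const_mul _) (hH.fun_mul hH),
    pd_const_mul _ (hF.fun_add (hh.const_mul 2)), pd_add hF (hh.const_mul 2), pd_const_mul _ hh,
    pd_mul hH hH, hf.pd_F hy, hf.pd_h hy, hf.pd_expansion hy, spaceCurvature]
  ring

theorem proj_symm (a b : Fin 4) : proj G u a b y = proj G u b a y := by
  rw [proj, proj, hf.metric.symm_apply hy a b]
  ring

theorem ip_proj_left (c : Fin 4) (w : Fin 4 → ℝ) :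
    ip G (fun b => proj G u c b y) w y = w c + u c y * ip G (fun b => u b y) w y := by
  simp only [proj, ip_add_left, hf.metric.ip_metric_left hy, ip_mul_left]

/-- ∇u is symmetric and the connection is torsion-free, so du = 0. -/
theorem closed_velocity (c d : Fin 4) : pd c (u d) y = pd d (u c) y := by
  have h1 := hf.covVec_velocity hy c d
  have h2 := hf.covVec_velocity hy d c
  rw [hf.proj_symm hy d c, ← h1] at h2
  simp only [covVec, hf.metric.christoffel_symm hy _ d c] at h2
  linarith

theorem ip_fluidCurvature (C κ : ℝ) (v : Fin 4 → ℝ) (b c d : Fin 4) :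
    ip G v (fun a => fluidCurvature C κ (fun a => u a y) (fun a b => proj G u a b y) a b c d) y
      = C * ((v c + u c y * ip G (fun b => u b y) v y) * proj G u b d y
          - (v d + u d y * ip G (fun b => u b y) v y) * proj G u b c y)
        + κ * (u b y * (u c y * v d - u d y * v c)
          - ip G (fun b => u b y) v y * (u c y * proj G u b d y - u d y * proj G u b c y)) := by
  rw [hf.metric.ip_symm hy]
  simp only [fluidCurvature, hf.proj_symm hy _ c, hf.proj_symm hy _ d, ip_add_left, ip_sub_left,
    ip_mul_left, ip_mul_left_right, hf.ip_proj_left hy]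
  ring

end

/-! ### The prolonged Hessian equation -/

/-- The right-hand side of the equation `∇_d v_b = M_db` in the prolongation of the Hessian
equation, as a function of `q`, of `v` and of the time component `s` of `v`. -/
noncomputable def hessianRHS (G : E4 → Matrix (Fin 4) (Fin 4) ℝ) (u : Fin 4 → E4 → ℝ)
    (F h : E4 → ℝ) (d b : Fin 4) (y : E4) (q s : ℝ) (v : Fin 4 → ℝ) : ℝ :=
  expansion G u F h y * (u d y * (v b + s * u b y) + (v d + s * u d y) * u b y)
    - (spaceCurvature G u F h y * q + expansion G u F h y * s) * proj G u d b y

/-- The time component of a solution of the prolonged Hessian equation is constant. -/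
theorem pd_ip_velocity_eq_zero (hf : FluidChart G U u F h) (hy : y ∈ U) {r : ℝ}
    {v : Fin 4 → E4 → ℝ} (hv : ∀ a, DifferentiableAt ℝ (v a) y)
    (hvp : ∀ c b, covVec G v c b y = hessianRHS G u F h c b y r
      (ip G (fun a => u a y) (fun a => v a y) y) (fun a => v a y)) (c : Fin 4) :
    pd c (fun z => ip G (fun a => u a z) (fun a => v a z) z) y = 0 := by
  rw [hf.metric.pd_ip hy (hf.differentiableAt_velocity hy) hv,
    hf.metric.ip_symm hy (fun a => u a y)]
  simp only [hf.covVec_velocity hy, hvp, hessianRHS, ip_add_left, ip_sub_left, ip_mul_left,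
    hf.ip_proj_left hy, hf.ip_velocity hy]
  rw [hf.metric.ip_symm hy (fun a => v a y) (fun a => u a y)]
  ring

/-- Formal integrability of the prolonged Hessian equation. -/
theorem hessian_integrable (hf : FluidChart G U u F h) (hy : y ∈ U) {q : E4 → ℝ}
    {v : Fin 4 → E4 → ℝ} (hq : DifferentiableAt ℝ q y) (hv : ∀ a, DifferentiableAt ℝ (v a) y)
    (hqp : ∀ c, pd c q y = v c y + ip G (fun a => u a y) (fun a => v a y) y * u c y)
    (hvp : ∀ c b, covVec G v c b y = hessianRHS G u F h c b y (q y)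
      (ip G (fun a => u a y) (fun a => v a y) y) (fun a => v a y)) (c d : Fin 4) :
    pd c (fun z => v d z + ip G (fun a => u a z) (fun a => v a z) z * u d z) y
      = pd d (fun z => v c z + ip G (fun a => u a z) (fun a => v a z) z * u c z) y ∧
    ∀ b, pd c (fun z => (∑ e, christoffel G e d b z * v e z) + hessianRHS G u F h d b z (q z)
        (ip G (fun a => u a z) (fun a => v a z) z) (fun a => v a z)) y
      = pd d (fun z => (∑ e, christoffel G e c b z * v e z) + hessianRHS G u F h c b z (q z)
        (ip G (fun a => u a z) (fun a => v a z) z) (fun a => v a z)) y := by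
  have hu := hf.differentiableAt_velocity hy
  have hH := hf.differentiableAt_expansion hy
  have hE := hf.differentiableAt_spaceCurvature hy
  have hP := hf.differentiableAt_proj hy
  set s : E4 → ℝ := fun z => ip G (fun a => u a z) (fun a => v a z) z with hs
  have hsd : DifferentiableAt ℝ s y := by
    simp only [hs, ip, dotProduct, Matrix.mulVec]
    exact DifferentiableAt.fun_sum fun a _ => (hu a).fun_mul (DifferentiableAt.fun_sum fun b _ =>
      (hf.metric.smooth_inv.differentiableAt hf.metric.isOpen hy a b).fun_mul (hv b))
  have hsy : ip G (fun a => u a y) (fun a => v a y) y = s y := rfl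
  have hps : ∀ c, pd c s y = 0 := hf.pd_ip_velocity_eq_zero hy hv hvp
  -- the spatial part of `v`
  set p : Fin 4 → E4 → ℝ := fun a z => v a z + s z * u a z with hp
  have hpd : ∀ a, DifferentiableAt ℝ (p a) y := fun a => (hv a).fun_add (hsd.fun_mul (hu a))
  have hpc : ∀ c b, covVec G p c b y = expansion G u F h y * (u c y * p b y + p c y * u b y)
      - spaceCurvature G u F h y * q y * proj G u c b y := by
    intro c b
    have : covVec G p c b y = covVec G v c b y + covVec G (fun a z => s z * u a z) c b y :=
      covVec_add hv (fun a => hsd.fun_mul (hu a)) c b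
    rw [this, covVec_smul hsd hu, hps, hvp, hf.covVec_velocity hy, hessianRHS, hsy]
    simp only [hp]
    ring
  refine ⟨?_, fun b => ?_⟩
  · change pd c (p d) y = pd d (p c) y
    have h1 := hpc c d
    have h2 := hpc d c
    rw [hf.proj_symm hy d c] at h2
    simp only [covVec, hf.metric.christoffel_symm hy _ d c] at h1 h2
    linarith
  set w : E4 → ℝ := fun z => spaceCurvature G u F h z * q z + expansion G u F h z * s z with hw
  have hwd : DifferentiableAt ℝ w y := (hE.fun_mul hq).fun_add (hH.fun_mul hsd)
  set X : Fin 4 → Fin 4 → E4 → ℝ := fun d b z =>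
    expansion G u F h z * (u d z * p b z + p d z * u b z) - w z * proj G u d b z with hX
  have hup : ∀ a b, DifferentiableAt ℝ (fun z => u a z * p b z + p a z * u b z) y := fun a b =>
    ((hu a).fun_mul (hpd b)).fun_add ((hpd a).fun_mul (hu b))
  have hXd : ∀ a b, DifferentiableAt ℝ (X a b) y := fun a b =>
    (hH.fun_mul (hup a b)).fun_sub (hwd.fun_mul (hP a b))
  have hcX : ∀ c d b, covTensor G X c d b y =
      pd c (expansion G u F h) y * (u d y * p b y + p d y * u b y) + expansion G u F h y *
        (covVec G u c d y * p b y + u d y * covVec G p c b y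
          + (covVec G p c d y * u b y + p d y * covVec G u c b y))
        - (pd c w y * proj G u d b y + w y * covTensor G (proj G u) c d b y) := by
    intro c d b
    rw [hX, covTensor_sub (fun a b => hH.fun_mul (hup a b)) (fun a b => hwd.fun_mul (hP a b)),
      covTensor_smul (X := fun a b z => u a z * p b z + p a z * u b z) hH hup,
      covTensor_smul hwd hP, covTensor_add (fun a b => (hu a).fun_mul (hpd b))
        (fun a b => (hpd a).fun_mul (hu b)), covTensor_tmul hu hpd, covTensor_tmul hpd hu]
  have hpw : ∀ c, pd c w y = 2 * expansion G u F h y * spaceCurvature G u F h y * u c y * q y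
      + spaceCurvature G u F h y * p c y
      + ((F y - h y) / 3 + expansion G u F h y ^ 2) * u c y * s y := by
    intro c
    rw [hw, pd_add (hE.fun_mul hq) (hH.fun_mul hsd), pd_mul hE hq, pd_mul hH hsd,
      hf.pd_spaceCurvature hy, hf.pd_expansion hy, hps, hqp]
    simp only [hp, hsy]
    ring
  -- By the Ricci identity, integrability amounts to the commutator of covariant derivatives of `X`
  -- matching the curvature term. The curvature is known explicitly, so this becomes a polynomial
  -- identity.
  have hric := hf.metric.ricci_identity_at hy hv hXd (fun c b => hvp c b) b c d
  have hcurv : ∑ a, v a y * riemann G a b c d y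
      = (F y + 2 * h y) / 6 * (p c y * proj G u b d y - p d y * proj G u b c y)
        + -(F y - h y) / 3 * (u b y * (u c y * p d y - u d y * p c y)
          - s y * (u c y * proj G u b d y - u d y * proj G u b c y)) := by
    rw [hf.metric.sum_riemann_eq_ip hy]
    simp only [(hf.pd_expansion_and_riemannLow hy).2]
    rw [hf.ip_fluidCurvature hy, hsy]
    simp only [hp]
    ring
  refine eq_of_sub_eq_zero (hric.trans ?_)
  rw [hcurv, hcX, hcX, hpw, hpw]
  simp only [hpc, hf.covVec_velocity hy, hf.covTensor_proj hy, hf.pd_expansion hy,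
    hf.proj_symm hy d c, hf.proj_symm hy b c, hf.proj_symm hy b d]
  -- The Gauss equation: the sectional curvature of space-time on the slices is their intrinsic
  -- curvature plus H².
  have hE' : (F y + 2 * h y) / 6 = spaceCurvature G u F h y + expansion G u F h y ^ 2 := by
    rw [spaceCurvature]
    ring
  rw [hE']
  simp only [hw]
  ring

/-- The Hessian equation `∇_c ∂_b q = H (u_c ∂_b q + u_b ∂_c q) - E q P_cb`, `u^a ∂ₐ q = 0`, for a
function on the set `B`. -/
structure IsHessianSolution (G : E4 → Matrix (Fin 4) (Fin 4) ℝ) (u : Fin 4 → E4 → ℝ)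
    (F h : E4 → ℝ) (B : Set E4) (q : E4 → ℝ) : Prop where
  smooth : ContDiffOn ℝ ∞ q B
  spatial : ∀ y ∈ B, ip G (fun a => u a y) (fun a => pd a q y) y = 0
  hessian : ∀ y ∈ B, ∀ c b, covVec G (fun b => pd b q) c b y
    = expansion G u F h y * (u c y * pd b q y + pd c q y * u b y)
      - spaceCurvature G u F h y * q y * proj G u c b y

theorem IsHessianSolution.mono {B B' : Set E4} {q : E4 → ℝ} (hq : IsHessianSolution G u F h B q)
    (hB : B' ⊆ B) : IsHessianSolution G u F h B' q :=
  ⟨hq.smooth.mono hB, fun y hy => hq.spatial y (hB hy), fun y hy => hq.hessian y (hB hy)⟩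

/-- The solutions play the role of ambient linear functions on the slices: a value and a spatial
differential at one point can be prescribed. The unknowns are q and a covector v, and the constraint
that v be orthogonal to u is not imposed. Instead `hessianRHS` carries the time component s of v,
arranged so that the unconstrained system is integrable and s is constant. Starting from s = 0 gives
s = 0 on the ball, and then v = dq. -/
theorem exists_hessianSolution (hf : FluidChart G U u F h) {y₀ : E4} (hy₀ : y₀ ∈ U) (q₀ : ℝ)
    (v₀ : Fin 4 → ℝ) (hv₀ : ip G (fun a => u a y₀) v₀ y₀ = 0) :
    ∃ ρ > 0, ball y₀ ρ ⊆ U ∧ ∃ q, IsHessianSolution G u F h (ball y₀ ρ) q ∧ q y₀ = q₀ ∧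
      ∀ c, pd c q y₀ = v₀ c := by
  have hlin : ∀ (d : Fin 4) (y : E4), IsLinearMap ℝ (fun (X : Option (Fin 4) → ℝ)
      (i : Option (Fin 4)) => match i with
      | none => X (some d) + ip G (fun a => u a y) (fun a => X (some a)) y * u d y
      | some b => (∑ e, christoffel G e d b y * X (some e)) + hessianRHS G u F h d b y (X none)
          (ip G (fun a => u a y) (fun a => X (some a)) y) (fun a => X (some a))) := by
    intro d y
    constructor
    · intro X Y
      funext i
      match i with
      | none =>
        simp only [Pi.add_apply, ip_add_right]
        ring
      | some b =>
        simp only [Pi.add_apply, ip_add_right, mul_add, Finset.sum_add_distrib, hessianRHS]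
        ring
    · intro r X
      funext i
      match i with
      | none =>
        simp only [Pi.smul_apply, smul_eq_mul, ip_mul_right]
        ring
      | some b =>
        simp only [Pi.smul_apply, smul_eq_mul, ip_mul_right, hessianRHS, mul_left_comm _ r,
          ← Finset.mul_sum]
        ring
  obtain ⟨ρ, hρ, hsub, V, hV0, hVs, hVd⟩ := exists_solution_of_integrable
    (L := fun d y => (hlin d y).mk') hf.metric.isOpen (fun d X i => by
      have hip : ContDiffOn ℝ ∞ (fun y => ip G (fun a => u a y) (fun a => X (some a)) y) U :=
        smooth_ip hf.metric hf.smooth_velocity (fun _ => contDiffOn_const)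
      have hu := hf.smooth_velocity
      simp only [IsLinearMap.mk'_apply]
      match i with
      | none => exact contDiffOn_const.add (hip.mul (hu d))
      | some b =>
        refine (ContDiffOn.sum fun e _ =>
          (hf.metric.smooth_christoffel e d b).mul contDiffOn_const).add ?_
        exact (hf.smooth_expansion.mul (((hu d).mul (contDiffOn_const.add (hip.mul (hu b)))).add
          ((contDiffOn_const.add (hip.mul (hu d))).mul (hu b)))).sub
          (((hf.smooth_spaceCurvature.mul contDiffOn_const).add
            (hf.smooth_expansion.mul hip)).mul (hf.smooth_proj d b)))
    (fun y hy V hV hVp c d i => by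
      simp only [IsLinearMap.mk'_apply] at hVp ⊢
      have key := hf.hessian_integrable hy (q := V none) (v := fun a => V (some a)) (hV none)
        (fun a => hV (some a)) (fun c => hVp c none)
        (fun c b => by
          rw [covVec, hVp c (some b)]
          ring) c d
      match i with
      | none => exact key.1
      | some b => exact key.2 b) hy₀ (fun i => match i with
        | none => q₀
        | some a => v₀ a)
  simp only [IsLinearMap.mk'_apply] at hVd
  have hB : IsOpen (ball y₀ ρ) := isOpen_ball
  have hVdiff : ∀ y ∈ ball y₀ ρ, ∀ i, DifferentiableAt ℝ (V i) y := fun y hy i =>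
    differentiableAt_of_contDiffOn hB (hVs i) hy
  have hcov : ∀ y ∈ ball y₀ ρ, ∀ c b, covVec G (fun a => V (some a)) c b y
      = hessianRHS G u F h c b y (V none y)
        (ip G (fun a => u a y) (fun a => V (some a) y) y) (fun a => V (some a) y) := by
    intro y hy c b
    rw [covVec, hVd y hy c (some b)]
    ring
  have hs : ∀ y ∈ ball y₀ ρ, ip G (fun a => u a y) (fun a => V (some a) y) y = 0 := by
    intro y hy
    rw [eq_of_pd_eq_zero (f := fun z => ip G (fun a => u a z) (fun a => V (some a) z) z)
      (fun z hz => differentiableAt_of_contDiffOn hB (smooth_ip (hf.metric.mono hB hsub)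
        (fun a => (hf.smooth_velocity a).mono hsub) (fun a => hVs (some a))) hz)
      (fun z hz c => hf.pd_ip_velocity_eq_zero (hsub hz) (fun a => hVdiff z hz (some a))
        (hcov z hz) c) hy]
    simp only [hV0, hv₀]
  have hp : ∀ c, EqOn (pd c (V none)) (V (some c)) (ball y₀ ρ) := by
    intro c y hy
    rw [hVd y hy c none]
    simp only [hs y hy]
    ring
  refine ⟨ρ, hρ, hsub, V none, ⟨hVs none, fun y hy => ?_, fun y hy c b => ?_⟩, by rw [hV0],
    fun c => by rw [hp c (mem_ball_self hρ), hV0]⟩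
  · simp only [hp _ hy]
    exact hs y hy
  · have h1 := hcov y hy c b
    simp only [covVec, pd_congr_of_eqOn hB (hp b) hy, hp _ hy] at h1 ⊢
    rw [h1, hessianRHS, hs y hy]
    ring

/-- Solutions of the Hessian equation have a bilinear first integral. -/
theorem IsHessianSolution.first_integral (hf : FluidChart G U u F h) {y₀ : E4} {ρ k : ℝ}
    (hsub : ball y₀ ρ ⊆ U) {q r A : E4 → ℝ} (hq : IsHessianSolution G u F h (ball y₀ ρ) q)
    (hr : IsHessianSolution G u F h (ball y₀ ρ) r) (hA : ContDiffOn ℝ ∞ A (ball y₀ ρ))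
    (hAp : ∀ y ∈ ball y₀ ρ, ∀ c, pd c A y = -(A y * expansion G u F h y * u c y))
    (hk : ∀ y ∈ ball y₀ ρ, spaceCurvature G u F h y * A y ^ 2 = k) (hy : y ∈ ball y₀ ρ) :
    A y ^ 2 * ip G (fun a => pd a q y) (fun a => pd a r y) y + k * (q y * r y)
      = A y₀ ^ 2 * ip G (fun a => pd a q y₀) (fun a => pd a r y₀) y₀ + k * (q y₀ * r y₀) := by
  have hB : IsOpen (ball y₀ ρ) := isOpen_ball
  have hdA := fun z hz => differentiableAt_of_contDiffOn hB hA (y := z) hz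
  have hdq := fun z hz => differentiableAt_of_contDiffOn hB hq.smooth (y := z) hz
  have hdr := fun z hz => differentiableAt_of_contDiffOn hB hr.smooth (y := z) hz
  have hdi := fun z hz => differentiableAt_of_contDiffOn hB (smooth_ip (hf.metric.mono hB hsub)
    (fun a => contDiffOn_pd hB (i := a) hq.smooth)
    (fun a => contDiffOn_pd hB (i := a) hr.smooth)) (y := z) hz
  -- Since dq and dr are orthogonal to u, d⟨dq, dr⟩ = 2H⟨dq, dr⟩u - E(q dr + r dq). The first term
  -- is cancelled by dA = -A H u, and the second by k d(q r) because E A² = k.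
  have key := eq_of_pd_eq_zero (f := fun z =>
      A z * A z * ip G (fun a => pd a q z) (fun a => pd a r z) z + k * (q z * r z))
    (y₀ := y₀) (ρ := ρ)
    (fun z hz => (((hdA z hz).fun_mul (hdA z hz)).fun_mul (hdi z hz)).fun_add
      (((hdq z hz).fun_mul (hdr z hz)).const_mul k)) (fun z hz c => by
      rw [pd_add (((hdA z hz).fun_mul (hdA z hz)).fun_mul (hdi z hz))
        (((hdq z hz).fun_mul (hdr z hz)).const_mul k),
        pd_mul ((hdA z hz).fun_mul (hdA z hz)) (hdi z hz), pd_mul (hdA z hz) (hdA z hz),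
        pd_const_mul _ ((hdq z hz).fun_mul (hdr z hz)), pd_mul (hdq z hz) (hdr z hz),
        hf.metric.pd_ip (hsub hz)
          (fun a => differentiableAt_of_contDiffOn hB (contDiffOn_pd hB hq.smooth) hz)
          (fun a => differentiableAt_of_contDiffOn hB (contDiffOn_pd hB hr.smooth) hz),
        hf.metric.ip_symm (hsub hz) (fun a => pd a q z) (fun b => covVec G _ c b z)]
      simp only [hq.hessian z hz, hr.hessian z hz, hAp z hz, ip_add_left, ip_sub_left, ip_mul_left,
        hf.ip_proj_left (hsub hz), hq.spatial z hz, hr.spatial z hz]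
      rw [hf.metric.ip_symm (hsub hz) (fun a => pd a r z) (fun a => pd a q z), ← hk z hz]
      ring) hy
  linarith

end FluidChart


/-! ### Construction of Robertson-Walker coordinate functions -/

open Set Matrix Metric

section InnerProduct

variable {G : E4 → Matrix (Fin 4) (Fin 4) ℝ} {U : Set E4} {y : E4}

theorem ip_neg_left (v w : Fin 4 → ℝ) :
    ip G (fun a => -v a) w y = -ip G v w y := neg_dotProduct _ _

/-- A covector orthogonal to four independent covectors vanishes. -/
theorem eq_zero_of_ip_eq_zero {φ : Fin 4 → Fin 4 → ℝ} {δ : Fin 4 → ℝ} (hδ : ∀ i, δ i ≠ 0)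
    (hφ : ∀ i j, ip G (φ i) (φ j) y = if i = j then δ i else 0) {w : Fin 4 → ℝ}
    (hw : ∀ i, ip G (φ i) w y = 0) : w = 0 := by
  have h1 : Matrix.of φ * (G y)⁻¹ * (Matrix.of φ)ᵀ = Matrix.diagonal δ := by
    ext i j
    rw [Matrix.diagonal_apply, ← hφ i j, Matrix.mul_assoc]
    simp only [ip, Matrix.mul_apply, dotProduct, Matrix.mulVec, Matrix.of_apply,
      Matrix.transpose_apply]
  have h2 : (Matrix.of φ * (G y)⁻¹) *ᵥ w = 0 := by
    rw [← Matrix.mulVec_mulVec]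
    exact funext hw
  have h3 : (Matrix.of φ * (G y)⁻¹).det ≠ 0 := by
    intro h0
    have h4 := congrArg Matrix.det h1
    rw [Matrix.det_mul, h0, zero_mul, Matrix.det_diagonal] at h4
    exact Finset.prod_ne_zero_iff.2 (fun i _ => hδ i) h4.symm
  exact Matrix.eq_zero_of_mulVec_eq_zero h3 h2

end InnerProduct

/-- Functions `φ⁰ = t`, `φⁱ = xⁱ` on a ball in which the metric takes the Robertson-Walker form:
`w` is `(1 + (k/4) r²)⁻¹`, and the coordinate differentials are orthogonal. -/
structure IsRWFunctions (G : E4 → Matrix (Fin 4) (Fin 4) ℝ) (u : Fin 4 → E4 → ℝ)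
    (F h : E4 → ℝ) (k : ℝ) (y₀ : E4) (ρ : ℝ) (φ : Fin 4 → E4 → ℝ) (A : E4 → ℝ) : Prop where
  smooth : ∀ i, ContDiffOn ℝ ∞ (φ i) (ball y₀ ρ)
  smooth_scale : ContDiffOn ℝ ∞ A (ball y₀ ρ)
  scale_pos : ∀ y ∈ ball y₀ ρ, 0 < A y
  conformal_pos : ∀ y ∈ ball y₀ ρ, 0 < 1 + k / 4 * (φ 1 y ^ 2 + φ 2 y ^ 2 + φ 3 y ^ 2)
  pd_scale : ∀ y ∈ ball y₀ ρ, ∀ c, pd c A y = A y * expansion G u F h y * pd c (φ 0) y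
  curvature : ∀ y ∈ ball y₀ ρ, spaceCurvature G u F h y * A y ^ 2 = k
  orthogonal : ∀ y ∈ ball y₀ ρ, ∀ i j, ip G (fun a => pd a (φ i) y) (fun a => pd a (φ j) y) y =
    if i = j then (if i = 0 then -1
      else (1 + k / 4 * (φ 1 y ^ 2 + φ 2 y ^ 2 + φ 3 y ^ 2)) ^ 2 / A y ^ 2) else 0

namespace FluidChart

variable {G : E4 → Matrix (Fin 4) (Fin 4) ℝ} {U : Set E4} {u : Fin 4 → E4 → ℝ} {F h : E4 → ℝ}
  {y : E4}

/-- A scale factor and a time function. -/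
theorem exists_scale_and_time (hf : FluidChart G U u F h) {y₀ : E4} (hy₀ : y₀ ∈ U) :
    ∃ ρ > 0, ball y₀ ρ ⊆ U ∧ ∃ (k : ℝ) (t A : E4 → ℝ), (k = -1 ∨ k = 0 ∨ k = 1) ∧
      ContDiffOn ℝ ∞ t (ball y₀ ρ) ∧ ContDiffOn ℝ ∞ A (ball y₀ ρ) ∧ ∀ y ∈ ball y₀ ρ,
        (∀ c, pd c t y = -u c y) ∧ 0 < A y ∧
        (∀ c, pd c A y = -(A y * expansion G u F h y * u c y)) ∧
        spaceCurvature G u F h y * A y ^ 2 = k := by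
  have hU := hf.metric.isOpen
  obtain ⟨ρ₁, hρ₁, hs₁, t, -, ht, htp⟩ := exists_potential hU (w := fun c z => -u c z)
    (fun a => (hf.smooth_velocity a).neg)
    (fun y hy c d => by rw [pd_neg, pd_neg, hf.closed_velocity hy]) hy₀
  -- H u is closed because u is closed and dH is a multiple of u. Its potential, up to sign, is the
  -- logarithm of the scale factor.
  obtain ⟨ρ₂, hρ₂, hs₂, s, hs0, hs, hsp⟩ := exists_potential hU
    (w := fun c z => -(expansion G u F h z * u c z))
    (fun a => (hf.smooth_expansion.mul (hf.smooth_velocity a)).neg)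
    (fun y hy c d => by
      have hH := hf.differentiableAt_expansion hy
      have hu := hf.differentiableAt_velocity hy
      rw [pd_neg, pd_neg, pd_mul hH (hu d), pd_mul hH (hu c), hf.closed_velocity hy c d,
        hf.pd_expansion hy, hf.pd_expansion hy]
      ring) hy₀
  set E₀ := spaceCurvature G u F h y₀ with hE₀
  -- The free multiplicative constant of A normalises E A² to the sign of E at the centre.
  obtain ⟨A₀, hA₀, hk⟩ : ∃ A₀ > 0, E₀ * A₀ ^ 2 = -1 ∨ E₀ * A₀ ^ 2 = 0 ∨ E₀ * A₀ ^ 2 = 1 := by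
    rcases lt_trichotomy E₀ 0 with h0 | h0 | h0
    · have h1 : 0 < -E₀ := by linarith
      refine ⟨1 / Real.sqrt (-E₀), by positivity, Or.inl ?_⟩
      rw [div_pow, Real.sq_sqrt h1.le]
      field_simp
      rw [div_self h0.ne]
    · exact ⟨1, one_pos, Or.inr (Or.inl (by rw [h0, zero_mul]))⟩
    · refine ⟨1 / Real.sqrt E₀, by positivity, Or.inr (Or.inr ?_)⟩
      rw [div_pow, Real.sq_sqrt h0.le]
      field_simp
  set ρ := min ρ₁ ρ₂ with hρ
  have hB₁ : ball y₀ ρ ⊆ ball y₀ ρ₁ := ball_subset_ball (min_le_left _ _)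
  have hB₂ : ball y₀ ρ ⊆ ball y₀ ρ₂ := ball_subset_ball (min_le_right _ _)
  have hsub : ball y₀ ρ ⊆ U := hB₁.trans hs₁
  have hρ0 : 0 < ρ := lt_min hρ₁ hρ₂
  set A : E4 → ℝ := fun y => A₀ * Real.exp (s y) with hA
  have hAs : ContDiffOn ℝ ∞ A (ball y₀ ρ) :=
    contDiffOn_const.mul (Real.contDiff_exp.comp_contDiffOn (hs.mono hB₂))
  have hAp : ∀ y ∈ ball y₀ ρ, ∀ c, pd c A y = -(A y * expansion G u F h y * u c y) := by
    intro y hy c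
    have h1 : DifferentiableAt ℝ s y := differentiableAt_of_contDiffOn isOpen_ball hs (hB₂ hy)
    have h2 : pd c (fun z => Real.exp (s z)) y = Real.exp (s y) * pd c s y := by
      rw [pd, h1.hasFDerivAt.exp.fderiv]
      rfl
    rw [hA, pd_const_mul _ h1.exp, h2, hsp y (hB₂ hy)]
    ring
  refine ⟨ρ, hρ0, hsub, E₀ * A₀ ^ 2, t, A, hk, ht.mono hB₁, hAs,
    fun y hy => ⟨htp y (hB₁ hy), by positivity, hAp y hy, ?_⟩⟩
  have hdA := fun z hz => differentiableAt_of_contDiffOn isOpen_ball hAs (y := z) hz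
  have hdE := fun z hz => hf.differentiableAt_spaceCurvature (y := z) (hsub hz)
  have key := eq_of_pd_eq_zero (f := fun z => spaceCurvature G u F h z * (A z * A z))
    (fun z hz => (hdE z hz).fun_mul ((hdA z hz).fun_mul (hdA z hz))) (fun z hz c => by
      rw [pd_mul (hdE z hz) ((hdA z hz).fun_mul (hdA z hz)), pd_mul (hdA z hz) (hdA z hz),
        hAp z hz, hf.pd_spaceCurvature (hsub hz)]
      ring) hy
  have h1 : A y₀ = A₀ := by simp [hA, hs0]
  rw [h1] at key
  rw [sq, sq]
  exact key

/-- Functions satisfying the Hessian equation which generate the spatial coordinates. -/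
theorem exists_spatial_generators (hf : FluidChart G U u F h) {y₀ : E4} (hy₀ : y₀ ∈ U) {A₀ : ℝ}
    (hA₀ : 0 < A₀) : ∃ ρ > 0, ball y₀ ρ ⊆ U ∧ ∃ (q : Fin 4 → E4 → ℝ) (w : E4 → ℝ),
      (∀ i, IsHessianSolution G u F h (ball y₀ ρ) (q i)) ∧
      IsHessianSolution G u F h (ball y₀ ρ) w ∧ (∀ i, q i y₀ = 0) ∧ w y₀ = 1 / 2 ∧
      (∀ c, pd c w y₀ = 0) ∧ ∀ i j, i ≠ 0 → j ≠ 0 →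
        A₀ ^ 2 * ip G (fun a => pd a (q i) y₀) (fun a => pd a (q j) y₀) y₀
          = if i = j then 1 else 0 := by
  obtain ⟨f, fr⟩ := hf.frame y₀ hy₀
  have ho : ∀ i j, hat f (fun a => hat f (fun b => G y₀ a b) j) i = mink i j := fr.orth
  have hhat : ∀ i j, hat f (fun a => hat f (fun b => G y₀ a b) i / A₀) j = mink j i / A₀ := by
    intro i j
    simp only [div_eq_mul_inv, hat_mul_right, ho]
  -- For spatial `i` the initial differential is the lowered frame vector divided by `A₀`, which
  -- gives A₀²⟨dq_i, dq_j⟩ = δ_ij. The entry `i = 0` is a filler that keeps the index type `Fin 4`.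
  have hex : ∀ i : Fin 4, ∃ ρ > 0, ball y₀ ρ ⊆ U ∧ ∃ q,
      IsHessianSolution G u F h (ball y₀ ρ) q ∧ q y₀ = 0 ∧
      (i ≠ 0 → ∀ c, pd c q y₀ = hat f (fun b => G y₀ c b) i / A₀) := by
    intro i
    by_cases hi : i = 0
    · obtain ⟨ρ, hρ, hs, q, hq, hq0, -⟩ := hf.exists_hessianSolution hy₀ 0 (fun _ => 0)
        (by rw [fr.sum_velocity_ip]; exact dotProduct_zero _)
      exact ⟨ρ, hρ, hs, q, hq, hq0, fun h0 => absurd hi h0⟩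
    · obtain ⟨ρ, hρ, hs, q, hq, hq0, hqp⟩ := hf.exists_hessianSolution hy₀ 0
        (fun c => hat f (fun b => G y₀ c b) i / A₀) (by
          rw [fr.sum_velocity_ip, hhat, mink, if_neg (Ne.symm hi), zero_div])
      exact ⟨ρ, hρ, hs, q, hq, hq0, fun _ => hqp⟩
  choose r hr hrs q hq hq0 hqp using hex
  obtain ⟨ρw, hρw, hws, w, hw, hw0, hwp⟩ := hf.exists_hessianSolution hy₀ (1 / 2) (fun _ => 0)
    (by rw [fr.sum_velocity_ip]; exact dotProduct_zero _)
  obtain ⟨ρ', hρ', hle⟩ : ∃ ρ' > 0, ∀ i, ρ' ≤ r i := by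
    refine ⟨Finset.univ.inf' Finset.univ_nonempty r, ?_, fun i => Finset.inf'_le _ (by simp)⟩
    exact (Finset.lt_inf'_iff _).2 fun i _ => hr i
  refine ⟨min ρ' ρw, lt_min hρ' hρw, (ball_subset_ball (min_le_right _ _)).trans hws, q, w,
    fun i => (hq i).mono (ball_subset_ball ((min_le_left _ _).trans (hle i))),
    hw.mono (ball_subset_ball (min_le_right _ _)), hq0, hw0, hwp, fun i j hi hj => ?_⟩
  rw [ip, fr.dotProduct_inv]
  simp only [hqp i hi, hqp j hj, hhat]
  have hsum : ∑ k, mink k k * (mink k i / A₀) * (mink k j / A₀)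
      = (if i = j then 1 else 0) / A₀ ^ 2 := by
    fin_cases i <;> fin_cases j <;>
      first
      | exact absurd rfl hi
      | exact absurd rfl hj
      | (simp [Fin.sum_univ_four, mink, sq])
  rw [hsum]
  field_simp

/-- Stereographic projection. For k = 1 the q_i and 2w' behave like the coordinates of a unit
3-sphere with pole at the centre: the first integrals are the relations A²⟨dX, dY⟩ + XY = ⟨X, Y⟩
between ambient linear functions. Hence x_i = q_i/(w' + 1/2) = 2q_i/(1 + 2w') are stereographic
coordinates with conformal factor v = 1/(w' + 1/2). The same formulas serve the hyperboloid (k = -1)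
and flat space (k = 0, where w' is constantly 1/2). -/
theorem exists_rwFunctions (hf : FluidChart G U u F h) {y₀ : E4} (hy₀ : y₀ ∈ U) :
    ∃ ρ > 0, ball y₀ ρ ⊆ U ∧ ∃ (k : ℝ) (φ : Fin 4 → E4 → ℝ) (A : E4 → ℝ),
      (k = -1 ∨ k = 0 ∨ k = 1) ∧ IsRWFunctions G u F h k y₀ ρ φ A := by
  obtain ⟨ρ₁, hρ₁, hs₁, k, t, A, hk, ht, hA, htA⟩ := hf.exists_scale_and_time hy₀
  obtain ⟨ρ₂, hρ₂, hs₂, q, w', hq, hw', hq0, hw0, hwp0, hqq0⟩ :=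
    hf.exists_spatial_generators hy₀ (htA y₀ (mem_ball_self hρ₁)).2.1
  have hwev : ∀ᶠ y in nhds y₀, 0 < w' y + 1 / 2 := by
    have h1 : ContinuousAt w' y₀ :=
      (differentiableAt_of_contDiffOn isOpen_ball hw'.smooth (mem_ball_self hρ₂)).continuousAt
    exact (h1.add continuousAt_const).eventually_const_lt (by rw [Pi.add_apply, hw0]; norm_num)
  obtain ⟨ρ₃, hρ₃, hwpos⟩ := Metric.eventually_nhds_iff_ball.1 hwev
  set ρ := min (min ρ₁ ρ₂) ρ₃ with hρdef
  have hρ : 0 < ρ := lt_min (lt_min hρ₁ hρ₂) hρ₃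
  have hB₁ : ball y₀ ρ ⊆ ball y₀ ρ₁ :=
    ball_subset_ball ((min_le_left _ _).trans (min_le_left _ _))
  have hB₂ : ball y₀ ρ ⊆ ball y₀ ρ₂ :=
    ball_subset_ball ((min_le_left _ _).trans (min_le_right _ _))
  have hB₃ : ball y₀ ρ ⊆ ball y₀ ρ₃ := ball_subset_ball (min_le_right _ _)
  have hsub : ball y₀ ρ ⊆ U := hB₁.trans hs₁
  have hB : IsOpen (ball y₀ ρ) := isOpen_ball
  have hy₀B : y₀ ∈ ball y₀ ρ := mem_ball_self hρ
  replace ht := ht.mono hB₁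
  replace hA := hA.mono hB₁
  replace hq := fun i => (hq i).mono hB₂
  replace hw' := hw'.mono hB₂
  have hAp : ∀ y ∈ ball y₀ ρ, ∀ c, pd c A y = -(A y * expansion G u F h y * u c y) :=
    fun y hy => (htA y (hB₁ hy)).2.2.1
  have hcurv : ∀ y ∈ ball y₀ ρ, spaceCurvature G u F h y * A y ^ 2 = k :=
    fun y hy => (htA y (hB₁ hy)).2.2.2
  -- first integrals
  have iqq : ∀ y ∈ ball y₀ ρ, ∀ i j, i ≠ 0 → j ≠ 0 →
      A y ^ 2 * ip G (fun a => pd a (q i) y) (fun a => pd a (q j) y) y + k * (q i y * q j y)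
        = if i = j then 1 else 0 := by
    intro y hy i j hi hj
    rw [IsHessianSolution.first_integral hf hsub (hq i) (hq j) hA hAp hcurv hy, hqq0 i j hi hj,
      hq0, hq0]
    ring
  have hip0 : ∀ v, ip G (fun a => pd a w' y₀) v y₀ = 0 := by
    intro v
    simp only [hwp0]
    exact zero_dotProduct _
  have iwq : ∀ y ∈ ball y₀ ρ, ∀ j,
      A y ^ 2 * ip G (fun a => pd a w' y) (fun a => pd a (q j) y) y + k * (w' y * q j y) = 0 := by
    intro y hy j
    rw [IsHessianSolution.first_integral hf hsub hw' (hq j) hA hAp hcurv hy, hip0, hq0]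
    ring
  have iww : ∀ y ∈ ball y₀ ρ,
      A y ^ 2 * ip G (fun a => pd a w' y) (fun a => pd a w' y) y + k * (w' y * w' y) = k / 4 := by
    intro y hy
    rw [IsHessianSolution.first_integral hf hsub hw' hw' hA hAp hcurv hy, hip0, hw0]
    ring
  set w : E4 → ℝ := fun y => w' y + 1 / 2 with hw
  have hwpos' : ∀ y ∈ ball y₀ ρ, 0 < w y := fun y hy => hwpos y (hB₃ hy)
  have hws : ContDiffOn ℝ ∞ w (ball y₀ ρ) := hw'.smooth.add contDiffOn_const
  have hdw := fun z hz => differentiableAt_of_contDiffOn hB hws (y := z) hz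
  have hpw : ∀ y ∈ ball y₀ ρ, ∀ a, pd a w y = pd a w' y := by
    intro y hy a
    rw [hw, pd_add (differentiableAt_of_contDiffOn hB hw'.smooth hy) (by fun_prop), pd_const,
      add_zero]
  set v : E4 → ℝ := fun y => (w y)⁻¹ with hv
  have hvs : ContDiffOn ℝ ∞ v (ball y₀ ρ) := hws.inv fun y hy => (hwpos' y hy).ne'
  have hdv := fun z hz => differentiableAt_of_contDiffOn hB hvs (y := z) hz
  have hpv : ∀ y ∈ ball y₀ ρ, ∀ a, pd a v y = -(v y ^ 2 * pd a w' y) := by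
    intro y hy a
    have h1 : pd a (fun z => w z * v z) y = 0 := by
      rw [pd_congr_of_eqOn hB (g := fun _ => 1)
        (fun z hz => mul_inv_cancel₀ (hwpos' z hz).ne') hy, pd_const]
    rw [pd_mul (hdw y hy) (hdv y hy), hpw y hy] at h1
    have h2 := (hwpos' y hy).ne'
    have h3 : v y * w y = 1 := inv_mul_cancel₀ h2
    linear_combination v y * h1 - pd a v y * h3
  set φ : Fin 4 → E4 → ℝ := fun i y => if i = 0 then t y else q i y * v y with hφ
  have hφ0 : φ 0 = t := by
    funext y
    simp [hφ]
  have hφi : ∀ i, i ≠ 0 → φ i = fun y => q i y * v y := by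
    intro i hi
    funext y
    simp [hφ, hi]
  have hφs : ∀ i, ContDiffOn ℝ ∞ (φ i) (ball y₀ ρ) := by
    intro i
    by_cases hi : i = 0
    · rw [hi, hφ0]
      exact ht
    · rw [hφi i hi]
      exact (hq i).smooth.mul hvs
  have hpφ : ∀ y ∈ ball y₀ ρ, ∀ i, i ≠ 0 → ∀ a, pd a (φ i) y
      = v y * (pd a (q i) y - φ i y * pd a w' y) := by
    intro y hy i hi a
    rw [hφi i hi, pd_mul (differentiableAt_of_contDiffOn hB (hq i).smooth hy) (hdv y hy),
      hpv y hy]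
    ring
  have hpt : ∀ y ∈ ball y₀ ρ, ∀ a, pd a (φ 0) y = -u a y := by
    intro y hy a
    rw [hφ0, (htA y (hB₁ hy)).1]
  have hqφ : ∀ y ∈ ball y₀ ρ, ∀ i, i ≠ 0 → q i y = φ i y * w y := by
    intro y hy i hi
    rw [hφi i hi]
    exact (inv_mul_cancel_right₀ (hwpos' y hy).ne' _).symm
  have hw'w : ∀ y, w' y = w y - 1 / 2 := fun y => by simp only [hw]; ring
  have hAne : ∀ y ∈ ball y₀ ρ, A y ≠ 0 := fun y hy => (htA y (hB₁ hy)).2.1.ne'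
  have i00 : ∀ y ∈ ball y₀ ρ, ip G (fun a => pd a (φ 0) y) (fun a => pd a (φ 0) y) y = -1 := by
    intro y hy
    simp only [hpt y hy, ip_neg_left]
    rw [hf.metric.ip_symm (hsub hy)]
    simp only [ip_neg_left, hf.ip_velocity (hsub hy)]
    ring
  have iuq : ∀ y ∈ ball y₀ ρ, ∀ i, i ≠ 0 →
      ip G (fun a => pd a (φ i) y) (fun a => u a y) y = 0 := by
    intro y hy i hi
    have e1 := (hq i).spatial y hy
    have e2 := hw'.spatial y hy
    rw [hf.metric.ip_symm (hsub hy)] at e1 e2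
    simp only [hpφ y hy i hi, ip_mul_left, ip_sub_left, e1, e2]
    ring
  have i0i : ∀ y ∈ ball y₀ ρ, ∀ i, i ≠ 0 →
      ip G (fun a => pd a (φ 0) y) (fun a => pd a (φ i) y) y = 0 := by
    intro y hy i hi
    simp only [hpt y hy, ip_neg_left]
    rw [hf.metric.ip_symm (hsub hy), iuq y hy i hi, neg_zero]
  have iij : ∀ y ∈ ball y₀ ρ, ∀ i j, i ≠ 0 → j ≠ 0 →
      ip G (fun a => pd a (φ i) y) (fun a => pd a (φ j) y) y
        = if i = j then v y ^ 2 / A y ^ 2 else 0 := by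
    intro y hy i j hi hj
    have hs := hf.metric.ip_symm (hsub hy)
    have e1 := iqq y hy i j hi hj
    have e2 := iwq y hy i
    have e3 := iwq y hy j
    have e4 := iww y hy
    simp only [hqφ y hy i hi, hqφ y hy j hj, hw'w] at e1 e2 e3 e4
    have e5 : ip G (fun a => pd a (φ i) y) (fun a => pd a (φ j) y) y
        = v y ^ 2 * (ip G (fun a => pd a (q i) y) (fun a => pd a (q j) y) y
          - φ i y * ip G (fun a => pd a w' y) (fun a => pd a (q j) y) y
          - φ j y * (ip G (fun a => pd a w' y) (fun a => pd a (q i) y) y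
            - φ i y * ip G (fun a => pd a w' y) (fun a => pd a w' y) y)) := by
      simp only [hpφ y hy i hi, ip_mul_left, ip_sub_left]
      rw [hs (fun a => pd a (q i) y) (fun a => pd a (φ j) y),
        hs (fun a => pd a w' y) (fun a => pd a (φ j) y)]
      simp only [hpφ y hy j hj, ip_mul_left, ip_sub_left]
      rw [hs (fun a => pd a (q j) y) (fun a => pd a (q i) y),
        hs (fun a => pd a (q j) y) (fun a => pd a w' y)]
      ring
    have e6 : A y ^ 2 * ip G (fun a => pd a (φ i) y) (fun a => pd a (φ j) y) y
        = v y ^ 2 * if i = j then 1 else 0 := by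
      rw [e5]
      -- With q_i = φ_i w and w' = w - 1/2, all terms containing k cancel, and A²⟨dφ_i, dφ_j⟩ = v²
      -- δ_ij remains.
      linear_combination v y ^ 2 * e1 - v y ^ 2 * φ i y * e3 - v y ^ 2 * φ j y * e2
        + v y ^ 2 * φ i y * φ j y * e4
    have hA2 : A y ^ 2 ≠ 0 := pow_ne_zero _ (hAne y hy)
    split_ifs at e6 ⊢ with hij
    · rw [eq_div_iff hA2]
      linear_combination e6
    · rw [mul_zero] at e6
      exact (mul_eq_zero.1 e6).resolve_left hA2
  have hvpos : ∀ y ∈ ball y₀ ρ, 0 < v y := fun y hy => inv_pos.2 (hwpos' y hy)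
  -- the conformal factor
  have hvφ : ∀ y ∈ ball y₀ ρ, v y = 1 + k / 4 * (φ 1 y ^ 2 + φ 2 y ^ 2 + φ 3 y ^ 2) := by
    have hdφ : ∀ i, ∀ z ∈ ball y₀ ρ, DifferentiableAt ℝ (φ i) z :=
      fun i z hz => differentiableAt_of_contDiffOn hB (hφs i) hz
    set S : E4 → ℝ := fun z => φ 1 z * φ 1 z + φ 2 z * φ 2 z + φ 3 z * φ 3 z with hS
    have hdS : ∀ z ∈ ball y₀ ρ, DifferentiableAt ℝ S z := fun z hz =>
      (((hdφ 1 z hz).fun_mul (hdφ 1 z hz)).fun_add ((hdφ 2 z hz).fun_mul (hdφ 2 z hz))).fun_add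
        ((hdφ 3 z hz).fun_mul (hdφ 3 z hz))
    have hpS : ∀ z ∈ ball y₀ ρ, ∀ a, pd a S z
        = 2 * (φ 1 z * pd a (φ 1) z + φ 2 z * pd a (φ 2) z + φ 3 z * pd a (φ 3) z) := by
      intro z hz a
      have m := fun i => (hdφ i z hz).fun_mul (hdφ i z hz)
      rw [hS, pd_add ((m 1).fun_add (m 2)) (m 3), pd_add (m 1) (m 2),
        pd_mul (hdφ 1 z hz) (hdφ 1 z hz), pd_mul (hdφ 2 z hz) (hdφ 2 z hz),
        pd_mul (hdφ 3 z hz) (hdφ 3 z hz)]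
      ring
    have hdkS : ∀ z ∈ ball y₀ ρ, DifferentiableAt ℝ (fun x => k / 4 * S x) z :=
      fun z hz => (differentiableAt_const _).fun_mul (hdS z hz)
    -- The differential of v - (k/4)|x|² is orthogonal to the four independent covectors dφ_i, so it
    -- vanishes. The function equals 1 at the centre, where all x_i are zero.
    have hzero : ∀ z ∈ ball y₀ ρ, ∀ a, pd a (fun x => v x - k / 4 * S x) z = 0 := by
      intro z hz
      have hs := hf.metric.ip_symm (hsub hz)
      have hA2 : A z ^ 2 ≠ 0 := pow_ne_zero _ (hAne z hz)
      have hp : ∀ a, pd a (fun x => v x - k / 4 * S x) z = -(v z ^ 2) * pd a w' z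
          - k / 2 * (φ 1 z * pd a (φ 1) z + (φ 2 z * pd a (φ 2) z + φ 3 z * pd a (φ 3) z)) := by
        intro a
        rw [pd_sub (hdv z hz) (hdkS z hz), pd_const_mul _ (hdS z hz), hpS z hz, hpv z hz]
        ring
      have hiw : ∀ i, i ≠ 0 → A z ^ 2 * ip G (fun a => pd a w' z) (fun a => pd a (φ i) z) z
          = -(k / 2 * φ i z) := by
        intro i hi
        have e2 := iwq z hz i
        have e4 := iww z hz
        rw [hs] at e2 ⊢
        simp only [hqφ z hz i hi, hw'w] at e2 e4
        simp only [hpφ z hz i hi, ip_mul_left, ip_sub_left]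
        have h3 : v z * w z = 1 := inv_mul_cancel₀ (hwpos' z hz).ne'
        linear_combination v z * e2 - v z * φ i z * e4 - k / 2 * φ i z * h3
      have hiw0 : ip G (fun a => pd a w' z) (fun a => pd a (φ 0) z) z = 0 := by
        have e2 := hw'.spatial z hz
        rw [hs]
        simp only [hpt z hz, ip_neg_left, e2, neg_zero]
      refine fun a => congrFun (eq_zero_of_ip_eq_zero (G := G) (y := z)
        (φ := fun i a => pd a (φ i) z)
        (δ := fun i => if i = 0 then -1 else v z ^ 2 / A z ^ 2) (fun i => ?_) (fun i j => ?_)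
        (w := fun a => pd a (fun x => v x - k / 4 * S x) z) (fun i => ?_)) a
      · have := hvpos z hz
        have := (htA z (hB₁ hz)).2.1
        split_ifs
        · norm_num
        · positivity
      · by_cases hi : i = 0 <;> by_cases hj : j = 0
        · rw [hi, hj, i00 z hz]
          simp
        · rw [hi, i0i z hz j hj, if_neg (Ne.symm hj)]
        · rw [hj, hs, i0i z hz i hi, if_neg hi]
        · rw [iij z hz i j hi hj, if_neg hi]
      · rw [hs]
        simp only [hp, ip_sub_left, ip_mul_left, ip_add_left]
        by_cases hi : i = 0
        · rw [hi, hiw0, hs _ (fun a => pd a (φ 0) z), i0i z hz 1 (by decide),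
            hs _ (fun a => pd a (φ 0) z), i0i z hz 2 (by decide),
            hs _ (fun a => pd a (φ 0) z), i0i z hz 3 (by decide)]
          ring
        · have e1 := hiw i hi
          have e2 : ip G (fun a => pd a w' z) (fun a => pd a (φ i) z) z
              = -(k / 2 * φ i z) / A z ^ 2 := by
            rw [eq_div_iff hA2]
            linear_combination e1
          rw [e2, iij z hz 1 i (by decide) hi, iij z hz 2 i (by decide) hi,
            iij z hz 3 i (by decide) hi]
          fin_cases i
          · exact absurd rfl hi
          all_goals
            simp
            ring
    intro y hy
    have key := eq_of_pd_eq_zero (f := fun x => v x - k / 4 * S x)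
      (fun z hz => (hdv z hz).fun_sub (hdkS z hz)) hzero hy
    have h0 : ∀ i, i ≠ 0 → φ i y₀ = 0 := fun i hi => by
      rw [hφi i hi]
      simp only [hq0, zero_mul]
    have hv0 : v y₀ = 1 := by
      simp only [hv, hw, hw0]
      norm_num
    simp only [hS, h0 1 (by decide), h0 2 (by decide), h0 3 (by decide), hv0] at key
    linear_combination key
  refine ⟨ρ, hρ, hsub, k, φ, A, hk, hφs, hA, fun y hy => (htA y (hB₁ hy)).2.1, fun y hy => ?_,
    fun y hy c => ?_, hcurv, fun y hy i j => ?_⟩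
  · rw [← hvφ y hy]
    exact hvpos y hy
  · rw [hAp y hy, hpt y hy]
    ring
  · rw [← hvφ y hy]
    by_cases hi : i = 0 <;> by_cases hj : j = 0
    · rw [hi, hj, i00 y hy]
      simp
    · rw [hi, i0i y hy j hj, if_neg (Ne.symm hj)]
    · rw [hj, hf.metric.ip_symm (hsub hy), i0i y hy i hi, if_neg hi]
    · rw [iij y hy i j hi hj, if_neg hi]

end FluidChart


open Set Matrix Metric

/-! ### Adapted orthonormal frames -/

/-- In a Lorentzian vector space, a unit timelike vector is part of an orthonormal family. -/
theorem exists_orthonormal_of_timelike {V : Type*} [AddCommGroup V] [Module ℝ V]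
    (B : V → V → ℝ) (hadd : ∀ x y z, B (x + y) z = B x z + B y z)
    (hsmul : ∀ (r : ℝ) x z, B (r • x) z = r * B x z) (hsymm : ∀ x y, B x y = B y x)
    {b : Fin 4 → V} (hb : ∀ i j, B (b i) (b j) = mink i j) {u : V} (hu : B u u = -1) :
    ∃ f : Fin 4 → V, (∀ i j, B (f i) (f j) = mink i j) ∧ f 0 = u := by
  have hadd' : ∀ x y z, B z (x + y) = B z x + B z y := fun x y z => by
    rw [hsymm, hadd, hsymm x, hsymm y]
  have hsmul' : ∀ (r : ℝ) x z, B z (r • x) = r * B z x := fun r x z => by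
    rw [hsymm, hsmul, hsymm x]
  -- The frame is obtained by the reflection along v = u + s b₀, which sends b₀ to -s u. The sign s
  -- = ±1 is chosen so that v is not null, which is possible because B(v, v) = 2s (B(u, b₀) - s).
  obtain ⟨s, hs, hN⟩ : ∃ s : ℝ, s * s = 1 ∧ B u (b 0) - s ≠ 0 := by
    by_cases h1 : B u (b 0) = 1
    · exact ⟨-1, by norm_num, by rw [h1]; norm_num⟩
    · exact ⟨1, by norm_num, sub_ne_zero.2 h1⟩
  have hs0 : s ≠ 0 := fun h0 => by simp [h0] at hs
  have h00 : B (b 0) (b 0) = -1 := by simp [hb, mink]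
  set v := u + s • b 0 with hv
  have hvv : B v v = 2 * s * (B u (b 0) - s) := by
    rw [hv]
    simp only [hadd, hadd', hsmul, hsmul', hu, h00, hsymm (b 0) u]
    linear_combination (1 : ℝ) * hs
  have hvv0 : B v v ≠ 0 := by
    rw [hvv]
    exact mul_ne_zero (mul_ne_zero two_ne_zero hs0) hN
  set c : Fin 4 → ℝ := fun i => 2 * B (b i) v / B v v with hc
  have hcv : ∀ i, c i * B v v = 2 * B (b i) v := fun i => div_mul_cancel₀ _ hvv0
  have hc0 : c 0 = s := by
    rw [hc]
    dsimp only
    rw [div_eq_iff hvv0, hvv, hv, hadd', hsmul', h00, hsymm]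
    linear_combination (-2 * B u (b 0) + 2 * s) * hs
  have horth : ∀ i j, B (b i + (-c i) • v) (b j + (-c j) • v) = mink i j := by
    intro i j
    simp only [hadd, hadd', hsmul, hsmul', hb, hsymm v (b j)]
    linear_combination c i * hcv j
  refine ⟨fun i => (if i = 0 then -s else 1) • (b i + (-c i) • v), fun i j => ?_, ?_⟩
  · simp only [hsmul, hsmul', horth]
    by_cases hi : i = 0 <;> by_cases hj : j = 0
    · simp only [hi, hj, if_true]
      linear_combination mink 0 0 * hs
    · simp [hi, hj, mink, Ne.symm hj]
    · simp [hi, hj, mink]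
    · simp [hi, hj]
  · simp only [if_true, hc0, hv, smul_add, smul_smul]
    have e1 : -s * (-s) = 1 := by linear_combination hs
    have e2 : -s * (-s * s) = s := by linear_combination s * hs
    rw [e1, one_smul, e2, neg_smul]
    abel

theorem IsFrame.det_ne_zero {f : Fin 4 → Fin 4 → ℝ} {G : Matrix (Fin 4) (Fin 4) ℝ}
    {u : Fin 4 → ℝ} (h : IsFrame f G u) : G.det ≠ 0 := by
  intro h0
  have h1 := congrArg Matrix.det h.mul_left_inv
  simp [Matrix.det_mul, h0] at h1

/-! ### Smooth components of the metric and adapted frames in a chart -/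

section Manifold

variable {M : Type*} [TopologicalSpace M] [ChartedSpace E4 M]
  {e e' : OpenPartialHomeomorph M E4}

theorem mdifferentiable_of_mem_maximalAtlas (he : e ∈ IsManifold.maximalAtlas (𝓡 4) ∞ M) :
    e.MDifferentiable (𝓡 4) (𝓡 4) :=
  ⟨(contMDiffOn_of_mem_maximalAtlas he).mdifferentiableOn (by simp),
    (contMDiffOn_symm_of_mem_maximalAtlas he).mdifferentiableOn (by simp)⟩

theorem contDiffOn_comp_symm (he : e ∈ IsManifold.maximalAtlas (𝓡 4) ∞ M) {f : M → ℝ}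
    (hf : ContMDiff (𝓡 4) 𝓘(ℝ, ℝ) ∞ f) : ContDiffOn ℝ ∞ (fun y => f (e.symm y)) e.target :=
  (hf.comp_contMDiffOn (contMDiffOn_symm_of_mem_maximalAtlas he)).contDiffOn

theorem contDiffOn_transition (he : e ∈ IsManifold.maximalAtlas (𝓡 4) ∞ M)
    (he' : e' ∈ IsManifold.maximalAtlas (𝓡 4) ∞ M) :
    ContDiffOn ℝ ∞ (fun z => e' (e.symm z)) (e.target ∩ e.symm ⁻¹' e'.source) := by
  have h1 := (contMDiffOn_of_mem_maximalAtlas he').comp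
    ((contMDiffOn_symm_of_mem_maximalAtlas he).mono inter_subset_left)
    (inter_subset_right : e.target ∩ e.symm ⁻¹' e'.source ⊆ _)
  exact h1.contDiffOn

variable [IsManifold (𝓡 4) ∞ M]

theorem contMDiffOn_coordVec (he : e ∈ IsManifold.maximalAtlas (𝓡 4) ∞ M) (i : Fin 4) :
    ContMDiffOn (𝓡 4) (𝓡 4).tangent ∞
      (fun y => (⟨e.symm y, coordVec e i y⟩ : TangentBundle (𝓡 4) M)) e.target := by
  have hu : UniqueMDiffOn (𝓡 4) e.target := e.open_target.uniqueMDiffOn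
  have h1 := (contMDiffOn_symm_of_mem_maximalAtlas he).contMDiffOn_tangentMapWithin
    (m := ∞) (by simp) hu
  have h2 : ContMDiffOn (𝓡 4) (𝓡 4).tangent ∞
      (fun y : E4 => (⟨y, (EuclideanSpace.single i (1 : ℝ) : E4)⟩ : TangentBundle (𝓡 4) E4))
      e.target :=
    contMDiffOn_vectorSpace_iff_contDiffOn.2 contDiffOn_const
  refine (h1.comp h2 fun y hy => hy).congr fun y hy => ?_
  simp only [Function.comp, tangentMapWithin, coordVec]
  rw [mfderivWithin_of_isOpen e.open_target hy]

theorem contDiffOn_metric_apply (g : LorentzMetric M) {b : E4 → M} {s : Set E4}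
    {v w : ∀ y, TangentSpace (𝓡 4) (b y)}
    (hb : ContMDiffOn (𝓡 4) (𝓡 4) ∞ b s)
    (hv : ContMDiffOn (𝓡 4) (𝓡 4).tangent ∞
      (fun y => (⟨b y, v y⟩ : TangentBundle (𝓡 4) M)) s)
    (hw : ContMDiffOn (𝓡 4) (𝓡 4).tangent ∞
      (fun y => (⟨b y, w y⟩ : TangentBundle (𝓡 4) M)) s) :
    ContDiffOn ℝ ∞ (fun y => g.val (b y) (v y) (w y)) s := by
  have h1 : ContMDiffOn (𝓡 4) ((𝓡 4).prod 𝓘(ℝ)) ∞ (fun y =>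
      Bundle.TotalSpace.mk' ℝ (E := Bundle.Trivial M ℝ) (b y) (g.val (b y) (v y) (w y))) s := by
    apply ContMDiffOn.clm_bundle_apply₂ (F₁ := E4) (F₂ := E4)
    · exact g.contMDiff.comp_contMDiffOn hb
    · exact hv
    · exact hw
  have h2 : ContMDiffOn (𝓡 4) 𝓘(ℝ) ∞ (fun y => g.val (b y) (v y) (w y)) s := fun y hy =>
    (Bundle.contMDiffWithinAt_totalSpace.1 (h1 y hy)).2
  exact h2.contDiffOn

theorem smooth_comp (g : LorentzMetric M) (he : e ∈ IsManifold.maximalAtlas (𝓡 4) ∞ M) :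
    SmoothMatrixOn (g.comp e) e.target := fun i j =>
  contDiffOn_metric_apply g (contMDiffOn_symm_of_mem_maximalAtlas he)
    (contMDiffOn_coordVec he i) (contMDiffOn_coordVec he j)

theorem smooth_lowerComp (g : LorentzMetric M) {u : (x : M) → TangentSpace (𝓡 4) x}
    (hu : ContMDiff (𝓡 4) (𝓡 4).tangent ∞ (fun x => (⟨x, u x⟩ : TangentBundle (𝓡 4) M)))
    (he : e ∈ IsManifold.maximalAtlas (𝓡 4) ∞ M) (i : Fin 4) :
    ContDiffOn ℝ ∞ (g.lowerComp u e i) e.target :=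
  contDiffOn_metric_apply g (contMDiffOn_symm_of_mem_maximalAtlas he)
    (hu.comp_contMDiffOn (contMDiffOn_symm_of_mem_maximalAtlas he)) (contMDiffOn_coordVec he i)

omit [IsManifold (𝓡 4) ∞ M] in
/-- The coordinate vectors span the tangent space. -/
theorem exists_eq_sum_coordVec (he : e ∈ IsManifold.maximalAtlas (𝓡 4) ∞ M) {y : E4}
    (hy : y ∈ e.target) (v : TangentSpace (𝓡 4) (e.symm y)) :
    ∃ c : Fin 4 → ℝ, v = ∑ i, c i • coordVec e i y := by
  obtain ⟨w, hw⟩ := (mdifferentiable_of_mem_maximalAtlas he).symm.mfderiv_surjective hy v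
  let w' : E4 := w
  refine ⟨fun i => w' i, ?_⟩
  have h1 : w' = ∑ c, w' c • EuclideanSpace.single c (1 : ℝ) := by
    ext i
    simp [Finset.sum_apply, Pi.single_apply]
  have h2 : w = (∑ c, w' c • (EuclideanSpace.single c (1 : ℝ) : E4) : E4) := h1
  rw [← hw, h2]
  let L : E4 →L[ℝ] TangentSpace (𝓡 4) (e.symm y) := mfderiv (𝓡 4) (𝓡 4) e.symm y
  have h3 : L (∑ c, w' c • (EuclideanSpace.single c (1 : ℝ) : E4))
      = ∑ c, w' c • L (EuclideanSpace.single c (1 : ℝ)) := by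
    rw [map_sum]
    simp only [map_smul]
  exact h3

/-- The velocity is completed to an orthonormal family of the tangent space, and `f` collects its
coefficients in the coordinate vectors. The existence of such a frame also shows that the matrix of
components is nonsingular. -/
theorem exists_isFrame (g : LorentzMetric M) {u : (x : M) → TangentSpace (𝓡 4) x}
    (hu : ∀ x, g.val x (u x) (u x) = -1) (he : e ∈ IsManifold.maximalAtlas (𝓡 4) ∞ M) {y : E4}
    (hy : y ∈ e.target) :
    ∃ f, IsFrame f (g.comp e y) (fun a => g.lowerComp u e a y) := by
  obtain ⟨b, hb⟩ := g.lorentzian (e.symm y)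
  obtain ⟨v, hv, hv0⟩ := exists_orthonormal_of_timelike
    (fun x z => g.val (e.symm y) x z) (fun x z w => by simp) (fun r x z => by simp)
    (g.symm (e.symm y)) hb (hu (e.symm y))
  choose c hc using fun i => exists_eq_sum_coordVec he hy (v i)
  have hlin : ∀ i (w : TangentSpace (𝓡 4) (e.symm y)),
      g.val (e.symm y) (v i) w = ∑ a, c i a * g.val (e.symm y) (coordVec e a y) w := by
    intro i w
    conv_lhs => rw [hc i]
    simp
  refine ⟨c, ⟨fun i j => ?_, fun b => ?_⟩⟩
  · have h1 : ∀ a, g.val (e.symm y) (coordVec e a y) (v j)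
        = ∑ b, c j b * g.comp e y a b := by
      intro a
      rw [g.symm, hlin]
      exact Finset.sum_congr rfl fun b _ => by rw [g.symm]; rfl
    rw [← hv i j, hlin]
    simp only [h1]
    rfl
  · change _ = g.val (e.symm y) (u (e.symm y)) (coordVec e b y)
    rw [← hv0, hlin]
    rfl

theorem isMetricOn_comp (g : LorentzMetric M) {u : (x : M) → TangentSpace (𝓡 4) x}
    (hu : ∀ x, g.val x (u x) (u x) = -1) (he : e ∈ IsManifold.maximalAtlas (𝓡 4) ∞ M) :
    IsMetricOn (g.comp e) e.target where
  isOpen := e.open_target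
  smooth := smooth_comp g he
  symm y _ := by
    ext i j
    exact g.symm _ _ _
  det_ne_zero y hy := by
    obtain ⟨f, hf⟩ := exists_isFrame g hu he hy
    exact hf.det_ne_zero

/-! ### Change of chart -/

/-- The Jacobian matrix `∂_i φ^k`, in the entry `k i`. -/
noncomputable def jacobian (φ : E4 → E4) (y : E4) : Matrix (Fin 4) (Fin 4) ℝ :=
  Matrix.of fun k i => pd i (fun z => φ z k) y

theorem fderiv_single_eq_sum {φ : E4 → E4} {y : E4} (hφ : DifferentiableAt ℝ φ y) (i : Fin 4) :
    fderiv ℝ φ y (EuclideanSpace.single i 1)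
      = ∑ k, jacobian φ y k i • EuclideanSpace.single k (1 : ℝ) := by
  ext j
  have h1 : fderiv ℝ (fun z => φ z j) y
      = (EuclideanSpace.proj (𝕜 := ℝ) j : E4 →L[ℝ] ℝ).comp (fderiv ℝ φ y) :=
    ((EuclideanSpace.proj (𝕜 := ℝ) j : E4 →L[ℝ] ℝ).hasFDerivAt.comp y hφ.hasFDerivAt).fderiv
  simp [jacobian, pd, h1, Finset.sum_apply, Pi.single_apply]

/-- The coordinate vector `∂ᵢ` as an element of the model space. -/
noncomputable def chartVec (e : OpenPartialHomeomorph M E4) (i : Fin 4) (y : E4) : E4 :=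
  coordVec e i y

/-- The metric at a point as a bilinear form on the model space. -/
noncomputable def LorentzMetric.form (g : LorentzMetric M) (x : M) : E4 →L[ℝ] E4 →L[ℝ] ℝ :=
  g.val x

omit [IsManifold (𝓡 4) ∞ M] in
theorem chartVec_eq_sum (he : e ∈ IsManifold.maximalAtlas (𝓡 4) ∞ M)
    (he' : e' ∈ IsManifold.maximalAtlas (𝓡 4) ∞ M) {y : E4} (hy : y ∈ e.target)
    (hy' : e.symm y ∈ e'.source) (i : Fin 4) :
    chartVec e i y = ∑ k, jacobian (fun z => e' (e.symm z)) y k i •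
      chartVec e' k (e' (e.symm y)) := by
  have ho : IsOpen (e.target ∩ e.symm ⁻¹' e'.source) :=
    e.symm.isOpen_inter_preimage e'.open_source
  have hd : DifferentiableAt ℝ (fun z => e' (e.symm z)) y :=
    ((contDiffOn_transition he he').contDiffAt (ho.mem_nhds ⟨hy, hy'⟩)).differentiableAt (by simp)
  have hev : (fun z => e'.symm (e' (e.symm z))) =ᶠ[nhds y] e.symm := by
    filter_upwards [ho.mem_nhds ⟨hy, hy'⟩] with z hz
    exact e'.left_inv hz.2
  have h1 : mfderiv (𝓡 4) (𝓡 4) (fun z => e'.symm (e' (e.symm z))) y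
      = (mfderiv (𝓡 4) (𝓡 4) e'.symm (e' (e.symm y))).comp
        (mfderiv (𝓡 4) (𝓡 4) (fun z => e' (e.symm z)) y) :=
    mfderiv_comp y ((mdifferentiable_of_mem_maximalAtlas he').mdifferentiableAt_symm
      (e'.map_source hy')) hd.mdifferentiableAt
  have h4 : mfderiv (𝓡 4) (𝓡 4) (fun z => e' (e.symm z)) y
      = fderiv ℝ (fun z => e' (e.symm z)) y := mfderiv_eq_fderiv
  -- The two derivatives take values in tangent spaces at base points that are only propositionally
  -- equal. Naming them as maps of `E4` removes this dependence.
  obtain ⟨L, hL⟩ : ∃ L : E4 →L[ℝ] E4, L = mfderiv (𝓡 4) (𝓡 4) e.symm y := ⟨_, rfl⟩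
  obtain ⟨L', hL'⟩ : ∃ L' : E4 →L[ℝ] E4,
    L' = mfderiv (𝓡 4) (𝓡 4) e'.symm (e' (e.symm y)) := ⟨_, rfl⟩
  have h2 : L = L'.comp (fderiv ℝ (fun z => e' (e.symm z)) y) := by
    rw [hL, hL', ← h4]
    exact (hev.mfderiv_eq (I := 𝓡 4) (I' := 𝓡 4)).symm.trans h1
  have h3 : ∀ k, chartVec e' k (e' (e.symm y)) = L' (EuclideanSpace.single k 1) := by
    intro k
    rw [hL']
    rfl
  have h5 : chartVec e i y = L (EuclideanSpace.single i 1) := by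
    rw [hL]
    rfl
  simp only [h3]
  rw [h5, h2, ContinuousLinearMap.comp_apply, fderiv_single_eq_sum hd, map_sum]
  simp only [map_smul]

theorem comp_change_chart (g : LorentzMetric M) (he : e ∈ IsManifold.maximalAtlas (𝓡 4) ∞ M)
    (he' : e' ∈ IsManifold.maximalAtlas (𝓡 4) ∞ M) {y : E4} (hy : y ∈ e.target)
    (hy' : e.symm y ∈ e'.source) :
    g.comp e y = (jacobian (fun z => e' (e.symm z)) y)ᵀ * g.comp e' (e' (e.symm y))
      * jacobian (fun z => e' (e.symm z)) y := by
  have hB : g.form (e'.symm (e' (e.symm y))) = g.form (e.symm y) := by rw [e'.left_inv hy']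
  have hc : ∀ k l, g.comp e' (e' (e.symm y)) k l
      = g.form (e.symm y) (chartVec e' k (e' (e.symm y))) (chartVec e' l (e' (e.symm y))) := by
    intro k l
    rw [← hB]
    rfl
  ext i j
  have h1 : g.comp e y i j = g.form (e.symm y) (chartVec e i y) (chartVec e j y) := rfl
  rw [h1, chartVec_eq_sum he he' hy hy' i, chartVec_eq_sum he he' hy hy' j]
  simp only [map_sum, map_smul, _root_.sum_apply, _root_.smul_apply,
    smul_eq_mul, Matrix.mul_apply, Matrix.transpose_apply, Finset.sum_mul, hc]
  refine Finset.sum_congr rfl fun k _ => ?_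
  rw [Finset.mul_sum]
  exact Finset.sum_congr rfl fun l _ => by ring

end Manifold


open Set Matrix Metric

/-! ### Coordinates from functions with invertible Jacobian matrix -/

theorem fderiv_eq_toLin_jacobian {Φ : E4 → E4} {y : E4} (hΦ : DifferentiableAt ℝ Φ y) (v : E4)
    (k : Fin 4) : fderiv ℝ Φ y v k = (jacobian Φ y *ᵥ fun i => v i) k := by
  have h1 : fderiv ℝ (fun z => Φ z k) y
      = (EuclideanSpace.proj (𝕜 := ℝ) k : E4 →L[ℝ] ℝ).comp (fderiv ℝ Φ y) :=
    ((EuclideanSpace.proj (𝕜 := ℝ) k : E4 →L[ℝ] ℝ).hasFDerivAt.comp y hΦ.hasFDerivAt).fderiv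
  have h2 : fderiv ℝ Φ y v k = fderiv ℝ (fun z => Φ z k) y v := by
    rw [h1]
    rfl
  rw [h2, fderiv_eq_sum_pd]
  simp only [mulVec, dotProduct, jacobian, Matrix.of_apply]
  exact Finset.sum_congr rfl fun i _ => mul_comm _ _

theorem exists_hasFDerivAt_equiv {Φ : E4 → E4} {y : E4} (hΦ : DifferentiableAt ℝ Φ y)
    (hdet : (jacobian Φ y).det ≠ 0) : ∃ L : E4 ≃L[ℝ] E4, HasFDerivAt Φ (L : E4 →L[ℝ] E4) y := by
  have hinj : Function.Injective (fderiv ℝ Φ y : E4 →ₗ[ℝ] E4) := by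
    rw [← LinearMap.ker_eq_bot, LinearMap.ker_eq_bot']
    intro v hv
    have h1 : (jacobian Φ y *ᵥ fun i => v i) = 0 := by
      funext k
      rw [← fderiv_eq_toLin_jacobian hΦ]
      have hv' : fderiv ℝ Φ y v = 0 := hv
      rw [hv']
      rfl
    ext i
    exact congrFun (Matrix.eq_zero_of_mulVec_eq_zero hdet h1) i
  refine ⟨(LinearEquiv.ofInjectiveEndo _ hinj).toContinuousLinearEquiv, ?_⟩
  convert hΦ.hasFDerivAt using 1
  ext v : 1
  rfl

/-- The inverse function theorem, with a ball as the target. -/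
theorem exists_openPartialHomeomorph {Φ : E4 → E4} {y₀ : E4} {ρ : ℝ} (hρ : 0 < ρ)
    (hΦ : ContDiffOn ℝ ∞ Φ (ball y₀ ρ)) (hdet : ∀ y ∈ ball y₀ ρ, (jacobian Φ y).det ≠ 0) :
    ∃ Ψ : OpenPartialHomeomorph E4 E4, y₀ ∈ Ψ.source ∧ Ψ.source ⊆ ball y₀ ρ ∧ ⇑Ψ = Φ ∧
      (∃ r > 0, Ψ.target = ball (Φ y₀) r) ∧ ContDiffOn ℝ ∞ Ψ.symm Ψ.target := by
  have hy₀ := mem_ball_self (x := y₀) hρ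
  have hcd : ∀ y ∈ ball y₀ ρ, ContDiffAt ℝ ∞ Φ y := fun y hy =>
    hΦ.contDiffAt (isOpen_ball.mem_nhds hy)
  have hL := fun y (hy : y ∈ ball y₀ ρ) =>
    exists_hasFDerivAt_equiv ((hcd y hy).differentiableAt (by simp)) (hdet y hy)
  obtain ⟨L, hL0⟩ := hL y₀ hy₀
  set Ψ₀ := (hcd y₀ hy₀).toOpenPartialHomeomorph Φ hL0 (by simp) with hΨ₀
  have hc₀ : ⇑Ψ₀ = Φ := rfl
  set Ψ₁ := Ψ₀.restrOpen (ball y₀ ρ) isOpen_ball with hΨ₁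
  have hy₁ : y₀ ∈ Ψ₁.source :=
    ⟨ContDiffAt.mem_toOpenPartialHomeomorph_source (hcd y₀ hy₀) hL0 (by simp), hy₀⟩
  have hc₁ : ⇑Ψ₁ = Φ := rfl
  have ht₁ : Φ y₀ ∈ Ψ₁.target := Ψ₁.map_source hy₁
  obtain ⟨r, hr, hrs⟩ := Metric.isOpen_iff.1 Ψ₁.open_target _ ht₁
  -- A ball as target is convex. This will show that a function with vanishing spatial derivatives
  -- depends only on the time coordinate.
  set Ψ := (Ψ₁.symm.restrOpen (ball (Φ y₀) r) isOpen_ball).symm with hΨ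
  have hc : ⇑Ψ = Φ := rfl
  have htar : Ψ.target = ball (Φ y₀) r := inter_eq_right.2 hrs
  have hsrc : Ψ.source ⊆ ball y₀ ρ := by
    intro z hz
    have h1 : Ψ.symm (Ψ z) = z := Ψ.left_inv hz
    have h2 : Ψ z ∈ Ψ₁.target := hrs (htar ▸ Ψ.map_source hz)
    rw [← h1]
    exact (Ψ₁.map_target h2).2
  have hmem : y₀ ∈ Ψ.source := by
    have h1 : Φ y₀ ∈ Ψ.target := htar ▸ mem_ball_self hr
    have h2 := Ψ.map_target h1
    have h3 : Ψ.symm (Φ y₀) = y₀ := Ψ₁.left_inv hy₁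
    rwa [h3] at h2
  refine ⟨Ψ, hmem, hsrc, hc, ⟨r, hr, htar⟩, fun z hz => ?_⟩
  have hz' := hsrc (Ψ.map_target hz)
  obtain ⟨L', hL'⟩ := hL _ hz'
  exact (Ψ.contDiffAt_symm hz hL' (hcd _ hz')).contDiffWithinAt

section Manifold

variable {M : Type*} [TopologicalSpace M] [ChartedSpace E4 M] {e : OpenPartialHomeomorph M E4}

theorem trans_mem_maximalAtlas (he : e ∈ IsManifold.maximalAtlas (𝓡 4) ∞ M)
    {Ψ : OpenPartialHomeomorph E4 E4} (h1 : ContDiffOn ℝ ∞ Ψ Ψ.source)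
    (h2 : ContDiffOn ℝ ∞ Ψ.symm Ψ.target) :
    e.trans Ψ ∈ IsManifold.maximalAtlas (𝓡 4) ∞ M := by
  have hΨ : Ψ ∈ contDiffGroupoid ∞ (𝓡 4) := by
    rw [contDiffGroupoid, mem_groupoid_of_pregroupoid]
    simp only [contDiffPregroupoid, modelWithCornersSelf_coe, modelWithCornersSelf_coe_symm,
      Function.id_comp, Function.comp_id, preimage_id, range_id, inter_univ]
    exact ⟨h1, h2⟩
  rw [IsManifold.mem_maximalAtlas_iff] at he ⊢
  rw [mem_maximalAtlas_iff] at he ⊢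
  intro c hc
  obtain ⟨h3, h4⟩ := he c hc
  constructor
  · rw [OpenPartialHomeomorph.trans_symm_eq_symm_trans_symm, OpenPartialHomeomorph.trans_assoc]
    exact (contDiffGroupoid ∞ (𝓡 4)).trans ((contDiffGroupoid ∞ (𝓡 4)).symm hΨ) h3
  · rw [← OpenPartialHomeomorph.trans_assoc]
    exact (contDiffGroupoid ∞ (𝓡 4)).trans h4 hΨ

end Manifold

/-- A function on a ball whose partial derivatives `∂ᵢ`, `i ≠ 0`, vanish depends only on the
coordinate `0`. -/
theorem eq_of_pd_spatial_eq_zero {a : E4 → ℝ} {c : E4} {r : ℝ}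
    (ha : ∀ y ∈ ball c r, DifferentiableAt ℝ a y)
    (h0 : ∀ y ∈ ball c r, ∀ i, i ≠ 0 → pd i a y = 0) {y z : E4} (hy : y ∈ ball c r)
    (hz : z ∈ ball c r) (hyz : y 0 = z 0) : a y = a z := by
  have hseg : ∀ t ∈ Icc (0 : ℝ) 1, z + t • (y - z) ∈ ball c r := fun t ht =>
    (convex_ball c r).add_smul_sub_mem hz hy ht
  have hd : ∀ t ∈ Icc (0 : ℝ) 1, HasDerivAt (fun t : ℝ => a (z + t • (y - z))) 0 t := by
    intro t ht
    have h1 : HasDerivAt (fun t : ℝ => z + t • (y - z)) (y - z) t := by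
      simpa using ((hasDerivAt_id t).smul_const (y - z)).const_add z
    have h2 := (ha _ (hseg t ht)).hasFDerivAt.comp_hasDerivAt t h1
    have h3 : fderiv ℝ a (z + t • (y - z)) (y - z) = 0 := by
      rw [fderiv_eq_sum_pd]
      refine Finset.sum_eq_zero fun i _ => ?_
      by_cases hi : i = 0
      · simp [hi, hyz]
      · rw [h0 _ (hseg t ht) i hi, mul_zero]
    rwa [h3] at h2
  have key := constant_of_has_deriv_right_zero (f := fun t : ℝ => a (z + t • (y - z)))
    (a := 0) (b := 1) (fun t ht => (hd t ht).continuousAt.continuousWithinAt)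
    (fun t ht => (hd t ⟨ht.1, ht.2.le⟩).hasDerivWithinAt) 1 (by simp)
  simpa using key

theorem rwMatrix_inv {k : ℝ} {A : ℝ → ℝ} {y : E4} (hA : 0 < A (y 0))
    (hk : 0 < 1 + k / 4 * ((y 1) ^ 2 + (y 2) ^ 2 + (y 3) ^ 2)) :
    (rwMatrix k A y)⁻¹ = Matrix.diagonal fun i => if i = 0 then -1 else
      (1 + k / 4 * ((y 1) ^ 2 + (y 2) ^ 2 + (y 3) ^ 2)) ^ 2 / (A (y 0)) ^ 2 := by
  refine Matrix.inv_eq_right_inv ?_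
  rw [rwMatrix, Matrix.diagonal_mul_diagonal, ← Matrix.diagonal_one]
  congr 1
  funext i
  split_ifs
  · norm_num
  · rw [div_mul_div_comm, mul_comm, div_self (by positivity)]

/-! ### From Robertson-Walker functions to a chart -/

section RWChart

variable {M : Type*} [TopologicalSpace M] [ChartedSpace E4 M] [IsManifold (𝓡 4) ∞ M]
  {e : OpenPartialHomeomorph M E4}

/-- Orthogonality of the differentials says that J G⁻¹ Jᵀ is an invertible diagonal matrix. So J is
invertible and Φ is a local coordinate system, in which the inverse metric is that diagonal matrix
and the metric is `rwMatrix`. The scale factor depends on t alone because dA is a multiple of dt. -/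
theorem IsRWFunctions.exists_chart {g : LorentzMetric M}
    (he : e ∈ IsManifold.maximalAtlas (𝓡 4) ∞ M) {x : M} (hx : x ∈ e.source)
    {u : Fin 4 → E4 → ℝ} {F h : E4 → ℝ} {k ρ : ℝ} {φ : Fin 4 → E4 → ℝ} {A : E4 → ℝ}
    (hρ : 0 < ρ) (hsub : ball (e x) ρ ⊆ e.target)
    (hrw : IsRWFunctions (g.comp e) u F h k (e x) ρ φ A) :
    ∃ e' ∈ IsManifold.maximalAtlas (𝓡 4) ∞ M, x ∈ e'.source ∧
      ∃ A : ℝ → ℝ, ∀ y ∈ e'.target,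
        0 < A (y 0) ∧ ContDiffAt ℝ ∞ A (y 0) ∧
        0 < 1 + k / 4 * ((y 1) ^ 2 + (y 2) ^ 2 + (y 3) ^ 2) ∧
        g.comp e' y = rwMatrix k A y := by
  set Φ : E4 → E4 := fun y => WithLp.toLp 2 fun i => φ i y with hΦ
  have hΦs : ContDiffOn ℝ ∞ Φ (ball (e x) ρ) := by
    rw [contDiffOn_euclidean]
    exact hrw.smooth
  have horth : ∀ y ∈ ball (e x) ρ, jacobian Φ y * (g.comp e y)⁻¹ * (jacobian Φ y)ᵀ
      = Matrix.diagonal fun i => if i = 0 then -1 else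
        (1 + k / 4 * (φ 1 y ^ 2 + φ 2 y ^ 2 + φ 3 y ^ 2)) ^ 2 / A y ^ 2 := by
    intro y hy
    ext i j
    rw [Matrix.diagonal_apply, ← hrw.orthogonal y hy i j, Matrix.mul_assoc]
    simp only [ip, Matrix.mul_apply, dotProduct, Matrix.mulVec, Matrix.transpose_apply]
    rfl
  have hdet : ∀ y ∈ ball (e x) ρ, (jacobian Φ y).det ≠ 0 := by
    intro y hy h0
    have h1 := congrArg Matrix.det (horth y hy)
    rw [Matrix.det_mul, Matrix.det_mul, h0, zero_mul, zero_mul, Matrix.det_diagonal] at h1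
    refine Finset.prod_ne_zero_iff.2 (fun i _ => ?_) h1.symm
    have := hrw.conformal_pos y hy
    have := hrw.scale_pos y hy
    split_ifs
    · norm_num
    · positivity
  obtain ⟨Ψ, hxΨ, hsrc, hΨΦ, ⟨r, hr, htar⟩, hsymm⟩ := exists_openPartialHomeomorph hρ hΦs hdet
  have hmax := trans_mem_maximalAtlas he (Ψ := Ψ) (by rw [hΨΦ]; exact hΦs.mono hsrc) hsymm
  have hinv : ∀ y' ∈ Ψ.target, Φ (Ψ.symm y') = y' := fun y' hy' => by
    rw [← hΨΦ]
    exact Ψ.right_inv hy'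
  have hmemB : ∀ y' ∈ Ψ.target, Ψ.symm y' ∈ ball (e x) ρ := fun y' hy' =>
    hsrc (Ψ.map_target hy')
  set c := Φ (e x) with hc
  set a : E4 → ℝ := fun y' => A (Ψ.symm y') with ha
  have has : ContDiffOn ℝ ∞ a Ψ.target := hrw.smooth_scale.comp hsymm hmemB
  have hda : ∀ y' ∈ Ψ.target, DifferentiableAt ℝ a y' := fun y' hy' =>
    differentiableAt_of_contDiffOn Ψ.open_target has hy'
  have hpa : ∀ y' ∈ Ψ.target, ∀ i, i ≠ 0 → pd i a y' = 0 := by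
    intro y' hy'
    set y := Ψ.symm y' with hy
    have hyB := hmemB y' hy'
    have hyy' : Φ y = y' := hinv y' hy'
    have hdΦ : DifferentiableAt ℝ Φ y :=
      (hΦs.contDiffAt (isOpen_ball.mem_nhds hyB)).differentiableAt (by simp)
    have h1 : ∀ j, pd j A y = ∑ i, jacobian Φ y i j * pd i a y' := by
      intro j
      have h2 : A =ᶠ[nhds y] fun z => a (Φ z) := by
        filter_upwards [Ψ.open_source.mem_nhds (Ψ.map_target hy')] with z hz
        rw [ha, ← hΨΦ]
        dsimp only
        rw [Ψ.left_inv hz]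
      have h3 : HasFDerivAt (fun z => a (Φ z)) ((fderiv ℝ a y').comp (fderiv ℝ Φ y)) y := by
        have h4 : HasFDerivAt a (fderiv ℝ a y') (Φ y) := by
          rw [hyy']
          exact (hda y' hy').hasFDerivAt
        exact HasFDerivAt.comp (g := a) (f := Φ) y h4 hdΦ.hasFDerivAt
      rw [pd, h2.fderiv_eq, h3.fderiv, ContinuousLinearMap.comp_apply, fderiv_single_eq_sum hdΦ,
        map_sum]
      simp only [map_smul, smul_eq_mul]
      rfl
    -- In the new coordinates dA = A H dt reads Jᵀ(∂a - A H e₀) = 0, and Jᵀ is injective.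
    have h4 : ((jacobian Φ y)ᵀ *ᵥ fun i => pd i a y' -
        if i = 0 then A y * expansion (g.comp e) u F h y else 0) = 0 := by
      funext j
      have h5 := hrw.pd_scale y hyB j
      rw [h1 j] at h5
      simp only [Matrix.mulVec, dotProduct, Matrix.transpose_apply, mul_sub,
        Finset.sum_sub_distrib, h5]
      simp only [mul_ite, mul_zero, Finset.sum_ite_eq', Finset.mem_univ, if_true, Pi.zero_apply]
      rw [sub_eq_zero, mul_comm]
      rfl
    intro i hi
    have h6 := congrFun (Matrix.eq_zero_of_mulVec_eq_zero
      (by rw [Matrix.det_transpose]; exact hdet y hyB) h4) i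
    simpa [hi] using h6
  -- The scale factor as a function of one variable is `a` on the line through the centre in the
  -- time direction. Its point at time `y' 0` is at most as far from the centre as `y'`, so it stays
  -- in the ball.
  set line : ℝ → E4 := fun s => c + (s - c 0) • EuclideanSpace.single (0 : Fin 4) (1 : ℝ)
    with hline
  have hline0 : ∀ s, line s 0 = s := by
    intro s
    simp [hline]
  have hlineB : ∀ y' ∈ Ψ.target, line (y' 0) ∈ Ψ.target := by
    intro y' hy'
    rw [htar, mem_ball, dist_eq_norm] at hy' ⊢
    refine lt_of_le_of_lt ?_ hy'
    have h1 : line (y' 0) - c = (y' 0 - c 0) • EuclideanSpace.single (0 : Fin 4) (1 : ℝ) := by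
      simp [hline]
    rw [h1, norm_smul]
    simpa using PiLp.norm_apply_le (p := 2) (y' - c) 0
  have hAline : ∀ y' ∈ Ψ.target, a (line (y' 0)) = a y' := by
    intro y' hy'
    have h1 := hy'
    have h2 := hlineB y' hy'
    rw [htar] at h1 h2
    rw [htar] at hda hpa
    exact eq_of_pd_spatial_eq_zero hda hpa h2 h1 (hline0 _)
  refine ⟨e.trans Ψ, hmax, ⟨hx, hxΨ⟩, fun s => a (line s), fun y' hy' => ?_⟩
  have hyt : y' ∈ Ψ.target := hy'.1
  have hyB := hmemB y' hyt
  have hcoord : ∀ i, φ i (Ψ.symm y') = y' i := fun i => congrArg (fun z : E4 => z i) (hinv y' hyt)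
  have hpos : 0 < a (line (y' 0)) := by
    rw [hAline y' hyt]
    exact hrw.scale_pos _ hyB
  have hconf : 0 < 1 + k / 4 * ((y' 1) ^ 2 + (y' 2) ^ 2 + (y' 3) ^ 2) := by
    have h1 := hrw.conformal_pos _ hyB
    rwa [hcoord, hcoord, hcoord] at h1
  refine ⟨hpos, ?_, hconf, ?_⟩
  · have h1 : ContDiffAt ℝ ∞ a (line (y' 0)) :=
      has.contDiffAt (Ψ.open_target.mem_nhds (hlineB y' hyt))
    have h2 : ContDiff ℝ ∞ line := by
      rw [hline]
      fun_prop
    exact h1.comp (y' 0) h2.contDiffAt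
  · set y := Ψ.symm y' with hy
    have hye : y ∈ e.target := hsub hyB
    have hyΨ : y ∈ Ψ.source := Ψ.map_target hyt
    have hΦy : Φ y = y' := hinv y' hyt
    have h1 := comp_change_chart g he hmax hye
      ⟨e.map_target hye, by
        change e (e.symm y) ∈ Ψ.source
        rwa [e.right_inv hye]⟩
    have h2 : jacobian (fun z => (e.trans Ψ) (e.symm z)) y = jacobian Φ y := by
      ext i j
      refine pd_congr_of_eqOn Ψ.open_source (fun z hz => ?_) hyΨ
      simp only [OpenPartialHomeomorph.coe_trans, Function.comp_apply]
      rw [e.right_inv (hsub (hsrc hz)), hΨΦ]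
    have h3 : (e.trans Ψ) (e.symm y) = y' := by
      simp only [OpenPartialHomeomorph.coe_trans, Function.comp_apply]
      rw [e.right_inv hye, hΨΦ, hΦy]
    rw [h2, h3] at h1
    have h4 := horth y hyB
    have h5 : (Matrix.diagonal fun i => if i = 0 then (-1 : ℝ) else
        (1 + k / 4 * (φ 1 y ^ 2 + φ 2 y ^ 2 + φ 3 y ^ 2)) ^ 2 / A y ^ 2)
        = (rwMatrix k (fun s => a (line s)) y')⁻¹ := by
      rw [rwMatrix_inv hpos hconf, hAline y' hyt]
      simp only [hcoord]
      rfl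
    rw [h5, h1] at h4
    have hJ : IsUnit (jacobian Φ y).det := isUnit_iff_ne_zero.2 (hdet y hyB)
    have hJt : IsUnit (jacobian Φ y)ᵀ.det := by rwa [Matrix.det_transpose]
    rw [Matrix.mul_inv_rev, Matrix.mul_inv_rev, ← Matrix.mul_assoc, Matrix.mul_nonsing_inv _ hJ,
      Matrix.one_mul, Matrix.nonsing_inv_mul_cancel_right _ _ hJt] at h4
    have hu1 : IsUnit (rwMatrix k (fun s => a (line s)) y').det := by
      rw [isUnit_iff_ne_zero, rwMatrix, Matrix.det_diagonal]
      refine Finset.prod_ne_zero_iff.2 fun i _ => ?_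
      split_ifs
      · norm_num
      · positivity
    exact Matrix.inv_inj h4.symm hu1 |>.symm

end RWChart


/-! ### Globalisation: Yang pure implies equation of state and Robertson-Walker -/

open Set Matrix Metric

section Manifold

variable {M : Type*} [TopologicalSpace M] [ChartedSpace E4 M] [IsManifold (𝓡 4) ∞ M]
  {e : OpenPartialHomeomorph M E4} {g : LorentzMetric M} {u : (x : M) → TangentSpace (𝓡 4) x}
  {μ p : M → ℝ}

/-- The trace of Einstein's equation gives R = 8π(μ - 3p). Substituting this back isolates the Ricci
tensor. -/
theorem LorentzMetric.IsPerfectFluid.ricci_eq (hf : g.IsPerfectFluid u μ p)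
    (he : e ∈ IsManifold.maximalAtlas (𝓡 4) ∞ M) {y : E4} (hy : y ∈ e.target) (a b : Fin 4) :
    ricci (g.comp e) a b y = 8 * Real.pi * (μ (e.symm y) + p (e.symm y))
        * (g.lowerComp u e a y * g.lowerComp u e b y)
      + 4 * Real.pi * (μ (e.symm y) - p (e.symm y)) * g.comp e y a b := by
  obtain ⟨f, fr⟩ := exists_isFrame g hf.unit he hy
  have h1 := fr.trace_inv fun a b => ricci (g.comp e) a b y
  have h2 : ∀ i j, hat₂ f (fun a b => ricci (g.comp e) a b y) i j
      = (1 / 2 * scalarCurv (g.comp e) y + 8 * Real.pi * p (e.symm y)) * mink i j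
        + 8 * Real.pi * (μ (e.symm y) + p (e.symm y)) * (timeComp i * timeComp j) := by
    intro i j
    have h3 : ∀ a b, ricci (g.comp e) a b y
        = (1 / 2 * scalarCurv (g.comp e) y + 8 * Real.pi * p (e.symm y)) * g.comp e y a b
          + 8 * Real.pi * (μ (e.symm y) + p (e.symm y))
            * (g.lowerComp u e a y * g.lowerComp u e b y) := by
      intro a b
      linear_combination hf.einstein e he y hy a b
    simp only [h3]
    rw [← fr.orth i j, ← fr.hat_velocity i, ← fr.hat_velocity j]
    simp only [hat₂, hat_add, hat_mul_left, hat_mul_right]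
  have h4 : scalarCurv (g.comp e) y = 8 * Real.pi * (μ (e.symm y) - 3 * p (e.symm y)) := by
    have h5 : scalarCurv (g.comp e) y = _ := h1
    simp [h2, Fin.sum_univ_four, mink, timeComp] at h5
    linear_combination -h5
  have h6 := hf.einstein e he y hy a b
  rw [h4] at h6
  linear_combination h6

theorem LorentzMetric.IsPerfectFluid.smooth_density_add (hf : g.IsPerfectFluid u μ p)
    (he : e ∈ IsManifold.maximalAtlas (𝓡 4) ∞ M) (r s t : ℝ) :
    ContDiffOn ℝ ∞ (fun y => r * (s * μ (e.symm y) + t * p (e.symm y))) e.target :=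
  contDiffOn_const.mul ((contDiffOn_const.mul (contDiffOn_comp_symm he hf.contMDiff_density)).add
    (contDiffOn_const.mul (contDiffOn_comp_symm he hf.contMDiff_pressure)))

theorem LorentzMetric.IsPerfectFluid.einsteinFluidChart (hf : g.IsPerfectFluid u μ p)
    (hμp : ∀ x, μ x + p x ≠ 0) (he : e ∈ IsManifold.maximalAtlas (𝓡 4) ∞ M) :
    EinsteinFluidChart (g.comp e) e.target (g.lowerComp u e)
      (fun y => 8 * Real.pi * (μ (e.symm y) + p (e.symm y)))
      (fun y => 4 * Real.pi * (μ (e.symm y) - p (e.symm y))) where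
  metric := isMetricOn_comp g hf.unit he
  smooth_velocity := smooth_lowerComp g hf.contMDiff_velocity he
  smooth_F := (hf.smooth_density_add he (8 * Real.pi) 1 1).congr fun y _ => by ring
  smooth_h := (hf.smooth_density_add he (4 * Real.pi) 1 (-1)).congr fun y _ => by ring
  ne_zero y _ := mul_ne_zero (mul_ne_zero (by norm_num) Real.pi_ne_zero) (hμp _)
  frame y hy := exists_isFrame g hf.unit he hy
  ricci_eq y hy a b := hf.ricci_eq he hy a b

theorem LorentzMetric.IsPerfectFluid.fluidChart (hf : g.IsPerfectFluid u μ p)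
    (hμp : ∀ x, μ x + p x ≠ 0) (hY : g.IsYangPureSpace)
    (he : e ∈ IsManifold.maximalAtlas (𝓡 4) ∞ M) :
    FluidChart (g.comp e) e.target (g.lowerComp u e)
      (fun y => 8 * Real.pi * (μ (e.symm y) + p (e.symm y)))
      (fun y => 4 * Real.pi * (μ (e.symm y) - p (e.symm y))) where
  toEinsteinFluidChart := hf.einsteinFluidChart hμp he
  codazzi y hy a b c := sub_eq_zero.1 (hY e he y hy a b c)

omit [IsManifold (𝓡 4) ∞ M] in
/-- A function which is locally constant in charts is constant. -/
theorem exists_eq_const_of_chart [ConnectedSpace M] {X : Type*} {f : M → X}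
    (hf : ∀ x, ∃ e ∈ IsManifold.maximalAtlas (𝓡 4) ∞ M, x ∈ e.source ∧ ∃ ρ > 0,
      ∀ y ∈ ball (e x) ρ, f (e.symm y) = f x) : ∃ c, ∀ x, f x = c := by
  have h1 : IsLocallyConstant f := by
    rw [IsLocallyConstant.iff_eventually_eq]
    intro x
    obtain ⟨e, -, hx, ρ, hρ, h⟩ := hf x
    filter_upwards [e.open_source.mem_nhds hx,
      (e.continuousAt hx).preimage_mem_nhds (ball_mem_nhds _ hρ)] with z hz hz'
    rw [← h _ hz', e.left_inv hz]
  obtain ⟨x₀⟩ := (inferInstance : Nonempty M)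
  exact ⟨f x₀, fun x => h1.apply_eq_of_preconnectedSpace x x₀⟩

/-- In each chart F - 4h = 24π(p - μ/3) has zero gradient, so p - μ/3 is locally constant on the
connected manifold. -/
theorem exists_eos_of_isYangPureSpace [ConnectedSpace M] (hf : g.IsPerfectFluid u μ p)
    (hμp : ∀ x, μ x + p x ≠ 0) (hY : g.IsYangPureSpace) :
    ∃ c : ℝ, ∀ x, p x = (1 / 3 : ℝ) * μ x + c := by
  obtain ⟨c, hc⟩ := exists_eq_const_of_chart (f := fun x => p x - (1 / 3 : ℝ) * μ x) (fun x => by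
    have he := IsManifold.chart_mem_maximalAtlas (I := 𝓡 4) (n := ∞) x
    set e := chartAt E4 x
    have hx : x ∈ e.source := mem_chart_source E4 x
    have hx' := e.map_source hx
    have hF := hf.fluidChart hμp hY he
    obtain ⟨ρ, hρ, hs⟩ := Metric.isOpen_iff.1 e.open_target _ hx'
    refine ⟨e, he, hx, ρ, hρ, fun y hy => ?_⟩
    have hdF := fun z hz => hF.differentiableAt_F (y := z) (hs hz)
    have hdh := fun z hz => hF.differentiableAt_h (y := z) (hs hz)
    have key := eq_of_pd_eq_zero
      (f := fun z => 8 * Real.pi * (μ (e.symm z) + p (e.symm z))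
        - 4 * (4 * Real.pi * (μ (e.symm z) - p (e.symm z))))
      (fun z hz => (hdF z hz).fun_sub ((differentiableAt_const _).fun_mul (hdh z hz)))
      (fun z hz a => by
        rw [pd_sub (hdF z hz) ((differentiableAt_const _).fun_mul (hdh z hz)),
          pd_const_mul _ (hdh z hz), hF.pd_F (hs hz), sub_self]) hy
    rw [e.left_inv hx] at key
    have hpi : 24 * Real.pi ≠ 0 := mul_ne_zero (by norm_num) Real.pi_ne_zero
    refine mul_left_cancel₀ hpi ?_
    linear_combination key)
  exact ⟨c, fun x => by linear_combination hc x⟩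

/-! ### The curvature of the rest spaces as a function on the manifold -/

/-- The derivative of a function along a vector field. -/
noncomputable def derivAlong (f : M → ℝ) (u : (x : M) → TangentSpace (𝓡 4) x) (x : M) : ℝ :=
  mfderiv (𝓡 4) 𝓘(ℝ, ℝ) f x (u x)

/-- The chart expression is a derivative that does not refer to the chart. It makes the expansion
and the curvature E of the slices functions on M, so that their values in different charts can be
compared. -/
theorem ip_lowerComp_pd (hu : ∀ x, g.val x (u x) (u x) = -1)
    (he : e ∈ IsManifold.maximalAtlas (𝓡 4) ∞ M) {f : M → ℝ}
    (hf : ContMDiff (𝓡 4) 𝓘(ℝ, ℝ) ∞ f) {y : E4} (hy : y ∈ e.target) :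
    ip (g.comp e) (fun a => g.lowerComp u e a y) (fun a => pd a (fun z => f (e.symm z)) y) y
      = derivAlong f u (e.symm y) := by
  obtain ⟨c, hc⟩ := exists_eq_sum_coordVec he hy (u (e.symm y))
  have hG := isMetricOn_comp g hu he
  have h1 : ∀ b, g.lowerComp u e b y = ∑ a, c a * g.comp e y a b := by
    intro b
    change g.val (e.symm y) (u (e.symm y)) (coordVec e b y) = _
    rw [hc]
    simp
    rfl
  have h2 : ∀ a, pd a (fun z => f (e.symm z)) y
      = mfderiv (𝓡 4) 𝓘(ℝ, ℝ) f (e.symm y) (coordVec e a y) := by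
    intro a
    have h3 : mfderiv (𝓡 4) 𝓘(ℝ, ℝ) (fun z => f (e.symm z)) y
        = (mfderiv (𝓡 4) 𝓘(ℝ, ℝ) f (e.symm y)).comp (mfderiv (𝓡 4) (𝓡 4) e.symm y) :=
      mfderiv_comp y (hf.mdifferentiableAt (by simp))
        ((mdifferentiable_of_mem_maximalAtlas he).mdifferentiableAt_symm hy)
    have h4 : mfderiv (𝓡 4) 𝓘(ℝ, ℝ) (fun z => f (e.symm z)) y
        = fderiv ℝ (fun z => f (e.symm z)) y := mfderiv_eq_fderiv
    rw [pd, ← h4, h3]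
    rfl
  have h5 : (fun b => g.lowerComp u e b y) = c ᵥ* g.comp e y := funext h1
  have h6 : derivAlong f u (e.symm y) = ∑ a, c a * pd a (fun z => f (e.symm z)) y := by
    rw [derivAlong, hc]
    simp only [h2]
    obtain ⟨L, hL⟩ : ∃ L : TangentSpace (𝓡 4) (e.symm y) →L[ℝ] ℝ,
      L = mfderiv (𝓡 4) 𝓘(ℝ, ℝ) f (e.symm y) := ⟨_, rfl⟩
    have h7 : L (∑ i, c i • coordVec e i y) = ∑ i, c i * L (coordVec e i y) := by simp
    rw [hL] at h7
    exact h7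
  rw [h5, h6, ip, ← Matrix.dotProduct_mulVec, Matrix.mulVec_mulVec, hG.mul_inv hy,
    Matrix.one_mulVec]
  rfl

/-- The local construction gives an index k with E A² = k and A > 0, so k is the sign of E. Since E
is a function on M and its sign is locally constant, a single k works on the connected manifold. -/
theorem isRobertsonWalker_of_isYangPureSpace [ConnectedSpace M] (hf : g.IsPerfectFluid u μ p)
    (hμp : ∀ x, μ x + p x ≠ 0) (hY : g.IsYangPureSpace) : g.IsRobertsonWalker := by
  set F : M → ℝ := fun x => 8 * Real.pi * (μ x + p x) with hF
  set h : M → ℝ := fun x => 4 * Real.pi * (μ x - p x) with hh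
  set E : M → ℝ := fun x => (F x + 2 * h x) / 6 - (-(derivAlong h u x) / F x) ^ 2 with hE
  have hhs : ContMDiff (𝓡 4) 𝓘(ℝ, ℝ) ∞ h :=
    contMDiff_const.mul (hf.contMDiff_density.sub hf.contMDiff_pressure)
  have key : ∀ x, ∃ e ∈ IsManifold.maximalAtlas (𝓡 4) ∞ M, x ∈ e.source ∧ ∃ ρ > 0,
      ∃ k : ℝ, (k = -1 ∨ k = 0 ∨ k = 1) ∧ (∀ y ∈ ball (e x) ρ, Real.sign (E (e.symm y)) = k) ∧
      ∃ e' ∈ IsManifold.maximalAtlas (𝓡 4) ∞ M, x ∈ e'.source ∧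
      ∃ A : ℝ → ℝ, ∀ y ∈ e'.target,
        0 < A (y 0) ∧ ContDiffAt ℝ ∞ A (y 0) ∧
        0 < 1 + k / 4 * ((y 1) ^ 2 + (y 2) ^ 2 + (y 3) ^ 2) ∧
        g.comp e' y = rwMatrix k A y := by
    intro x
    have he := IsManifold.chart_mem_maximalAtlas (I := 𝓡 4) (n := ∞) x
    set e := chartAt E4 x
    have hx : x ∈ e.source := mem_chart_source E4 x
    have hC := hf.fluidChart hμp hY he
    obtain ⟨ρ, hρ, hsub, k, φ, A, hk, hrw⟩ := hC.exists_rwFunctions (e.map_source hx)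
    refine ⟨e, he, hx, ρ, hρ, k, hk, fun y hy => ?_, hrw.exists_chart he hx hρ hsub⟩
    have h1 := hrw.curvature y hy
    have h2 := hrw.scale_pos y hy
    have h3 : spaceCurvature (g.comp e) (g.lowerComp u e)
        (fun y => 8 * Real.pi * (μ (e.symm y) + p (e.symm y)))
        (fun y => 4 * Real.pi * (μ (e.symm y) - p (e.symm y))) y = E (e.symm y) := by
      rw [spaceCurvature, expansion, ip_lowerComp_pd hf.unit he hhs (hsub hy)]
    rw [h3] at h1
    have h4 : 0 < A y ^ 2 := by positivity
    rcases lt_trichotomy (E (e.symm y)) 0 with h0 | h0 | h0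
    · rw [Real.sign_of_neg h0]
      have : k < 0 := h1 ▸ mul_neg_of_neg_of_pos h0 h4
      rcases hk with rfl | rfl | rfl
      · rfl
      · exact absurd this (lt_irrefl _)
      · exact absurd this (by norm_num)
    · rw [h0, Real.sign_zero, ← h1, h0, zero_mul]
    · rw [Real.sign_of_pos h0]
      have : 0 < k := h1 ▸ mul_pos h0 h4
      rcases hk with rfl | rfl | rfl
      · exact absurd this (by norm_num)
      · exact absurd this (lt_irrefl _)
      · rfl
  obtain ⟨k, hk⟩ := exists_eq_const_of_chart (f := fun x => Real.sign (E x)) (fun x => by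
    obtain ⟨e, he, hx, ρ, hρ, k, -, hs, -⟩ := key x
    refine ⟨e, he, hx, ρ, hρ, fun y hy => ?_⟩
    rw [hs y hy, ← hs (e x) (mem_ball_self hρ), e.left_inv hx])
  have hkx : ∀ x, ∀ e : OpenPartialHomeomorph M E4, x ∈ e.source → ∀ ρ > 0, ∀ k' : ℝ,
      (∀ y ∈ ball (e x) ρ, Real.sign (E (e.symm y)) = k') → k' = k := by
    intro x e hx ρ hρ k' hs
    rw [← hk x, ← hs (e x) (mem_ball_self hρ), e.left_inv hx]
  obtain ⟨x₀⟩ := (inferInstance : Nonempty M)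
  refine ⟨k, ?_, fun x => ?_⟩
  · obtain ⟨e, he, hx, ρ, hρ, k', hk', hs, -⟩ := key x₀
    rwa [← hkx x₀ e hx ρ hρ k' hs]
  · obtain ⟨e, he, hx, ρ, hρ, k', hk', hs, hrw⟩ := key x
    rwa [← hkx x e hx ρ hρ k' hs]

end Manifold


open Set Matrix Metric

/-! ### Fluids with a concircular time direction satisfy the Codazzi equation -/

section Contraction

variable {G : E4 → Matrix (Fin 4) (Fin 4) ℝ} {U : Set E4} {y : E4}

theorem sum_inv_mul (v w : Fin 4 → ℝ) :
    ∑ a, ∑ b, (G y)⁻¹ a b * (v a * w b) = ip G v w y := by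
  simp only [ip, dotProduct, Matrix.mulVec, Finset.mul_sum]
  exact Finset.sum_congr rfl fun a _ => Finset.sum_congr rfl fun b _ => by ring

theorem IsMetricOn.sum_inv_mul_metric (h : IsMetricOn G U) (hy : y ∈ U) :
    ∑ a, ∑ b, (G y)⁻¹ a b * G y a b = 4 := by
  have h1 : ((G y)⁻¹ * G y).trace = 4 := by
    rw [h.inv_mul hy, Matrix.trace_one]
    norm_num
  rw [← h1]
  simp only [Matrix.trace, Matrix.diag, Matrix.mul_apply]
  exact Finset.sum_congr rfl fun a _ => Finset.sum_congr rfl fun b _ => by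
    rw [h.symm_apply hy a b]

theorem sum_mul_ricciUp (v : Fin 4 → ℝ) (c : Fin 4) :
    ∑ a, v a * ricciUp G y a c = ip G v (fun e => ricci G e c y) y := by
  simp only [ricciUp, Matrix.mul_apply, ip, dotProduct, Matrix.mulVec]
  rfl

/-- The antisymmetries in both index pairs move the contraction to the second and fourth indices. In
this form Ric acting on a covector is a trace of the Ricci identity. -/
theorem IsMetricOn.ricciUp_eq_sum (h : IsMetricOn G U) (hy : y ∈ U) (a c : Fin 4) :
    ricciUp G y a c = ∑ m, ∑ b, (G y)⁻¹ m b * riemann G a b c m y := by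
  rw [← h.riemannUp_contract hy]
  refine Finset.sum_congr rfl fun m _ => ?_
  have h1 : riemannUp G m c y m a = -riemannUp G m c y a m :=
    congrFun (congrFun (h.riemannUp_skew hy m c) a) m
  have h2 : riemannUp G m c y = -riemannUp G c m y := by
    rw [riemannUp, IsMetricOn.riemannMatrix_antisymm, Matrix.neg_mul]
    rfl
  rw [h1, h2, Matrix.neg_apply, neg_neg]
  simp only [riemannUp, Matrix.mul_apply]
  refine Finset.sum_congr rfl fun b _ => ?_
  rw [h.inv_symm_apply hy b m, mul_comm]
  rfl

variable {τ : Fin 4 → E4 → ℝ} {H : E4 → ℝ}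

theorem IsMetricOn.sum_inv_mul_proj (h : IsMetricOn G U) (hy : y ∈ U)
    (hunit : ip G (fun a => τ a y) (fun a => τ a y) y = -1) :
    ∑ a, ∑ b, (G y)⁻¹ a b * proj G τ a b y = 3 := by
  simp only [proj, mul_add, Finset.sum_add_distrib]
  rw [h.sum_inv_mul_metric hy, sum_inv_mul (fun a => τ a y) (fun b => τ b y), hunit]
  norm_num

theorem IsMetricOn.ip_proj_eq_zero (h : IsMetricOn G U) (hy : y ∈ U)
    (hunit : ip G (fun a => τ a y) (fun a => τ a y) y = -1) (c : Fin 4) :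
    ip G (fun b => proj G τ c b y) (fun a => τ a y) y = 0 := by
  simp only [proj, ip_add_left, h.ip_metric_left hy, ip_mul_left, hunit]
  ring

/-- A concircular unit timelike covector field is an eigenvector of the Ricci tensor. -/
theorem IsMetricOn.ip_ricci_of_covVec_eq (h : IsMetricOn G U) (hy : y ∈ U)
    (hτ : ∀ a, ContDiffOn ℝ ∞ (τ a) U) (hH : ContDiffOn ℝ ∞ H U)
    (hunit : ip G (fun a => τ a y) (fun a => τ a y) y = -1)
    (hcov : ∀ z ∈ U, ∀ c b, covVec G τ c b z = H z * proj G τ c b z) {η : ℝ}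
    (hη : ∀ a, pd a H y = η * τ a y) (c : Fin 4) :
    ip G (fun a => τ a y) (fun e => ricci G e c y) y = 3 * (H y ^ 2 - η) * τ c y := by
  have h1 : ∀ m b, (∑ a, τ a y * ((G y)⁻¹ m b * riemann G a b c m y))
      = (H y ^ 2 - η) * τ c y * ((G y)⁻¹ m b * proj G τ m b y)
        - (H y ^ 2 - η) * ((G y)⁻¹ m b * (τ m y * proj G τ c b y)) := by
    intro m b
    have h2 := h.sum_riemann_of_covVec_eq hy hτ hH hcov b c m
    rw [hη, hη] at h2
    have h3 : ∑ a, τ a y * ((G y)⁻¹ m b * riemann G a b c m y)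
        = (G y)⁻¹ m b * ∑ a, τ a y * riemann G a b c m y := by
      rw [Finset.mul_sum]
      exact Finset.sum_congr rfl fun a _ => by ring
    rw [h3, h2]
    ring
  rw [← sum_mul_ricciUp]
  simp only [h.ricciUp_eq_sum hy, Finset.mul_sum]
  rw [Finset.sum_comm]
  have h4 : ∀ m, ∑ a, ∑ b, τ a y * ((G y)⁻¹ m b * riemann G a b c m y)
      = ∑ b, ((H y ^ 2 - η) * τ c y * ((G y)⁻¹ m b * proj G τ m b y)
        - (H y ^ 2 - η) * ((G y)⁻¹ m b * (τ m y * proj G τ c b y))) := by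
    intro m
    rw [Finset.sum_comm]
    exact Finset.sum_congr rfl fun b _ => h1 m b
  rw [Finset.sum_congr rfl fun m _ => h4 m]
  simp only [Finset.sum_sub_distrib, ← Finset.mul_sum]
  rw [h.sum_inv_mul_proj hy hunit, sum_inv_mul (fun m => τ m y) (fun b => proj G τ c b y),
    h.ip_symm hy, h.ip_proj_eq_zero hy hunit]
  ring

end Contraction

namespace EinsteinFluidChart

variable {G : E4 → Matrix (Fin 4) (Fin 4) ℝ} {U : Set E4} {u : Fin 4 → E4 → ℝ} {F h : E4 → ℝ}
  {y : E4} {τ : Fin 4 → E4 → ℝ} {H : E4 → ℝ}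

/-- A covector orthogonal to u is spacelike or zero, so it cannot have norm -1. -/
theorem ip_velocity_ne_zero (hf : EinsteinFluidChart G U u F h) (hy : y ∈ U) {v : Fin 4 → ℝ}
    (hv : ip G v v y = -1) : ip G v (fun a => u a y) y ≠ 0 := by
  obtain ⟨f, fr⟩ := hf.frame y hy
  rw [hf.metric.ip_symm hy, fr.sum_velocity_ip]
  intro h0
  rw [ip, fr.dotProduct_inv] at hv
  simp [Fin.sum_univ_four, mink, h0] at hv
  nlinarith [mul_self_nonneg (hat f v 1), mul_self_nonneg (hat f v 2), mul_self_nonneg (hat f v 3)]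

/-- Applying Ric = F u⊗u + h g to the eigenvector τ shows that F⟨τ, u⟩u is a multiple of τ. As F⟨τ,
u⟩ ≠ 0, u is proportional to τ, and both have norm -1. The sign of u stays open, but Ric only
contains u⊗u. -/
theorem velocity_mul_eq (hf : EinsteinFluidChart G U u F h) (hy : y ∈ U)
    (hτ : ∀ a, ContDiffOn ℝ ∞ (τ a) U) (hH : ContDiffOn ℝ ∞ H U)
    (hunit : ip G (fun a => τ a y) (fun a => τ a y) y = -1)
    (hcov : ∀ z ∈ U, ∀ c b, covVec G τ c b z = H z * proj G τ c b z) {η : ℝ}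
    (hη : ∀ a, pd a H y = η * τ a y) (a b : Fin 4) :
    u a y * u b y = τ a y * τ b y := by
  set κ := ip G (fun a => τ a y) (fun a => u a y) y with hκ
  have hκ0 : F y * κ ≠ 0 := mul_ne_zero (hf.ne_zero y hy) (hf.ip_velocity_ne_zero hy hunit)
  have h1 : ∀ c, u c y = (3 * (H y ^ 2 - η) - h y) / (F y * κ) * τ c y := by
    intro c
    have h2 := hf.metric.ip_ricci_of_covVec_eq hy hτ hH hunit hcov hη c
    have h3 : ∀ e, ricci G e c y = F y * u c y * u e y + h y * G y c e := by
      intro e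
      rw [hf.ricci_eq y hy, hf.metric.symm_apply hy c e]
      ring
    simp only [h3] at h2
    rw [ip_add_right, ip_mul_right, ip_mul_right,
      hf.metric.ip_symm hy _ (fun e => G y c e), hf.metric.ip_metric_left hy, ← hκ] at h2
    rw [div_mul_eq_mul_div, eq_div_iff hκ0]
    linear_combination h2
  set r := (3 * (H y ^ 2 - η) - h y) / (F y * κ) with hr
  have h4 := hf.ip_velocity hy
  simp only [h1] at h4
  rw [ip_mul_left, ip_mul_right, hunit] at h4
  rw [h1 a, h1 b]
  linear_combination (-τ a y * τ b y) * h4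

/-- With u⊗u replaced by τ⊗τ, ∇Ric is known up to dh. The contracted Bianchi identity supplies dh =
F H τ, after which ∇Ric is totally symmetric. -/
theorem fluidChart_of_covVec_eq (hf : EinsteinFluidChart G U u F h)
    (hτ : ∀ a, ContDiffOn ℝ ∞ (τ a) U) (hH : ContDiffOn ℝ ∞ H U)
    (hunit : ∀ z ∈ U, ip G (fun a => τ a z) (fun a => τ a z) z = -1)
    (hcov : ∀ z ∈ U, ∀ c b, covVec G τ c b z = H z * proj G τ c b z)
    (hη : ∀ z ∈ U, ∃ η, ∀ a, pd a H z = η * τ a z)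
    (hFh : ∀ z ∈ U, ∀ a, pd a F z = 4 * pd a h z) : FluidChart G U u F h where
  toEinsteinFluidChart := hf
  codazzi y hy := by
    have hric : ∀ z ∈ U, ∀ a b, ricci G a b z = F z * (τ a z * τ b z) + h z * G z a b := by
      intro z hz a b
      obtain ⟨η, hη⟩ := hη z hz
      rw [hf.ricci_eq z hz, hf.velocity_mul_eq hz hτ hH (hunit z hz) hcov hη]
    have hdτ := fun a => differentiableAt_of_contDiffOn hf.metric.isOpen (hτ a) hy
    have hdF := hf.differentiableAt_F hy
    have hdh := hf.differentiableAt_h hy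
    have hcr : ∀ a b c, covRicci G a b c y = 4 * pd a h y * (τ b y * τ c y)
        + F y * H y * (proj G τ a b y * τ c y + τ b y * proj G τ a c y)
        + pd a h y * G y b c := by
      intro a b c
      rw [hf.metric.covRicci_of_ricci_eq hy hdτ hdF hdh hric, hFh y hy, hcov y hy, hcov y hy]
      ring
    set s := ip G (fun a => pd a h y) (fun a => τ a y) y with hs
    -- The equation of state makes the scalar curvature constant, so the divergence of Ric vanishes.
    -- The coefficient 3 is the trace of P.
    have hdiv : ∀ d, 4 * s * τ d y + 3 * F y * H y * τ d y + pd d h y = 0 := by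
      intro d
      have h1 := hf.metric.divergence_ricci hy d
      have h2 : (pdMatrix d (ricciUp G) y).trace = pd d (fun z => -F z + 4 * h z) y := by
        rw [pd_congr_of_eqOn hf.metric.isOpen (fun z hz => (hf.trace_ricciUp hz).symm) hy]
        exact (pd_sum _ fun i _ =>
          hf.metric.smooth_ricciUp.differentiableAt hf.metric.isOpen hy i i).symm
      rw [h2, pd_add hdF.fun_neg (hdh.const_mul 4), pd_neg, pd_const_mul _ hdh, hFh y hy,
        neg_add_cancel] at h1
      have h3 : ∑ a, ((G y)⁻¹ * covRicciMatrix G a y) a d = ∑ a, ∑ b,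
          (4 * τ d y * ((G y)⁻¹ a b * (pd a h y * τ b y))
          + F y * H y * τ d y * ((G y)⁻¹ a b * proj G τ a b y)
          + F y * H y * ((G y)⁻¹ a b * (proj G τ d a y * τ b y))
          + (G y)⁻¹ a b * (pd a h y * G y d b)) := by
        refine Finset.sum_congr rfl fun a _ => ?_
        rw [Matrix.mul_apply]
        refine Finset.sum_congr rfl fun b _ => ?_
        change (G y)⁻¹ a b * covRicci G a b d y = _
        have h4 : proj G τ a d y = proj G τ d a y := by
          simp only [proj, hf.metric.symm_apply hy a d]
          ring
        rw [hcr, hf.metric.symm_apply hy d b, h4]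
        ring
      rw [h3] at h1
      simp only [Finset.sum_add_distrib, ← Finset.mul_sum] at h1
      rw [sum_inv_mul (fun a => pd a h y) (fun b => τ b y),
        hf.metric.sum_inv_mul_proj hy (hunit y hy),
        sum_inv_mul (fun a => proj G τ d a y) (fun b => τ b y),
        hf.metric.ip_proj_eq_zero hy (hunit y hy),
        sum_inv_mul (fun a => pd a h y) (fun b => G y d b), hf.metric.ip_symm hy _ (fun b => G y d b),
        hf.metric.ip_metric_left hy, ← hs] at h1
      linear_combination h1 / 2
    -- Contraction with τ gives s = 4s + 3 F H.
    have hs' : s = -(F y * H y) := by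
      have h1 : ∀ d, pd d h y = -(4 * s + 3 * F y * H y) * τ d y := fun d => by
        linear_combination hdiv d
      have h2 := hs
      simp only [h1] at h2
      rw [ip_mul_left, hunit y hy] at h2
      linear_combination -h2 / 3
    have hph : ∀ d, pd d h y = F y * H y * τ d y := fun d => by
      have := hdiv d
      rw [hs'] at this
      linear_combination this
    -- Now ∇Ric is F H times 6 τ⊗τ⊗τ plus the three terms of type g⊗τ, which is symmetric in all
    -- indices.
    intro a b c
    rw [hcr, hcr, hph, hph]
    simp only [proj]
    rw [hf.metric.symm_apply hy b a]
    ring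

end EinsteinFluidChart

/-! ### The time direction of a Robertson-Walker metric -/

/-- For g = -dt² + B Σ dx_i², the contraction of the Christoffel symbols with dt reduces, by
orthogonality, to the Hessian of t and ⟨dt, dB⟩. The Hessian term cancels in ∇dt. The φ_i are
functions in an arbitrary chart, so the result needs no change of coordinates. -/
theorem covVec_time_of_warped {G : E4 → Matrix (Fin 4) (Fin 4) ℝ} {U : Set E4}
    (hG : IsMetricOn G U) {φ : Fin 4 → E4 → ℝ} {B : E4 → ℝ}
    (hφ : ∀ i, ContDiffOn ℝ ∞ (φ i) U) (hB : ContDiffOn ℝ ∞ B U)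
    (hmet : ∀ z ∈ U, ∀ a b, G z a b = -(pd a (φ 0) z * pd b (φ 0) z)
      + B z * (pd a (φ 1) z * pd b (φ 1) z + pd a (φ 2) z * pd b (φ 2) z
        + pd a (φ 3) z * pd b (φ 3) z)) {y : E4} (hy : y ∈ U)
    (hunit : ip G (fun a => pd a (φ 0) y) (fun a => pd a (φ 0) y) y = -1)
    (horth : ∀ i, i ≠ 0 → ip G (fun a => pd a (φ 0) y) (fun a => pd a (φ i) y) y = 0) {H : ℝ}
    (hHB : ip G (fun a => pd a (φ 0) y) (fun a => pd a B y) y = 2 * H * B y) (c b : Fin 4) :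
    covVec G (fun a => pd a (φ 0)) c b y = H * proj G (fun a => pd a (φ 0)) c b y := by
  have hs : ∀ i a, ContDiffOn ℝ ∞ (pd a (φ i)) U := fun i a => contDiffOn_pd hG.isOpen (hφ i)
  have hd : ∀ i a, DifferentiableAt ℝ (pd a (φ i)) y := fun i a =>
    differentiableAt_of_contDiffOn hG.isOpen (hs i a) hy
  have hdB := differentiableAt_of_contDiffOn hG.isOpen hB hy
  have hpG : ∀ c a b, pd c (fun z => G z a b) y
      = -(pd c (pd a (φ 0)) y * pd b (φ 0) y + pd a (φ 0) y * pd c (pd b (φ 0)) y)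
        + (pd c B y * (pd a (φ 1) y * pd b (φ 1) y + pd a (φ 2) y * pd b (φ 2) y
          + pd a (φ 3) y * pd b (φ 3) y)
        + B y * (pd c (pd a (φ 1)) y * pd b (φ 1) y + pd a (φ 1) y * pd c (pd b (φ 1)) y
          + (pd c (pd a (φ 2)) y * pd b (φ 2) y + pd a (φ 2) y * pd c (pd b (φ 2)) y)
          + (pd c (pd a (φ 3)) y * pd b (φ 3) y + pd a (φ 3) y * pd c (pd b (φ 3)) y))) := by
    intro c a b
    have m := fun i => (hd i a).fun_mul (hd i b)
    have m3 := ((m 1).fun_add (m 2)).fun_add (m 3)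
    rw [pd_congr_of_eqOn hG.isOpen (fun z hz => hmet z hz a b) hy,
      pd_add (m 0).fun_neg (hdB.fun_mul m3), pd_neg, pd_mul (hd 0 a) (hd 0 b), pd_mul hdB m3,
      pd_add ((m 1).fun_add (m 2)) (m 3), pd_add (m 1) (m 2), pd_mul (hd 1 a) (hd 1 b),
      pd_mul (hd 2 a) (hd 2 b), pd_mul (hd 3 a) (hd 3 b)]
  have hcomm : ∀ i c a, pd c (pd a (φ i)) y = pd a (pd c (φ i)) y := fun i c a =>
    pd_comm hG.isOpen (hφ i) hy
  have hchr : ∑ e, christoffel G e c b y * pd e (φ 0) y = 1 / 2 * ip G (fun a => pd a (φ 0) y)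
      (fun l => pd c (fun z => G z l b) y + pd b (fun z => G z l c) y
        - pd l (fun z => G z c b) y) y := by
    simp only [christoffel, ip, dotProduct, Matrix.mulVec, Finset.mul_sum, Finset.sum_mul]
    exact Finset.sum_congr rfl fun e _ => Finset.sum_congr rfl fun l _ => by ring
  have hbr : ∀ l, pd c (fun z => G z l b) y + pd b (fun z => G z l c) y - pd l (fun z => G z c b) y
      = -2 * pd c (pd b (φ 0)) y * pd l (φ 0) y
        + (2 * B y * pd c (pd b (φ 1)) y + pd c B y * pd b (φ 1) y + pd b B y * pd c (φ 1) y)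
          * pd l (φ 1) y
        + (2 * B y * pd c (pd b (φ 2)) y + pd c B y * pd b (φ 2) y + pd b B y * pd c (φ 2) y)
          * pd l (φ 2) y
        + (2 * B y * pd c (pd b (φ 3)) y + pd c B y * pd b (φ 3) y + pd b B y * pd c (φ 3) y)
          * pd l (φ 3) y
        + -(pd c (φ 1) y * pd b (φ 1) y + pd c (φ 2) y * pd b (φ 2) y
          + pd c (φ 3) y * pd b (φ 3) y) * pd l B y := by
    intro l
    rw [hpG, hpG, hpG, hcomm 0 l c, hcomm 0 l b, hcomm 1 l c, hcomm 1 l b, hcomm 2 l c,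
      hcomm 2 l b, hcomm 3 l c, hcomm 3 l b, hcomm 0 b c, hcomm 1 b c, hcomm 2 b c, hcomm 3 b c]
    ring
  rw [covVec, hchr]
  simp only [hbr]
  simp only [ip_add_right, ip_mul_right]
  rw [hunit, horth 1 (by decide), horth 2 (by decide), horth 3 (by decide), hHB, proj,
    hmet y hy]
  ring


/-! ### Robertson-Walker with the equation of state implies Yang pure -/

open Set Matrix Metric

theorem EinsteinFluidChart.mono {G : E4 → Matrix (Fin 4) (Fin 4) ℝ} {U U' : Set E4}
    {u : Fin 4 → E4 → ℝ} {F h : E4 → ℝ} (hf : EinsteinFluidChart G U u F h) (hU' : IsOpen U')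
    (hs : U' ⊆ U) : EinsteinFluidChart G U' u F h where
  metric := hf.metric.mono hU' hs
  smooth_velocity a := (hf.smooth_velocity a).mono hs
  smooth_F := hf.smooth_F.mono hs
  smooth_h := hf.smooth_h.mono hs
  ne_zero y hy := hf.ne_zero y (hs hy)
  frame y hy := hf.frame y (hs hy)
  ricci_eq y hy := hf.ricci_eq y (hs hy)

theorem pd_comp {f : ℝ → ℝ} {t : E4 → ℝ} {y : E4} (hf : DifferentiableAt ℝ f (t y))
    (ht : DifferentiableAt ℝ t y) (a : Fin 4) :
    pd a (fun z => f (t z)) y = deriv f (t y) * pd a t y := by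
  have h1 := hf.hasDerivAt.comp_hasFDerivAt y ht.hasFDerivAt
  have h2 : fderiv ℝ (fun z => f (t z)) y = deriv f (t y) • fderiv ℝ t y := h1.fderiv
  rw [pd, h2]
  rfl

section Manifold

variable {M : Type*} [TopologicalSpace M] [ChartedSpace E4 M] [IsManifold (𝓡 4) ∞ M]
  {g : LorentzMetric M} {u : (x : M) → TangentSpace (𝓡 4) x} {μ p : M → ℝ}

/-- The given chart is kept, and the Robertson-Walker coordinates enter only as functions on the
overlap. Their time differential is the concircular covector required by `fluidChart_of_covVec_eq`.
-/
theorem isYangPureSpace_of_isRobertsonWalker (hf : g.IsPerfectFluid u μ p)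
    (hμp : ∀ x, μ x + p x ≠ 0) (hrw : g.IsRobertsonWalker) {c : ℝ}
    (hc : ∀ x, p x = (1 / 3 : ℝ) * μ x + c) : g.IsYangPureSpace := by
  intro e he y hy
  obtain ⟨k, -, hk⟩ := hrw
  obtain ⟨e', he', hx', A, hA⟩ := hk (e.symm y)
  set W := e.target ∩ e.symm ⁻¹' e'.source with hW
  have hWo : IsOpen W := e.symm.isOpen_inter_preimage e'.open_source
  have hyW : y ∈ W := ⟨hy, hx'⟩
  have hE := (hf.einsteinFluidChart hμp he).mono hWo inter_subset_left
  set G := g.comp e with hG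
  have hM : IsMetricOn G W := hE.metric
  set Φ : E4 → E4 := fun z => e' (e.symm z) with hΦ
  have hΦs : ContDiffOn ℝ ∞ Φ W := contDiffOn_transition he he'
  have hΦW : ∀ z ∈ W, Φ z ∈ e'.target := fun z hz => e'.map_source hz.2
  set φ : Fin 4 → E4 → ℝ := fun i z => Φ z i with hφ
  have hφs : ∀ i, ContDiffOn ℝ ∞ (φ i) W := contDiffOn_euclidean.1 hΦs
  have hdφ : ∀ i, ∀ z ∈ W, DifferentiableAt ℝ (φ i) z := fun i z hz =>
    differentiableAt_of_contDiffOn hWo (hφs i) hz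
  have hApos : ∀ z ∈ W, 0 < A (φ 0 z) := fun z hz => (hA _ (hΦW z hz)).1
  have hAs : ∀ z ∈ W, ContDiffAt ℝ ∞ A (φ 0 z) := fun z hz => (hA _ (hΦW z hz)).2.1
  set w : E4 → ℝ := fun z => 1 + k / 4 * (φ 1 z ^ 2 + φ 2 z ^ 2 + φ 3 z ^ 2) with hw
  have hwpos : ∀ z ∈ W, 0 < w z := fun z hz => (hA _ (hΦW z hz)).2.2.1
  have hws : ContDiffOn ℝ ∞ w W := contDiffOn_const.add (contDiffOn_const.mul
    ((((hφs 1).pow 2).add ((hφs 2).pow 2)).add ((hφs 3).pow 2)))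
  have hAφ : ContDiffOn ℝ ∞ (fun z => A (φ 0 z)) W := fun z hz =>
    ((hAs z hz).comp z ((hφs 0).contDiffAt (hWo.mem_nhds hz))).contDiffWithinAt
  have hA' : ∀ z ∈ W, ContDiffAt ℝ ∞ (deriv A) (φ 0 z) := fun z hz =>
    ((hAs z hz).fderiv_right (m := ∞) (by simp)).clm_apply contDiffAt_const
  have hA'φ : ContDiffOn ℝ ∞ (fun z => deriv A (φ 0 z)) W := fun z hz =>
    ((hA' z hz).comp z ((hφs 0).contDiffAt (hWo.mem_nhds hz))).contDiffWithinAt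
  set B : E4 → ℝ := fun z => A (φ 0 z) ^ 2 / w z ^ 2 with hB
  have hBs : ContDiffOn ℝ ∞ B W :=
    (hAφ.pow 2).div (hws.pow 2) fun z hz => pow_ne_zero _ (hwpos z hz).ne'
  -- The sign is that of the covector τ = dt, which is opposite to the velocity u = -dt; also ⟨dt,
  -- dt⟩ = -1.
  set H : E4 → ℝ := fun z => -(deriv A (φ 0 z) / A (φ 0 z)) with hH
  have hHs : ContDiffOn ℝ ∞ H W := (hA'φ.div hAφ fun z hz => (hApos z hz).ne').neg
  have hGJ : ∀ z ∈ W, G z = (jacobian Φ z)ᵀ * rwMatrix k A (Φ z) * jacobian Φ z := by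
    intro z hz
    rw [hG, comp_change_chart g he he' hz.1 hz.2, (hA _ (hΦW z hz)).2.2.2]
  have hmet : ∀ z ∈ W, ∀ a b, G z a b = -(pd a (φ 0) z * pd b (φ 0) z)
      + B z * (pd a (φ 1) z * pd b (φ 1) z + pd a (φ 2) z * pd b (φ 2) z
        + pd a (φ 3) z * pd b (φ 3) z) := by
    intro z hz a b
    rw [hGJ z hz]
    have h1 : ∀ i j, jacobian Φ z i j = pd j (φ i) z := fun i j => rfl
    simp only [rwMatrix, Matrix.mul_apply, Matrix.transpose_apply, h1,
      Fin.sum_univ_four]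
    simp [hB, hw, hφ]
    ring
  have hip : ∀ z ∈ W, ∀ i j, ip G (fun a => pd a (φ i) z) (fun a => pd a (φ j) z) z
      = (rwMatrix k A (Φ z))⁻¹ i j := by
    intro z hz i j
    have h1 := hM.det_ne_zero z hz
    have h2 := hGJ z hz
    have hJ : (jacobian Φ z).det ≠ 0 := by
      intro h0
      rw [h2, Matrix.det_mul, h0, mul_zero] at h1
      exact h1 rfl
    have hJu : IsUnit (jacobian Φ z).det := isUnit_iff_ne_zero.2 hJ
    have hJt : IsUnit (jacobian Φ z)ᵀ.det := by rwa [Matrix.det_transpose]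
    have h3 : jacobian Φ z * (G z)⁻¹ * (jacobian Φ z)ᵀ = (rwMatrix k A (Φ z))⁻¹ := by
      rw [h2, Matrix.mul_inv_rev, Matrix.mul_inv_rev, ← Matrix.mul_assoc,
        Matrix.mul_nonsing_inv _ hJu, Matrix.one_mul, Matrix.nonsing_inv_mul_cancel_right _ _ hJt]
    rw [← h3, Matrix.mul_assoc]
    simp only [ip, Matrix.mul_apply, dotProduct, Matrix.mulVec, Matrix.transpose_apply]
    rfl
  have hrwinv := fun z hz => rwMatrix_inv (hApos z hz) (hwpos z hz)
  have hunit : ∀ z ∈ W, ip G (fun a => pd a (φ 0) z) (fun a => pd a (φ 0) z) z = -1 := by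
    intro z hz
    rw [hip z hz, hrwinv z hz, Matrix.diagonal_apply_eq, if_pos rfl]
  have horth : ∀ z ∈ W, ∀ i, i ≠ 0 →
      ip G (fun a => pd a (φ 0) z) (fun a => pd a (φ i) z) z = 0 := by
    intro z hz i hi
    rw [hip z hz, hrwinv z hz, Matrix.diagonal_apply_ne _ (Ne.symm hi)]
  have hHB : ∀ z ∈ W, ip G (fun a => pd a (φ 0) z) (fun a => pd a B z) z = 2 * H z * B z := by
    intro z hz
    have hdB := differentiableAt_of_contDiffOn hWo hBs hz
    have hdw := differentiableAt_of_contDiffOn hWo hws hz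
    have hdA := differentiableAt_of_contDiffOn hWo hAφ hz
    have hpw : ∀ a, pd a w z = k / 2 * φ 1 z * pd a (φ 1) z + k / 2 * φ 2 z * pd a (φ 2) z
        + k / 2 * φ 3 z * pd a (φ 3) z := by
      intro a
      have m := fun i => (hdφ i z hz).fun_mul (hdφ i z hz)
      have m3 := ((m 1).fun_add (m 2)).fun_add (m 3)
      have h1 : w = fun z => 1 + k / 4 * (φ 1 z * φ 1 z + φ 2 z * φ 2 z + φ 3 z * φ 3 z) := by
        funext z
        simp only [hw, sq]
      rw [h1, pd_add (differentiableAt_const _) (m3.const_mul _), pd_const, pd_const_mul _ m3,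
        pd_add ((m 1).fun_add (m 2)) (m 3), pd_add (m 1) (m 2), pd_mul (hdφ 1 z hz) (hdφ 1 z hz),
        pd_mul (hdφ 2 z hz) (hdφ 2 z hz), pd_mul (hdφ 3 z hz) (hdφ 3 z hz)]
      ring
    have hw0 := (hwpos z hz).ne'
    -- Differentiating B w² = A² yields dB without a quotient rule.
    have hBw : ∀ z ∈ W, B z * (w z * w z) = A (φ 0 z) * A (φ 0 z) := by
      intro z hz
      have := (hwpos z hz).ne'
      simp only [hB]
      field_simp
    have hpB : ∀ a, pd a B z = 2 * A (φ 0 z) * deriv A (φ 0 z) / (w z * w z) * pd a (φ 0) z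
        + -(2 * B z / w z) * pd a w z := by
      intro a
      have h1 := pd_congr_of_eqOn (i := a) hWo hBw hz
      rw [pd_mul hdB (hdw.fun_mul hdw), pd_mul hdw hdw, pd_mul hdA hdA,
        pd_comp ((hAs z hz).differentiableAt (by simp)) (hdφ 0 z hz)] at h1
      field_simp
      linear_combination h1
    simp only [hpB, hpw]
    simp only [ip_add_right, ip_mul_right]
    rw [hunit z hz, horth z hz 1 (by decide), horth z hz 2 (by decide), horth z hz 3 (by decide)]
    have := (hApos z hz).ne'
    simp only [hH, hB]
    field_simp
    ring
  have hF := hE.fluidChart_of_covVec_eq (τ := fun a => pd a (φ 0)) (H := H)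
    (fun a => contDiffOn_pd hWo (hφs 0)) hHs hunit
    (fun z hz c b => covVec_time_of_warped hM hφs hBs hmet hz (hunit z hz) (horth z hz)
      (hHB z hz) c b)
    (fun z hz => ⟨deriv (fun s => -(deriv A s / A s)) (φ 0 z), fun a =>
      pd_comp (f := fun s => -(deriv A s / A s)) ((((hA' z hz).differentiableAt (by simp)).div
        ((hAs z hz).differentiableAt (by simp)) (hApos z hz).ne').neg) (hdφ 0 z hz) a⟩)
    (fun z hz a => by
      have hdh := hE.differentiableAt_h hz
      -- The equation of state in the form F = 4h + 24πc.
      have h1 : (fun z => 8 * Real.pi * (μ (e.symm z) + p (e.symm z)))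
          = fun z => 4 * (4 * Real.pi * (μ (e.symm z) - p (e.symm z))) + 24 * Real.pi * c := by
        funext z
        rw [hc]
        ring
      rw [h1, pd_add (hdh.const_mul 4) (differentiableAt_const _), pd_const, add_zero,
        pd_const_mul _ hdh])
  intro a b c'
  exact sub_eq_zero.2 (hF.codazzi y hyW a b c')

end Manifold

end YangPure

theorem theoremt {M : Type*} [TopologicalSpace M] [ConnectedSpace M]
    [ChartedSpace YangPure.E4 M] [IsManifold (𝓡 4) ∞ M]
    (g : YangPure.LorentzMetric M) (u : (x : M) → TangentSpace (𝓡 4) x) (μ p : M → ℝ)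
    (hfluid : g.IsPerfectFluid u μ p) (hμp : ∀ x, μ x + p x ≠ 0) :
    g.IsYangPureSpace ↔
      (g.IsRobertsonWalker ∧ ∃ c : ℝ, ∀ x, p x = (1 / 3 : ℝ) * μ x + c) := by
  constructor
  · intro hY
    exact ⟨YangPure.isRobertsonWalker_of_isYangPureSpace hfluid hμp hY,
      YangPure.exists_eos_of_isYangPureSpace hfluid hμp hY⟩
  · rintro ⟨hrw, c, hc⟩
    exact YangPure.isYangPureSpace_of_isRobertsonWalker hfluid hμp hrw hc
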